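/- **Setting.** Squares of the infinite chessboard are identified with points of $\mathbb{Z}^2$. An $(r,s)$-leaper moves from $(x,y)$ to $(x\pm r,y\pm s)$ and $(x\pm s,y\pm r)$; it is skew if $r,s\neq0$ and $r\ne s$. Let $A_1,\dots,A_8$ be the matrices $\left(\begin{smallmatrix}0&1\\1&0\end{smallmatrix}\right)$, $\left(\begin{smallmatrix}1&0\\0&1\end{smallmatrix}\right)$, $\left(\begin{smallmatrix}-1&0\\0&1\end{smallmatrix}\right)$, $\left(\begin{smallmatrix}0&-1\\1&0\end{smallmatrix}\right)$ and $A_{i+4}=-A_i$ for $i=1,\dots,4$. A move $v$ of a skew $(p,q)$-leaper, $p<q$, has direction $i$ if $v^T=A_i\left(\begin{smallmatrix}p\\q\end{smallmatrix}\right)$. A *direction graph* is a symmetric directed graph with arcs labeled by $1,\dots,8$ such that the sum of the matrices $A_i$ over the labels of every simple directed cycle is zero. Two direction graphs *coincide* if there is a bijection of their vertex sets preserving arcs and labels. A permutation $\pi$ of $\{1,\dots,8\}$ is an *equivalence permutation* if there are real $2\times2$ matrices $P,Q$ with $A_{\pi(i)}=PA_iQ$ for all $i$; two direction graphs are *equivalent*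 if relabeling the first by some equivalence permutation gives the second. A direction graph is *extracted from* a graph $G$ whose vertices are squares and whose edges are moves of a skew leaper if there is a bijection of vertex sets under which arcs labeled $i$ correspond to the moves of direction $i$ along edges of $G$. Consider cycles partitioned into eight paths $a^{E}a^{NE}a^{N}\cdots a^{SE}$, and write $-w$ for the reversal of a path $w$. For parameters $(p,q)$, the four lifts $b^Eb^{NE}\cdots b^{SE}$ are given by * $f$: $b^E=-a^{SW}{-a^W}{-a^{NW}}+(p+q,0)$, $b^{NE}=a^{NE}+(p,p)$, new parameters $(p,2p+q)$; * $g$: $b^E=a^E+(q-p,0)$, $b^{NE}=-a^S{-a^{SW}}{-a^W}+(q,q)$, new parameters $(q,2q-p)$; * $h$: $b^E=-a^S{-a^{SW}}{-a^W}{-a^{NW}}{-a^N}+(p+q,0)$, $b^{NE}=a^Ea^{NE}a^N+(q,q)$, new parameters $(q,p+2q)$; * $\hbar$: $b^E=a^{SE}a^Ea^{NE}+(p+q,0)$, $b^{NE}=-a^{SE}{-a^S}{-a^{SW}}{-a^W}{-a^{NW}}+(q,q)$, new parameters $(q,p+2q)$, the other six paths being defined symmetrically (by rotation through multiples of $90^\circ$).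 For a skew $(r,s)$-leaper $M$, $r<s$, the initial cycle of type $o\in\{f,g,h\}$ consists of eight one-square paths, obtained by rotation from the squares in the sections $E$, $NE$: these are $(r+s,0),(r,r)$ for $o=f$; $(s-r,0),(s,s)$ for $o=g$; $(r+s,0),(s,s)$ for $o=h$. Its parameters are $(r,2r+s)$, $(s,2s-r)$, $(s,r+2s)$, respectively. For a string $e=e_1\cdots e_l$ over $\{f,g,h,\hbar\}$, lifting the initial cycle of type $o$ successively by $e_l,\dots,e_1$ gives a cycle $D^M_o(e)$ of $M$, with final parameters $(p,q)$; let $C^M_o(e)$ be the graph on the squares of $D^M_o(e)$ whose edges are all pairs of these squares joined by a move of a $(p,q)$-leaper. A *fundamental direction cycle of descent $e$* is a direction graph extracted from $C^M_o(e)$ for some skew $M$ and some $o$; a *second fundamental direction cycle of origin $o$ and descent $e$* is a direction graph extracted from the cycle $D^M_o(e)$ for some skew $M$. The *companion* of a string is obtained by exchanging $f\leftrightarrow g$ and $h\leftrightarrow\hbar$. **Theorem.** 1. For all skew $M$, all $o\in\{f,g,h\}$ and all strings $e$ over $\{f,g,h,\hbar\}$, direction graphs can be extracted from $C^M_o(e)$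 and from $D^M_o(e)$. 2. Two fundamental direction cycles, of descents $e'$ and $e''$, coincide if and only if $e'=e''$. 3. Two fundamental direction cycles, of descents $e'$ and $e''$, are equivalent if and only if either $e'=e''$ or $e'$ and $e''$ are companions. 4. Let $\Phi$ be a fundamental direction cycle, or a second fundamental direction cycle of any origin, of descent $e$. Then $\Phi$ is not equivalent to any fundamental direction cycle, nor to any second fundamental direction cycle of origin $g$ or $h$, whose descent is a string over $\{f,g,h\}$, if and only if $e$ contains both $h$ and $\hbar$. -/

import Mathlib

namespace LeaperGraphs

/-! ## Skew directions, direction matrices, direction graphs -/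

/-- Squares of the infinite chessboard; a square is identified with the integer coordinates of
its center. -/
abbrev Square := ℤ × ℤ

/-- The eight skew directions, numbered counterclockwise from east-northeast. The element `k`
stands for the direction usually labeled `k + 1`. -/
abbrev SkewDir := Fin 8

/-- The direction matrices, `A₁, …, A₈` in this order. -/
def dirMatrix : SkewDir → Matrix (Fin 2) (Fin 2) ℤ :=
  ![!![0, 1; 1, 0], !![1, 0; 0, 1], !![-1, 0; 0, 1], !![0, -1; 1, 0],
    !![0, -1; -1, 0], !![-1, 0; 0, -1], !![1, 0; 0, -1], !![0, 1; -1, 0]]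

/-- A direction graph: a symmetric directed graph whose arcs are labeled with skew directions so
that the sum of the direction matrices over every simple (directed) cycle vanishes. `Arc x i y`
says that there is an arc from `x` to `y` and that its label is `i`. A simple cycle of length
`n + 1` is an injective cyclic sequence of vertices (addition in `Fin (n + 1)` is cyclic); the two
arcs of a symmetric pair form one of length two. -/
structure DirectionGraph where
  /-- vertices -/
  V : Type
  /-- labeled arcs -/
  Arc : V → SkewDir → V → Prop
  label_unique : ∀ x y i j, Arc x i y → Arc x j y → i = j
  symm : ∀ x y i, Arc x i y → ∃ j, Arc y j x
  cycle_sum : ∀ (n : ℕ) (x : Fin (n + 1) → V) (i : Fin (n + 1) → SkewDir),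
    Function.Injective x → (∀ k, Arc (x k) (i k) (x (k + 1))) → ∑ k, dirMatrix (i k) = 0

/-- Two direction graphs coincide if some bijection between their vertices preserves the arcs
and their labels. -/
def DirectionGraph.Coincide (Φ Ψ : DirectionGraph) : Prop :=
  ∃ σ : Φ.V ≃ Ψ.V, ∀ x i y, Φ.Arc x i y ↔ Ψ.Arc (σ x) i (σ y)

/-- `π` is an equivalence permutation: it is induced by two real matrices `P` and `Q`. -/
def IsEquivalencePerm (π : Equiv.Perm SkewDir) : Prop :=
  ∃ P Q : Matrix (Fin 2) (Fin 2) ℝ, ∀ i,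
    (dirMatrix (π i)).map (fun z : ℤ => (z : ℝ)) =
      P * (dirMatrix i).map (fun z : ℤ => (z : ℝ)) * Q

/-- Two direction graphs are equivalent if relabeling the arcs of the first one by some
equivalence permutation gives the second one. -/
def DirectionGraph.Equivalent (Φ Ψ : DirectionGraph) : Prop :=
  ∃ π : Equiv.Perm SkewDir, IsEquivalencePerm π ∧
    ∃ σ : Φ.V ≃ Ψ.V, ∀ x i y, Φ.Arc x i y ↔ Ψ.Arc (σ x) (π i) (σ y)

/-! ## Leaper graphs and extraction of direction graphs -/

/-- A move of a `(p, q)`-leaper leads from `a` to `b`. -/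
def IsLeaperMove (p q : ℤ) (a b : Square) : Prop :=
  (|b.1 - a.1| = p ∧ |b.2 - a.2| = q) ∨ (|b.1 - a.1| = q ∧ |b.2 - a.2| = p)

/-- The leaper graph of a `(p, q)`-leaper over the board `B`. -/
def leaperGraph (p q : ℤ) (B : Set Square) : SimpleGraph B :=
  SimpleGraph.fromRel fun a b => IsLeaperMove p q a b

/-- A move of direction `i` of a skew `(p, q)`-leaper, `p < q`, leads from `a` to `b`. -/
def IsMoveOfDir (p q : ℤ) (i : SkewDir) (a b : Square) : Prop :=
  ![b.1 - a.1, b.2 - a.2] = (dirMatrix i).mulVec ![p, q]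

/-- `Φ` is extracted from the graph `G`, the vertices of which are the squares of `B` and the
edges of which are moves of a skew `(p, q)`-leaper, `p < q`. -/
def DirectionGraph.ExtractedFrom (Φ : DirectionGraph) (p q : ℤ) {B : Set Square}
    (G : SimpleGraph B) : Prop :=
  ∃ σ : B ≃ Φ.V, ∀ a b i,
    (G.Adj a b ∧ IsMoveOfDir p q i (a : Square) (b : Square)) ↔ Φ.Arc (σ a) i (σ b)

/-! ## Lifting transformations -/

/-- The characters of descents; `hbar` stands for `ħ`. -/
inductive LiftType
  | f
  | g
  | h
  | hbar

/-- The types of initial cycles. -/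
inductive OriginType
  | f
  | g
  | h

/-- The compass directions E, NE, N, NW, W, SW, S, SE, in this order. -/
def compass : Fin 8 → Square :=
  ![(1, 0), (1, 1), (0, 1), (-1, 1), (-1, 0), (-1, -1), (0, -1), (1, -1)]

/-- A cycle partitioned into eight paths `a^E, a^NE, …, a^SE`. -/
abbrev OctoPath := Fin 8 → List Square

/-- Translation of a path. -/
def shift (w : List Square) (v : Square) : List Square := w.map (· + v)

/-- The lift of type `t` of a `(p, q)`-perfect cycle with perfect partitioning `a`, together with
its partitioning. The path `-w` is `w.reverse`; the index `i + k` is `k` steps counterclockwise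
from `i`; the even indices are E, N, W, S and the odd ones NE, NW, SW, SE. -/
def lift (t : LiftType) (p q : ℤ) (a : OctoPath) : OctoPath := fun i =>
  match t with
  | .f =>
    if i.val % 2 = 0 then
      shift ((a (i + 5)).reverse ++ (a (i + 4)).reverse ++ (a (i + 3)).reverse)
        ((p + q) • compass i)
    else shift (a i) (p • compass i)
  | .g =>
    if i.val % 2 = 0 then shift (a i) ((q - p) • compass i)
    else
      shift ((a (i + 5)).reverse ++ (a (i + 4)).reverse ++ (a (i + 3)).reverse) (q • compass i)
  | .h =>
    if i.val % 2 = 0 then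
      shift ((a (i + 6)).reverse ++ (a (i + 5)).reverse ++ (a (i + 4)).reverse ++
        (a (i + 3)).reverse ++ (a (i + 2)).reverse) ((p + q) • compass i)
    else shift (a (i - 1) ++ a i ++ a (i + 1)) (q • compass i)
  | .hbar =>
    if i.val % 2 = 0 then shift (a (i - 1) ++ a i ++ a (i + 1)) ((p + q) • compass i)
    else
      shift ((a (i + 6)).reverse ++ (a (i + 5)).reverse ++ (a (i + 4)).reverse ++
        (a (i + 3)).reverse ++ (a (i + 2)).reverse) (q • compass i)

/-- The parameters of the lift of type `t` of a `(p, q)`-perfect cycle. -/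
def liftParams (t : LiftType) (pq : ℤ × ℤ) : ℤ × ℤ :=
  match t with
  | .f => (pq.1, 2 * pq.1 + pq.2)
  | .g => (pq.2, 2 * pq.2 - pq.1)
  | .h => (pq.2, pq.1 + 2 * pq.2)
  | .hbar => (pq.2, pq.1 + 2 * pq.2)

/-- The initial cycle of type `o` of an `(r, s)`-leaper, partitioned into its eight squares. -/
def initialCycle (o : OriginType) (r s : ℤ) : OctoPath := fun i =>
  match o with
  | .f => if i.val % 2 = 0 then [(r + s) • compass i] else [r • compass i]
  | .g => if i.val % 2 = 0 then [(s - r) • compass i] else [s • compass i]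
  | .h => if i.val % 2 = 0 then [(r + s) • compass i] else [s • compass i]

/-- The parameters for which the initial cycle of type `o` is perfect. -/
def initialParams (o : OriginType) (r s : ℤ) : ℤ × ℤ :=
  match o with
  | .f => (r, 2 * r + s)
  | .g => (s, 2 * s - r)
  | .h => (s, r + 2 * s)

/-- The proportions `(p, q)` of the leaper `L^M_o(e)`, where `M` is an `(r, s)`-leaper. -/
def proportions (r s : ℤ) (o : OriginType) : List LiftType → ℤ × ℤ
  | [] => initialParams o r s
  | t :: e => liftParams t (proportions r s o e)

/-- The cycle `D^M_o(e)` with its partitioning: lifts of types `e_l, …, e_1` are applied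
successively to the initial cycle. -/
def secondCycle (r s : ℤ) (o : OriginType) : List LiftType → OctoPath
  | [] => initialCycle o r s
  | t :: e => lift t (proportions r s o e).1 (proportions r s o e).2 (secondCycle r s o e)

/-- The squares of a partitioned cycle in the order in which they are visited. -/
def OctoPath.squares (a : OctoPath) : List Square := (List.finRange 8).flatMap a

/-- The board formed by the squares of a partitioned cycle. -/
def OctoPath.board (a : OctoPath) : Set Square := {x | x ∈ OctoPath.squares a}

/-- A partitioned cycle as a graph: its vertices are its squares, and its edges join the squares
that are visited successively (cyclically). -/
def OctoPath.cycleGraph (a : OctoPath) : SimpleGraph (OctoPath.board a) :=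
  SimpleGraph.fromRel fun x y => ∃ k < (OctoPath.squares a).length,
    (OctoPath.squares a)[k]? = some (x : Square) ∧
      (OctoPath.squares a)[(k + 1) % (OctoPath.squares a).length]? = some (y : Square)

/-- The cycle `C^M_o(e)` : the leaper graph of the leaper `L^M_o(e)` over the board `B^M_o(e)`. -/
def firstCycle (r s : ℤ) (o : OriginType) (e : List LiftType) :
    SimpleGraph (OctoPath.board (secondCycle r s o e)) :=
  leaperGraph (proportions r s o e).1 (proportions r s o e).2
    (OctoPath.board (secondCycle r s o e))

/-! ## Fundamental direction cycles -/

/-- `Φ` is extracted from `C^M_o(e)`, where `M` is an `(r, s)`-leaper. -/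
def ExtractedFromFirst (r s : ℕ) (o : OriginType) (e : List LiftType) (Φ : DirectionGraph) :
    Prop :=
  Φ.ExtractedFrom (proportions r s o e).1 (proportions r s o e).2 (firstCycle r s o e)

/-- `Φ` is extracted from `D^M_o(e)`, where `M` is an `(r, s)`-leaper. -/
def ExtractedFromSecond (r s : ℕ) (o : OriginType) (e : List LiftType) (Φ : DirectionGraph) :
    Prop :=
  Φ.ExtractedFrom r s (OctoPath.cycleGraph (secondCycle r s o e))

/-- `Φ` is a fundamental direction cycle of descent `e`: it is extracted from `C^M_o(e)` for some
skew leaper `M` and some type `o`. -/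
def IsFundamental (e : List LiftType) (Φ : DirectionGraph) : Prop :=
  ∃ r s : ℕ, 0 < r ∧ r < s ∧ ∃ o, ExtractedFromFirst r s o e Φ

/-- `Φ` is a second fundamental direction cycle of origin `o` and descent `e`: it is extracted
from `D^M_o(e)` for some skew leaper `M`. -/
def IsSecondFundamental (o : OriginType) (e : List LiftType) (Φ : DirectionGraph) : Prop :=
  ∃ r s : ℕ, 0 < r ∧ r < s ∧ ExtractedFromSecond r s o e Φ

/-- The dual direction graphs of descent `e` of the large family: the fundamental direction cycle
and the second fundamental direction cycles of descent `e`. -/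
def IsFundamentalOrSecond (e : List LiftType) (Φ : DirectionGraph) : Prop :=
  IsFundamental e Φ ∨ ∃ o, IsSecondFundamental o e Φ

/-- The dual direction graphs of the original family: descents composed of `f`, `g`, `h` only,
origins `g` and `h` only. -/
def IsClassical (Ψ : DirectionGraph) : Prop :=
  ∃ e : List LiftType, LiftType.hbar ∉ e ∧
    (IsFundamental e Ψ ∨ IsSecondFundamental .g e Ψ ∨ IsSecondFundamental .h e Ψ)

/-- Exchange of `f` and `g`, and of `h` and `ħ`. -/
def LiftType.companion : LiftType → LiftType
  | .f => .g
  | .g => .f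
  | .h => .hbar
  | .hbar => .h

/-- The companion of a string. -/
def companion (e : List LiftType) : List LiftType := e.map LiftType.companion

end LeaperGraphs

/-! Written in terms of its parameters (p, q), every initial cycle has the squares (q - p, 0) and
(p, p) and their rotations, whatever the leaper and the origin. All lifts are therefore functions of
p, q and the descent, and they make sense over any abelian group. Over ℤ × ℤ with the independent
parameters (1, 0) and (0, 1), a vanishing sum of moves forces a vanishing sum of direction matrices.
Formal coordinates thus serve as a potential that makes the labeled graphs direction graphs.

Directions and sections are numbered from 0. On the board of a lifted cycle with parameters 0 < p <
q, a square of section i has exactly two moves, of directions i + 3 and i + 4 (`add_moveVec_mem`,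
`move_of_mem`). Absence of other moves follows from a system of regions and forbidden differences
that survives every lift (`separated`). Hence evaluation of the formal coordinates neither merges
squares nor creates moves (`eval_injOn`, `eval_move_iff`), and the fundamental direction cycle
depends on the descent alone (`moveForm_iff`).

The invariant that separates these graphs counts vertices by the pair of directions leaving them.
Right multiplication by four reflections splits pairs of directions of opposite parity into four
classes, and every equivalence permutation permutes the classes (`IsEquivalencePerm.exists_perm`).
For a fundamental direction cycle the two nonzero counts are 4a and 4b, where a and b are the
numbers of squares in sections E and NE. The vector (a, b) arises from (1, 1) by one linear step per
character of the descent, and the descent can be read back from it (`counts_injective`). The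
unordered pair {a, b} determines the descent up to exchange of the coordinates, that is, up to
companions. Companions are indeed equivalent: a rotation through 45° with scaling carries one cycle
to the other (`cyc_companion`).

For second cycles the cyclic word of labels is independent of the origin up to an equivalence
permutation. The turns along its paths obey the same linear recursion as the lengths, but only their
total over the cycle is visible; so the counts come from the transposed matrix product, which
belongs to the reversed descent with f and g exchanged (`IsSecondFundamental.hasCounts`).
Transposition preserves the occurrences of h and of ħ, and companionship exchanges them. A descent
with both characters thus never matches one without ħ, and any other descent can be freed of ħ by
passing to its companion if necessary. -/

namespace LeaperGraphs

/-! ## Partitioned cycles with coordinates in an additive group -/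

section Generic

variable {A B : Type*} [AddCommGroup A] [AddCommGroup B]

/-- The order in which a lift of type `t` concatenates the old paths and their reversals. -/
def liftPieces {X : Type*} (t : LiftType) (a : Fin 8 → List X) (i : Fin 8) : List X :=
  match t with
  | .f => if i.val % 2 = 0 then (a (i + 5)).reverse ++ (a (i + 4)).reverse ++ (a (i + 3)).reverse
      else a i
  | .g => if i.val % 2 = 0 then a i
      else (a (i + 5)).reverse ++ (a (i + 4)).reverse ++ (a (i + 3)).reverse
  | .h => if i.val % 2 = 0 then (a (i + 6)).reverse ++ (a (i + 5)).reverse ++ (a (i + 4)).reverse ++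
        (a (i + 3)).reverse ++ (a (i + 2)).reverse
      else a (i - 1) ++ a i ++ a (i + 1)
  | .hbar => if i.val % 2 = 0 then a (i - 1) ++ a i ++ a (i + 1)
      else (a (i + 6)).reverse ++ (a (i + 5)).reverse ++ (a (i + 4)).reverse ++
        (a (i + 3)).reverse ++ (a (i + 2)).reverse

/-- The coefficient of the translation applied by a lift. -/
def liftCoeff (t : LiftType) (p q : A) (i : Fin 8) : A :=
  match t with
  | .f => if i.val % 2 = 0 then p + q else p
  | .g => if i.val % 2 = 0 then q - p else q
  | .h => if i.val % 2 = 0 then p + q else q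
  | .hbar => if i.val % 2 = 0 then p + q else q

/-- The vector of direction `compass i` scaled by `a`. -/
def compassVec (i : Fin 8) (a : A) : A × A := ((compass i).1 • a, (compass i).2 • a)

/-- The parameters of a lift. -/
def nextParams (t : LiftType) (p q : A) : A × A :=
  match t with
  | .f => (p, p + p + q)
  | .g => (q, q + q - p)
  | .h => (q, p + q + q)
  | .hbar => (q, p + q + q)

/-- The parameters after lifts of types given by a string. -/
def params (p q : A) : List LiftType → A × A
  | [] => (p, q)
  | t :: e => nextParams t (params p q e).1 (params p q e).2

/-- The partitioned cycle obtained from the initial cycle with parameters `(p, q)`. -/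
def cyc (p q : A) : List LiftType → Fin 8 → List (A × A)
  | [] => fun i => [compassVec i (if i.val % 2 = 0 then q - p else p)]
  | t :: e => fun i => (liftPieces t (cyc p q e) i).map
      (· + compassVec i (liftCoeff t (params p q e).1 (params p q e).2 i))

/-- The first parameter of the initial cycle. -/
def startParams (o : OriginType) (r s : A) : A × A :=
  match o with
  | .f => (r, r + r + s)
  | .g => (s, s + s - r)
  | .h => (s, r + s + s)

theorem liftPieces_map {X Y : Type*} (t : LiftType) (a : Fin 8 → List X) (φ : X → Y) (i : Fin 8) :
    liftPieces t (fun j => (a j).map φ) i = (liftPieces t a i).map φ := by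
  cases t <;> by_cases h : i.val % 2 = 0 <;> simp [liftPieces, h]

theorem proportions_eq (r s : ℤ) (o : OriginType) (e : List LiftType) :
    proportions r s o e = params (startParams o r s).1 (startParams o r s).2 e := by
  induction e with
  | nil => cases o <;> simp [proportions, params, startParams, initialParams] <;> ring
  | cons t e ih =>
    cases t <;> simp [proportions, params, ih, liftParams, nextParams] <;> ring

/-- The three initial cycles differ only through their parameters: in each of them the axis squares
are at distance q - p and the diagonal ones at p. Leaper and origin can be forgotten from here on.
-/
theorem secondCycle_eq (r s : ℤ) (o : OriginType) (e : List LiftType) :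
    secondCycle r s o e = cyc (startParams o r s).1 (startParams o r s).2 e := by
  induction e with
  | nil =>
    funext i
    cases o <;> by_cases h : i.val % 2 = 0 <;>
      simp [secondCycle, cyc, startParams, initialCycle, h, compassVec, Prod.ext_iff] <;>
      constructor <;> ring
  | cons t e ih =>
    funext i
    have hs : ∀ (w : List Square) (c : ℤ), shift w (c • compass i) =
        w.map (· + compassVec i c) := by
      intro w c
      have : c • compass i = compassVec i c := by
        simp [compassVec, Prod.ext_iff, mul_comm]
      rw [shift, this]
    simp only [secondCycle, cyc, ih, proportions_eq]
    cases t <;> by_cases h : i.val % 2 = 0 <;>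
      simp only [lift, liftPieces, liftCoeff, h, if_true, if_false, hs]

theorem nextParams_map (f : A →+ B) (t : LiftType) (p q : A) :
    nextParams t (f p) (f q) = (f (nextParams t p q).1, f (nextParams t p q).2) := by
  cases t <;> simp [nextParams]

theorem params_map (f : A →+ B) (p q : A) (e : List LiftType) :
    params (f p) (f q) e = (f (params p q e).1, f (params p q e).2) := by
  induction e with
  | nil => rfl
  | cons t e ih => simp only [params, ih, nextParams_map]

theorem compassVec_map (f : A →+ B) (i : Fin 8) (a : A) :
    compassVec i (f a) = Prod.map f f (compassVec i a) := by
  simp [compassVec]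

theorem liftCoeff_map (f : A →+ B) (t : LiftType) (p q : A) (i : Fin 8) :
    liftCoeff t (f p) (f q) i = f (liftCoeff t p q i) := by
  cases t <;> by_cases h : i.val % 2 = 0 <;> simp [liftCoeff, h]

/-- Lifts use only translations by integer combinations of the parameters, so they commute with
homomorphisms. This links formal and actual coordinates. -/
theorem cyc_map (f : A →+ B) (p q : A) (e : List LiftType) (i : Fin 8) :
    cyc (f p) (f q) e i = (cyc p q e i).map (Prod.map f f) := by
  induction e generalizing i with
  | nil =>
    by_cases h : i.val % 2 = 0 <;> simp [cyc, h, ← map_sub, compassVec_map]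
  | cons t e ih =>
    have : cyc (f p) (f q) e = fun j => (cyc p q e j).map (Prod.map f f) := funext ih
    simp only [cyc, this, liftPieces_map, params_map, liftCoeff_map, compassVec_map, List.map_map]
    congr 1
    funext x
    simp [Prod.ext_iff]

/-- Rotation through `90°`. -/
def rot (x : A × A) : A × A := (-x.2, x.1)

theorem compassVec_add_two (i : Fin 8) (a : A) : compassVec (i + 2) a = rot (compassVec i a) := by
  fin_cases i <;> simp [compassVec, compass, rot]

theorem liftPieces_add_two {X : Type*} (t : LiftType) (a : Fin 8 → List X) (φ : X → X)
    (ha : ∀ j, a (j + 2) = (a j).map φ) (i : Fin 8) :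
    liftPieces t a (i + 2) = (liftPieces t a i).map φ := by
  have h2 : (i + 2).val % 2 = i.val % 2 := by revert i; decide
  rw [← liftPieces_map]
  have hc : ∀ c : Fin 8, i + 2 + c = i + c + 2 := fun c => by abel
  have hd : i + 2 - 1 = i - 1 + 2 := by abel
  cases t <;> simp only [liftPieces, h2, hc, ha, hd]

theorem liftCoeff_add_two (t : LiftType) (p q : A) (i : Fin 8) :
    liftCoeff t p q (i + 2) = liftCoeff t p q i := by
  have h2 : (i + 2).val % 2 = i.val % 2 := by revert i; decide
  cases t <;> simp only [liftCoeff, h2]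

theorem cyc_add_two (p q : A) (e : List LiftType) (i : Fin 8) :
    cyc p q e (i + 2) = (cyc p q e i).map rot := by
  induction e generalizing i with
  | nil =>
    have h2 : (i + 2).val % 2 = i.val % 2 := by revert i; decide
    simp only [cyc, h2, compassVec_add_two, List.map_cons, List.map_nil]
  | cons t e ih =>
    simp only [cyc, liftPieces_add_two t _ rot ih, liftCoeff_add_two, compassVec_add_two,
      List.map_map]
    congr 1
    funext x
    simp [rot, add_comm]

/-- The predicate of the section `i`, given the predicates of the sections `E` and `NE`. -/
def sect (E N : A → A → Prop) (i : Fin 8) (x y : A) : Prop :=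
  match i with
  | 0 => E x y
  | 1 => N x y
  | 2 => E y (-x)
  | 3 => N y (-x)
  | 4 => E (-x) (-y)
  | 5 => N (-x) (-y)
  | 6 => E (-y) x
  | 7 => N (-y) x

/-- Membership in the section `E`. -/
def inE (p q : A) (e : List LiftType) (x y : A) : Prop := (x, y) ∈ cyc p q e 0

/-- Membership in the section `NE`. -/
def inNE (p q : A) (e : List LiftType) (x y : A) : Prop := (x, y) ∈ cyc p q e 1

theorem mem_cyc_add_two (p q : A) (e : List LiftType) (i : Fin 8) (x y : A) :
    (x, y) ∈ cyc p q e (i + 2) ↔ (y, -x) ∈ cyc p q e i := by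
  rw [cyc_add_two, List.mem_map]
  constructor
  · rintro ⟨⟨u, v⟩, h, h2⟩
    simp only [rot, Prod.mk.injEq] at h2
    rw [← h2.1, ← h2.2]; simpa using h
  · intro h
    exact ⟨_, h, by simp [rot]⟩

theorem mem_cyc (p q : A) (e : List LiftType) (i : Fin 8) (x y : A) :
    (x, y) ∈ cyc p q e i ↔ sect (inE p q e) (inNE p q e) i x y := by
  have h := mem_cyc_add_two p q e
  have h2 : ∀ x y, (x, y) ∈ cyc p q e 2 ↔ (y, -x) ∈ cyc p q e 0 := h 0
  have h3 : ∀ x y, (x, y) ∈ cyc p q e 3 ↔ (y, -x) ∈ cyc p q e 1 := h 1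
  have h4 : ∀ x y, (x, y) ∈ cyc p q e 4 ↔ (y, -x) ∈ cyc p q e 2 := h 2
  have h5 : ∀ x y, (x, y) ∈ cyc p q e 5 ↔ (y, -x) ∈ cyc p q e 3 := h 3
  have h6 : ∀ x y, (x, y) ∈ cyc p q e 6 ↔ (y, -x) ∈ cyc p q e 4 := h 4
  have h7 : ∀ x y, (x, y) ∈ cyc p q e 7 ↔ (y, -x) ∈ cyc p q e 5 := h 5
  fin_cases i <;> simp [sect, inE, inNE, h7, h6, h5, h4, h3, h2]

/-- Section `E` of a lift. -/
def liftE (t : LiftType) (p q : A) (E N : A → A → Prop) (x y : A) : Prop :=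
  match t with
  | .f => N y (p + q - x) ∨ E (p + q - x) (-y) ∨ N (p + q - x) (-y)
  | .g => E (x + p - q) y
  | .h => E y (p + q - x) ∨ N y (p + q - x) ∨ E (p + q - x) (-y) ∨ N (p + q - x) (-y) ∨
      E (-y) (x - p - q)
  | .hbar => N (-y) (x - p - q) ∨ E (x - p - q) y ∨ N (x - p - q) y

/-- Section `NE` of a lift. -/
def liftNE (t : LiftType) (p q : A) (E N : A → A → Prop) (x y : A) : Prop :=
  match t with
  | .f => N (x - p) (y - p)
  | .g => E (q - y) (x - q) ∨ N (q - x) (q - y) ∨ E (q - x) (q - y)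
  | .h => E (x - q) (y - q) ∨ N (x - q) (y - q) ∨ E (y - q) (q - x)
  | .hbar => N (y - q) (q - x) ∨ E (q - x) (q - y) ∨ N (q - x) (q - y) ∨ E (q - y) (x - q) ∨
      N (q - y) (x - q)

theorem mem_map_add {V : Type*} [AddCommGroup V] (l : List V) (v x : V) :
    x ∈ l.map (· + v) ↔ x - v ∈ l := by
  rw [List.mem_map]
  constructor
  · rintro ⟨a, h, rfl⟩; simpa using h
  · intro h; exact ⟨_, h, by simp⟩

/-- By rotational symmetry all eight old sections are expressed through E and NE, so a lift becomes
a recursion for two predicates. -/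
theorem inE_cons (t : LiftType) (p q : A) (e : List LiftType) (x y : A) :
    inE p q (t :: e) x y ↔ liftE t (params p q e).1 (params p q e).2 (inE p q e) (inNE p q e) x y := by
  rw [inE, cyc, mem_map_add]
  generalize (params p q e).1 = P
  generalize (params p q e).2 = Q
  have e1 : -(x - (P + Q)) = P + Q - x := by abel
  have e2 : x - (P + Q) = x - P - Q := by abel
  have e3 : x - (Q - P) = x + P - Q := by abel
  cases t <;>
  simp [liftPieces, liftCoeff, compassVec, compass, liftE, mem_cyc, sect, e1, e3,
    or_assoc, or_comm, or_left_comm] <;> simp only [e2]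
  all_goals tauto

theorem inNE_cons (t : LiftType) (p q : A) (e : List LiftType) (x y : A) :
    inNE p q (t :: e) x y ↔
      liftNE t (params p q e).1 (params p q e).2 (inE p q e) (inNE p q e) x y := by
  rw [inNE, cyc, mem_map_add]
  generalize (params p q e).1 = P
  generalize (params p q e).2 = Q
  cases t <;>
  simp [liftPieces, liftCoeff, compassVec, compass, liftNE, mem_cyc, sect,
    Fin.reduceAdd, or_assoc, or_comm, or_left_comm]

end Generic

theorem cast₂ {A : Type*} {R : A → A → Prop} {a a' b b' : A} (h : R a b) (h₁ : a = a') (h₂ : b = b') :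
    R a' b' := h₁ ▸ h₂ ▸ h

/-! ### Reflection symmetry and the existence of moves -/

section Generic

variable {A : Type*} [AddCommGroup A]

theorem inE_nil (p q x y : A) : inE p q [] x y ↔ x = q - p ∧ y = 0 := by
  simp [inE, cyc, compassVec, compass]

theorem inNE_nil (p q x y : A) : inNE p q [] x y ↔ x = p ∧ y = p := by
  simp [inNE, cyc, compassVec, compass]

/-- Together with the rotations this gives the full symmetry of the square. Reflection in the axis
of a lifted section permutes the old sections that compose it, reversing their order. -/
theorem reflect_mem (p q : A) (e : List LiftType) :
    (∀ x y, inE p q e x y → inE p q e x (-y)) ∧ (∀ x y, inNE p q e x y → inNE p q e y x) := by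
  induction e with
  | nil => simp +contextual [inE_nil, inNE_nil]
  | cons t e ih =>
    obtain ⟨rE, rN⟩ := ih
    simp only [inE_cons, inNE_cons]
    generalize (params p q e).1 = P at *
    generalize (params p q e).2 = Q at *
    generalize inE p q e = E at *
    generalize inNE p q e = N at *
    constructor
    · intro x y h
      cases t <;> simp only [liftE] at h ⊢
      · rcases h with h | h | h
        · exact Or.inr (Or.inr (cast₂ (rN _ _ (h)) (by abel) (by abel)))
        · exact Or.inr (Or.inl (cast₂ (rE _ _ (h)) (by abel) (by abel)))
        · exact Or.inl (cast₂ (rN _ _ (h)) (by abel) (by abel))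
      · exact cast₂ (rE _ _ (h)) (by abel) (by abel)
      · rcases h with h | h | h | h | h
        · exact Or.inr (Or.inr (Or.inr (Or.inr (cast₂ (rE _ _ (h)) (by abel) (by abel)))))
        · exact Or.inr (Or.inr (Or.inr (Or.inl (cast₂ (rN _ _ (h)) (by abel) (by abel)))))
        · exact Or.inr (Or.inr (Or.inl (cast₂ (rE _ _ (h)) (by abel) (by abel))))
        · exact Or.inr (Or.inl (cast₂ (rN _ _ (h)) (by abel) (by abel)))
        · exact Or.inl (cast₂ (rE _ _ (h)) (by abel) (by abel))
      · rcases h with h | h | h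
        · exact Or.inr (Or.inr (cast₂ (rN _ _ (h)) (by abel) (by abel)))
        · exact Or.inr (Or.inl (cast₂ (rE _ _ (h)) (by abel) (by abel)))
        · exact Or.inl (cast₂ (rN _ _ (h)) (by abel) (by abel))
    · intro x y h
      cases t <;> simp only [liftNE] at h ⊢
      · exact cast₂ (rN _ _ (h)) (by abel) (by abel)
      · rcases h with h | h | h
        · exact Or.inr (Or.inr (cast₂ (rE _ _ (h)) (by abel) (by abel)))
        · exact Or.inr (Or.inl (cast₂ (rN _ _ (h)) (by abel) (by abel)))
        · exact Or.inl (cast₂ (rE _ _ (h)) (by abel) (by abel))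
      · rcases h with h | h | h
        · exact Or.inr (Or.inr (cast₂ (rE _ _ (h)) (by abel) (by abel)))
        · exact Or.inr (Or.inl (cast₂ (rN _ _ (h)) (by abel) (by abel)))
        · exact Or.inl (cast₂ (rE _ _ (h)) (by abel) (by abel))
      · rcases h with h | h | h | h | h
        · exact Or.inr (Or.inr (Or.inr (Or.inr (cast₂ (rN _ _ (h)) (by abel) (by abel)))))
        · exact Or.inr (Or.inr (Or.inr (Or.inl (cast₂ (rE _ _ (h)) (by abel) (by abel)))))
        · exact Or.inr (Or.inr (Or.inl (cast₂ (rN _ _ (h)) (by abel) (by abel))))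
        · exact Or.inr (Or.inl (cast₂ (rE _ _ (h)) (by abel) (by abel)))
        · exact Or.inl (cast₂ (rN _ _ (h)) (by abel) (by abel))

/-- Every square of the sections `E` and `NE` has one of its two moves; the other one is
obtained by reflection. -/
theorem move_mem (p q : A) (e : List LiftType) :
    (∀ x y, inE p q e x y → inNE p q e (y + (params p q e).1) ((params p q e).2 - x) ∨
      inE p q e ((params p q e).2 - x) (-(y + (params p q e).1))) ∧
    (∀ x y, inNE p q e x y → inNE p q e ((params p q e).1 - x) ((params p q e).2 - y) ∨
      inE p q e ((params p q e).2 - y) (x - (params p q e).1)) := by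
  have hR := reflect_mem p q
  induction e with
  | nil => simp +contextual [inE_nil, inNE_nil, params]
  | cons t e ih =>
    obtain ⟨hE, hN⟩ := ih
    obtain ⟨rE, rN⟩ := hR e
    simp only [inE_cons, inNE_cons, params]
    generalize (params p q e).1 = P at *
    generalize (params p q e).2 = Q at *
    generalize inE p q e = E at *
    generalize inNE p q e = N at *
    constructor
    · intro x y h
      -- Expanded, each goal concerns old squares. Either the move cancels against the two
      -- translations and the target is the same old square, or it reduces to an old move, supplied
      -- by `hE` or `hN` up to reflection.
      cases t <;> simp only [liftE, liftNE, nextParams] at h ⊢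
      · rcases h with h | h | h
        · exact Or.inl (cast₂ (h) (by abel) (by abel))
        · exact (hE _ _ (rE _ _ h)).elim (fun u => Or.inr (Or.inr (Or.inr (cast₂ (rN _ _ (u)) (by abel) (by abel))))) (fun u => Or.inr (Or.inr (Or.inl (cast₂ (rE _ _ (u)) (by abel) (by abel)))))
        · exact (hN _ _ (rN _ _ h)).elim (fun u => Or.inr (Or.inr (Or.inr (cast₂ (rN _ _ (u)) (by abel) (by abel))))) (fun u => Or.inr (Or.inr (Or.inl (cast₂ (rE _ _ (u)) (by abel) (by abel)))))
      · exact Or.inl (Or.inl (cast₂ (h) (by abel) (by abel)))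
      · rcases h with h | h | h | h | h
        · exact Or.inl (Or.inl (cast₂ (h) (by abel) (by abel)))
        · exact Or.inl (Or.inr (Or.inl (cast₂ (h) (by abel) (by abel))))
        · exact Or.inl (Or.inr (Or.inr (cast₂ (h) (by abel) (by abel))))
        · exact (hN _ _ h).elim (fun u => Or.inr (Or.inr (Or.inr (Or.inr (Or.inl (cast₂ (u) (by abel) (by abel))))))) (fun u => Or.inr (Or.inr (Or.inr (Or.inr (Or.inr (cast₂ (u) (by abel) (by abel)))))))
        · exact (hE _ _ h).elim (fun u => Or.inr (Or.inr (Or.inr (Or.inr (Or.inl (cast₂ (u) (by abel) (by abel))))))) (fun u => Or.inr (Or.inr (Or.inr (Or.inr (Or.inr (cast₂ (u) (by abel) (by abel)))))))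
      · rcases h with h | h | h
        · exact Or.inl (Or.inr (Or.inr (Or.inl (cast₂ (h) (by abel) (by abel)))))
        · exact Or.inl (Or.inr (Or.inr (Or.inr (Or.inl (cast₂ (h) (by abel) (by abel))))))
        · exact Or.inl (Or.inr (Or.inr (Or.inr (Or.inr (cast₂ (h) (by abel) (by abel))))))
    · intro x y h
      cases t <;> simp only [liftE, liftNE, nextParams] at h ⊢
      · exact Or.inr (Or.inl (cast₂ (h) (by abel) (by abel)))
      · rcases h with h | h | h
        · exact Or.inr (cast₂ (h) (by abel) (by abel))
        · exact (hN _ _ (rN _ _ h)).elim (fun u => Or.inl (Or.inr (Or.inl (cast₂ (rN _ _ (u)) (by abel) (by abel))))) (fun u => Or.inl (Or.inr (Or.inr (cast₂ (rE _ _ (u)) (by abel) (by abel)))))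
        · exact (hE _ _ (rE _ _ h)).elim (fun u => Or.inl (Or.inr (Or.inl (cast₂ (rN _ _ (u)) (by abel) (by abel))))) (fun u => Or.inl (Or.inr (Or.inr (cast₂ (rE _ _ (u)) (by abel) (by abel)))))
      · rcases h with h | h | h
        · exact Or.inr (Or.inl (cast₂ (h) (by abel) (by abel)))
        · exact Or.inr (Or.inr (Or.inl (cast₂ (h) (by abel) (by abel))))
        · exact Or.inr (Or.inr (Or.inr (Or.inl (cast₂ (h) (by abel) (by abel)))))
      · rcases h with h | h | h | h | h
        · exact (hN _ _ h).elim (fun u => Or.inl (Or.inl (cast₂ (u) (by abel) (by abel)))) (fun u => Or.inl (Or.inr (Or.inl (cast₂ (u) (by abel) (by abel)))))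
        · exact (hE _ _ h).elim (fun u => Or.inl (Or.inl (cast₂ (u) (by abel) (by abel)))) (fun u => Or.inl (Or.inr (Or.inl (cast₂ (u) (by abel) (by abel)))))
        · exact Or.inr (Or.inl (cast₂ (h) (by abel) (by abel)))
        · exact Or.inr (Or.inr (Or.inl (cast₂ (h) (by abel) (by abel))))
        · exact Or.inr (Or.inr (Or.inr (cast₂ (h) (by abel) (by abel))))

end Generic

/-- The sections `E` and `NE` of a `(p, q)`-perfect cycle are separated: they lie in certain
regions, and certain differences between squares of the cycle do not occur. -/
structure Separated (p q : ℤ) (E N : ℤ → ℤ → Prop) : Prop where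
  pos : 0 < p ∧ p < q
  rE : ∀ a b, E a b → E a (-b)
  rN : ∀ a b, N a b → N b a
  regE : ∀ a b, E a b → 0 < a ∧ b < a ∧ -b < a ∧ a < q ∧ a + b < p + q ∧ a - b < p + q ∧
    b < q - p ∧ -b < q - p
  regN : ∀ a b, N a b → 0 < a ∧ 0 < b ∧ a < q ∧ b < q ∧ a - b < 2 * p ∧ b - a < 2 * p ∧
    a + b < p + q
  EN_same : ∀ a b c d, E a b → N c d → c = a → d = b → False
  EN_up : ∀ a b c d, E a b → N c d → c = a - p → d = b + q → False
  EN_left : ∀ a b c d, E a b → N c d → c = b - p → d = -a + q → False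
  EN_turn : ∀ a b c d, E a b → N c d → c = b + q → d = -a + p → False
  NN_left : ∀ a b c d, N a b → N c d → c = b - p → d = -a + q → False
  EE_up : ∀ a b c d, E a b → E c d → c = b + q → d = -a + p → False
  NN_opp : ∀ a b c d, N a b → N c d → c = -a + p + q → d = -b - p + q → False
  EE_opp : ∀ a b c d, E a b → E c d → c = -a + p + q → d = -b + p - q → False
  NN_side : ∀ a b c d, N a b → N c d → c = a - 2 * p → d = b → False
  EE_diag : ∀ a b c d, E a b → E c d → c = a - p + q → d = b - p + q → False

/-- Undoing the translations and reflections turns a forbidden difference between lifted sections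
into one between old sections. It is then forbidden already or excluded by the regions. The fields
`NN_opp`, `EE_opp`, `NN_side` and `EE_diag` are there only to close this induction. -/
theorem Separated.lift_f {p q : ℤ} {E N : ℤ → ℤ → Prop} (S : Separated p q E N) :
    Separated (nextParams .f p q).1 (nextParams .f p q).2 (liftE .f p q E N)
      (liftNE .f p q E N) := by
  have hpq := S.pos
  refine ⟨?_, ?_, ?_, ?_, ?_, ?_, ?_, ?_, ?_, ?_, ?_, ?_, ?_, ?_, ?_⟩ <;>
    simp only [nextParams, liftE, liftNE]
  · omega
  · intro x y h
    rcases h with h | h | h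
    · exact Or.inr (Or.inr (cast₂ (S.rN _ _ h) (by omega) (by omega)))
    · exact Or.inr (Or.inl (cast₂ (S.rE _ _ h) (by omega) (by omega)))
    · exact Or.inl (cast₂ (S.rN _ _ h) (by omega) (by omega))
  · intro x y h
    exact cast₂ (S.rN _ _ h) (by omega) (by omega)
  · intro a b h
    rcases h with h | h | h <;>
    first | (have u := S.regE _ _ h; omega) | (have u := S.regN _ _ h; omega)
  · intro a b h
    have u := S.regN _ _ h
    omega
  · intro a b c d h k hc hd
    rcases h with h | h | h <;>
    first
      | exact S.NN_left _ _ _ _ (S.rN _ _ h) (S.rN _ _ k) (by omega) (by omega)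
      | exact S.EN_left _ _ _ _ (S.rE _ _ h) (S.rN _ _ k) (by omega) (by omega)
      | (have u := S.regN _ _ h; have v := S.regN _ _ k; omega)
  · intro a b c d h k hc hd
    rcases h with h | h | h <;>
    first
      | exact S.NN_opp _ _ _ _ (S.rN _ _ h) (S.rN _ _ k) (by omega) (by omega)
      | (have u := S.regE _ _ h; have v := S.regN _ _ k; omega)
      | (have u := S.regN _ _ h; have v := S.regN _ _ k; omega)
  · intro a b c d h k hc hd
    rcases h with h | h | h <;>
    first
      | exact S.NN_side _ _ _ _ h k (by omega) (by omega)
      | (have u := S.regE _ _ h; have v := S.regN _ _ k; omega)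
      | (have u := S.regN _ _ h; have v := S.regN _ _ k; omega)
  · intro a b c d h k hc hd
    rcases h with h | h | h <;>
    first
      | (have u := S.regE _ _ h; have v := S.regN _ _ k; omega)
      | (have u := S.regN _ _ h; have v := S.regN _ _ k; omega)
  · intro a b c d h k hc hd
    exact S.NN_left _ _ _ _ h k (by omega) (by omega)
  · intro a b c d h k hc hd
    rcases h with h | h | h <;>
    rcases k with k | k | k <;>
    first
      | exact S.EN_left _ _ _ _ h k (by omega) (by omega)
      | exact S.NN_left _ _ _ _ h k (by omega) (by omega)
      | (have u := S.regE _ _ h; have v := S.regE _ _ k; omega)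
      | (have u := S.regE _ _ h; have v := S.regN _ _ k; omega)
      | (have u := S.regN _ _ h; have v := S.regE _ _ k; omega)
      | (have u := S.regN _ _ h; have v := S.regN _ _ k; omega)
  · intro a b c d h k hc hd
    exact S.NN_opp _ _ _ _ h k (by omega) (by omega)
  · intro a b c d h k hc hd
    rcases h with h | h | h <;>
    rcases k with k | k | k <;>
    first
      | exact S.NN_opp _ _ _ _ (S.rN _ _ h) (S.rN _ _ k) (by omega) (by omega)
      | (have u := S.regE _ _ h; have v := S.regE _ _ k; omega)
      | (have u := S.regE _ _ h; have v := S.regN _ _ k; omega)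
      | (have u := S.regN _ _ h; have v := S.regE _ _ k; omega)
      | (have u := S.regN _ _ h; have v := S.regN _ _ k; omega)
  · intro a b c d h k hc hd
    exact S.NN_side _ _ _ _ h k (by omega) (by omega)
  · intro a b c d h k hc hd
    rcases h with h | h | h <;>
    rcases k with k | k | k <;>
    first
      | (have u := S.regE _ _ h; have v := S.regE _ _ k; omega)
      | (have u := S.regE _ _ h; have v := S.regN _ _ k; omega)
      | (have u := S.regN _ _ h; have v := S.regE _ _ k; omega)
      | (have u := S.regN _ _ h; have v := S.regN _ _ k; omega)

/-- The counterpart of `Separated.lift_f` under the exchange of axes and diagonals: `EE_up`,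
`EN_turn`, `EE_opp` and `EE_diag` play the parts of `NN_left`, `EN_left`, `NN_opp` and `NN_side`. -/
theorem Separated.lift_g {p q : ℤ} {E N : ℤ → ℤ → Prop} (S : Separated p q E N) :
    Separated (nextParams .g p q).1 (nextParams .g p q).2 (liftE .g p q E N)
      (liftNE .g p q E N) := by
  have hpq := S.pos
  refine ⟨?_, ?_, ?_, ?_, ?_, ?_, ?_, ?_, ?_, ?_, ?_, ?_, ?_, ?_, ?_⟩ <;>
    simp only [nextParams, liftE, liftNE]
  · omega
  · intro x y h
    exact cast₂ (S.rE _ _ h) (by omega) (by omega)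
  · intro x y h
    rcases h with h | h | h
    · exact Or.inr (Or.inr (cast₂ (S.rE _ _ h) (by omega) (by omega)))
    · exact Or.inr (Or.inl (cast₂ (S.rN _ _ h) (by omega) (by omega)))
    · exact Or.inl (cast₂ (S.rE _ _ h) (by omega) (by omega))
  · intro a b h
    have u := S.regE _ _ h
    omega
  · intro a b h
    rcases h with h | h | h <;>
    first | (have u := S.regE _ _ h; omega) | (have u := S.regN _ _ h; omega)
  · intro a b c d h k hc hd
    rcases k with k | k | k <;>
    first
      | exact S.EE_up _ _ _ _ (S.rE _ _ h) (S.rE _ _ k) (by omega) (by omega)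
      | exact S.EN_turn _ _ _ _ (S.rE _ _ h) (S.rN _ _ k) (by omega) (by omega)
      | (have u := S.regE _ _ h; have v := S.regE _ _ k; omega)
  · intro a b c d h k hc hd
    rcases k with k | k | k <;>
    first
      | exact S.EE_opp _ _ _ _ h k (by omega) (by omega)
      | (have u := S.regE _ _ h; have v := S.regE _ _ k; omega)
      | (have u := S.regE _ _ h; have v := S.regN _ _ k; omega)
  · intro a b c d h k hc hd
    rcases k with k | k | k <;>
    first
      | (have u := S.regE _ _ h; have v := S.regE _ _ k; omega)
      | (have u := S.regE _ _ h; have v := S.regN _ _ k; omega)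
  · intro a b c d h k hc hd
    rcases k with k | k | k <;>
    first
      | exact S.EE_diag _ _ _ _ h k (by omega) (by omega)
      | (have u := S.regE _ _ h; have v := S.regE _ _ k; omega)
      | (have u := S.regE _ _ h; have v := S.regN _ _ k; omega)
  · intro a b c d h k hc hd
    rcases h with h | h | h <;>
    rcases k with k | k | k <;>
    first
      | exact S.EN_turn _ _ _ _ h k (by omega) (by omega)
      | exact S.EE_up _ _ _ _ h k (by omega) (by omega)
      | (have u := S.regE _ _ h; have v := S.regE _ _ k; omega)
      | (have u := S.regE _ _ h; have v := S.regN _ _ k; omega)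
      | (have u := S.regN _ _ h; have v := S.regE _ _ k; omega)
      | (have u := S.regN _ _ h; have v := S.regN _ _ k; omega)
  · intro a b c d h k hc hd
    exact S.EE_up _ _ _ _ h k (by omega) (by omega)
  · intro a b c d h k hc hd
    rcases h with h | h | h <;>
    rcases k with k | k | k <;>
    first
      | exact S.EE_opp _ _ _ _ (S.rE _ _ h) (S.rE _ _ k) (by omega) (by omega)
      | (have u := S.regE _ _ h; have v := S.regE _ _ k; omega)
      | (have u := S.regE _ _ h; have v := S.regN _ _ k; omega)
      | (have u := S.regN _ _ h; have v := S.regE _ _ k; omega)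
      | (have u := S.regN _ _ h; have v := S.regN _ _ k; omega)
  · intro a b c d h k hc hd
    exact S.EE_opp _ _ _ _ h k (by omega) (by omega)
  · intro a b c d h k hc hd
    rcases h with h | h | h <;>
    rcases k with k | k | k <;>
    first
      | (have u := S.regE _ _ h; have v := S.regE _ _ k; omega)
      | (have u := S.regE _ _ h; have v := S.regN _ _ k; omega)
      | (have u := S.regN _ _ h; have v := S.regE _ _ k; omega)
      | (have u := S.regN _ _ h; have v := S.regN _ _ k; omega)
  · intro a b c d h k hc hd
    exact S.EE_diag _ _ _ _ h k (by omega) (by omega)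

theorem Separated.lift_h {p q : ℤ} {E N : ℤ → ℤ → Prop} (S : Separated p q E N) :
    Separated (nextParams .h p q).1 (nextParams .h p q).2 (liftE .h p q E N)
      (liftNE .h p q E N) := by
  have hpq := S.pos
  refine ⟨?_, ?_, ?_, ?_, ?_, ?_, ?_, ?_, ?_, ?_, ?_, ?_, ?_, ?_, ?_⟩ <;>
    simp only [nextParams, liftE, liftNE]
  · omega
  · intro x y h
    rcases h with h | h | h | h | h
    · exact Or.inr (Or.inr (Or.inr (Or.inr (cast₂ (S.rE _ _ h) (by omega) (by omega)))))
    · exact Or.inr (Or.inr (Or.inr (Or.inl (cast₂ (S.rN _ _ h) (by omega) (by omega)))))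
    · exact Or.inr (Or.inr (Or.inl (cast₂ (S.rE _ _ h) (by omega) (by omega))))
    · exact Or.inr (Or.inl (cast₂ (S.rN _ _ h) (by omega) (by omega)))
    · exact Or.inl (cast₂ (S.rE _ _ h) (by omega) (by omega))
  · intro x y h
    rcases h with h | h | h
    · exact Or.inr (Or.inr (cast₂ (S.rE _ _ h) (by omega) (by omega)))
    · exact Or.inr (Or.inl (cast₂ (S.rN _ _ h) (by omega) (by omega)))
    · exact Or.inl (cast₂ (S.rE _ _ h) (by omega) (by omega))
  · intro a b h
    rcases h with h | h | h | h | h <;>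
    first | (have u := S.regE _ _ h; omega) | (have u := S.regN _ _ h; omega)
  · intro a b h
    rcases h with h | h | h <;>
    first | (have u := S.regE _ _ h; omega) | (have u := S.regN _ _ h; omega)
  · intro a b c d h k hc hd
    rcases h with h | h | h | h | h <;>
    rcases k with k | k | k <;>
    first
      | exact S.EE_up _ _ _ _ k h (by omega) (by omega)
      | exact S.EN_turn _ _ _ _ k h (by omega) (by omega)
      | (have u := S.regE _ _ h; have v := S.regE _ _ k; omega)
      | (have u := S.regE _ _ h; have v := S.regN _ _ k; omega)
      | (have u := S.regN _ _ h; have v := S.regE _ _ k; omega)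
      | (have u := S.regN _ _ h; have v := S.regN _ _ k; omega)
  · intro a b c d h k hc hd
    rcases h with h | h | h | h | h <;>
    rcases k with k | k | k <;>
    first
      | exact S.EE_opp _ _ _ _ (S.rE _ _ h) (S.rE _ _ k) (by omega) (by omega)
      | (have u := S.regE _ _ h; have v := S.regE _ _ k; omega)
      | (have u := S.regE _ _ h; have v := S.regN _ _ k; omega)
      | (have u := S.regN _ _ h; have v := S.regE _ _ k; omega)
      | (have u := S.regN _ _ h; have v := S.regN _ _ k; omega)
  · intro a b c d h k hc hd
    rcases h with h | h | h | h | h <;>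
    rcases k with k | k | k <;>
    first
      | (have u := S.regE _ _ h; have v := S.regE _ _ k; omega)
      | (have u := S.regE _ _ h; have v := S.regN _ _ k; omega)
      | (have u := S.regN _ _ h; have v := S.regE _ _ k; omega)
      | (have u := S.regN _ _ h; have v := S.regN _ _ k; omega)
  · intro a b c d h k hc hd
    rcases h with h | h | h | h | h <;>
    rcases k with k | k | k <;>
    first
      | (have u := S.regE _ _ h; have v := S.regE _ _ k; omega)
      | (have u := S.regE _ _ h; have v := S.regN _ _ k; omega)
      | (have u := S.regN _ _ h; have v := S.regE _ _ k; omega)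
      | (have u := S.regN _ _ h; have v := S.regN _ _ k; omega)
  · intro a b c d h k hc hd
    rcases h with h | h | h <;>
    rcases k with k | k | k <;>
    first
      | exact S.EN_turn _ _ _ _ (S.rE _ _ k) (S.rN _ _ h) (by omega) (by omega)
      | exact S.EE_up _ _ _ _ (S.rE _ _ k) (S.rE _ _ h) (by omega) (by omega)
      | (have u := S.regE _ _ h; have v := S.regE _ _ k; omega)
      | (have u := S.regE _ _ h; have v := S.regN _ _ k; omega)
      | (have u := S.regN _ _ h; have v := S.regE _ _ k; omega)
      | (have u := S.regN _ _ h; have v := S.regN _ _ k; omega)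
  · intro a b c d h k hc hd
    rcases h with h | h | h | h | h <;>
    rcases k with k | k | k | k | k <;>
    first
      | exact S.EN_turn _ _ _ _ (S.rE _ _ k) (S.rN _ _ h) (by omega) (by omega)
      | exact S.EE_up _ _ _ _ (S.rE _ _ k) (S.rE _ _ h) (by omega) (by omega)
      | (have u := S.regE _ _ h; have v := S.regE _ _ k; omega)
      | (have u := S.regE _ _ h; have v := S.regN _ _ k; omega)
      | (have u := S.regN _ _ h; have v := S.regE _ _ k; omega)
      | (have u := S.regN _ _ h; have v := S.regN _ _ k; omega)
  · intro a b c d h k hc hd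
    rcases h with h | h | h <;>
    rcases k with k | k | k <;>
    first
      | exact S.EE_opp _ _ _ _ h k (by omega) (by omega)
      | (have u := S.regE _ _ h; have v := S.regE _ _ k; omega)
      | (have u := S.regE _ _ h; have v := S.regN _ _ k; omega)
      | (have u := S.regN _ _ h; have v := S.regE _ _ k; omega)
      | (have u := S.regN _ _ h; have v := S.regN _ _ k; omega)
  · intro a b c d h k hc hd
    rcases h with h | h | h | h | h <;>
    rcases k with k | k | k | k | k <;>
    first
      | exact S.EE_opp _ _ _ _ (S.rE _ _ h) (S.rE _ _ k) (by omega) (by omega)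
      | (have u := S.regE _ _ h; have v := S.regE _ _ k; omega)
      | (have u := S.regE _ _ h; have v := S.regN _ _ k; omega)
      | (have u := S.regN _ _ h; have v := S.regE _ _ k; omega)
      | (have u := S.regN _ _ h; have v := S.regN _ _ k; omega)
  · intro a b c d h k hc hd
    rcases h with h | h | h <;>
    rcases k with k | k | k <;>
    first
      | (have u := S.regE _ _ h; have v := S.regE _ _ k; omega)
      | (have u := S.regE _ _ h; have v := S.regN _ _ k; omega)
      | (have u := S.regN _ _ h; have v := S.regE _ _ k; omega)
      | (have u := S.regN _ _ h; have v := S.regN _ _ k; omega)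
  · intro a b c d h k hc hd
    rcases h with h | h | h | h | h <;>
    rcases k with k | k | k | k | k <;>
    first
      | (have u := S.regE _ _ h; have v := S.regE _ _ k; omega)
      | (have u := S.regE _ _ h; have v := S.regN _ _ k; omega)
      | (have u := S.regN _ _ h; have v := S.regE _ _ k; omega)
      | (have u := S.regN _ _ h; have v := S.regN _ _ k; omega)

theorem Separated.lift_hbar {p q : ℤ} {E N : ℤ → ℤ → Prop} (S : Separated p q E N) :
    Separated (nextParams .hbar p q).1 (nextParams .hbar p q).2 (liftE .hbar p q E N)
      (liftNE .hbar p q E N) := by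
  have hpq := S.pos
  refine ⟨?_, ?_, ?_, ?_, ?_, ?_, ?_, ?_, ?_, ?_, ?_, ?_, ?_, ?_, ?_⟩ <;>
    simp only [nextParams, liftE, liftNE]
  · omega
  · intro x y h
    rcases h with h | h | h
    · exact Or.inr (Or.inr (cast₂ (S.rN _ _ h) (by omega) (by omega)))
    · exact Or.inr (Or.inl (cast₂ (S.rE _ _ h) (by omega) (by omega)))
    · exact Or.inl (cast₂ (S.rN _ _ h) (by omega) (by omega))
  · intro x y h
    rcases h with h | h | h | h | h
    · exact Or.inr (Or.inr (Or.inr (Or.inr (cast₂ (S.rN _ _ h) (by omega) (by omega)))))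
    · exact Or.inr (Or.inr (Or.inr (Or.inl (cast₂ (S.rE _ _ h) (by omega) (by omega)))))
    · exact Or.inr (Or.inr (Or.inl (cast₂ (S.rN _ _ h) (by omega) (by omega))))
    · exact Or.inr (Or.inl (cast₂ (S.rE _ _ h) (by omega) (by omega)))
    · exact Or.inl (cast₂ (S.rN _ _ h) (by omega) (by omega))
  · intro a b h
    rcases h with h | h | h <;>
    first | (have u := S.regE _ _ h; omega) | (have u := S.regN _ _ h; omega)
  · intro a b h
    rcases h with h | h | h | h | h <;>
    first | (have u := S.regE _ _ h; omega) | (have u := S.regN _ _ h; omega)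
  · intro a b c d h k hc hd
    rcases h with h | h | h <;>
    rcases k with k | k | k | k | k <;>
    first
      | exact S.EN_left _ _ _ _ k h (by omega) (by omega)
      | exact S.NN_left _ _ _ _ k h (by omega) (by omega)
      | (have u := S.regE _ _ h; have v := S.regE _ _ k; omega)
      | (have u := S.regE _ _ h; have v := S.regN _ _ k; omega)
      | (have u := S.regN _ _ h; have v := S.regE _ _ k; omega)
      | (have u := S.regN _ _ h; have v := S.regN _ _ k; omega)
  · intro a b c d h k hc hd
    rcases h with h | h | h <;>
    rcases k with k | k | k | k | k <;>
    first
      | exact S.NN_opp _ _ _ _ h k (by omega) (by omega)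
      | (have u := S.regE _ _ h; have v := S.regE _ _ k; omega)
      | (have u := S.regE _ _ h; have v := S.regN _ _ k; omega)
      | (have u := S.regN _ _ h; have v := S.regE _ _ k; omega)
      | (have u := S.regN _ _ h; have v := S.regN _ _ k; omega)
  · intro a b c d h k hc hd
    rcases h with h | h | h <;>
    rcases k with k | k | k | k | k <;>
    first
      | (have u := S.regE _ _ h; have v := S.regE _ _ k; omega)
      | (have u := S.regE _ _ h; have v := S.regN _ _ k; omega)
      | (have u := S.regN _ _ h; have v := S.regE _ _ k; omega)
      | (have u := S.regN _ _ h; have v := S.regN _ _ k; omega)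
  · intro a b c d h k hc hd
    rcases h with h | h | h <;>
    rcases k with k | k | k | k | k <;>
    first
      | (have u := S.regE _ _ h; have v := S.regE _ _ k; omega)
      | (have u := S.regE _ _ h; have v := S.regN _ _ k; omega)
      | (have u := S.regN _ _ h; have v := S.regE _ _ k; omega)
      | (have u := S.regN _ _ h; have v := S.regN _ _ k; omega)
  · intro a b c d h k hc hd
    rcases h with h | h | h | h | h <;>
    rcases k with k | k | k | k | k <;>
    first
      | exact S.NN_left _ _ _ _ (S.rN _ _ k) (S.rN _ _ h) (by omega) (by omega)
      | exact S.EN_left _ _ _ _ (S.rE _ _ k) (S.rN _ _ h) (by omega) (by omega)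
      | (have u := S.regE _ _ h; have v := S.regE _ _ k; omega)
      | (have u := S.regE _ _ h; have v := S.regN _ _ k; omega)
      | (have u := S.regN _ _ h; have v := S.regE _ _ k; omega)
      | (have u := S.regN _ _ h; have v := S.regN _ _ k; omega)
  · intro a b c d h k hc hd
    rcases h with h | h | h <;>
    rcases k with k | k | k <;>
    first
      | exact S.NN_left _ _ _ _ (S.rN _ _ k) (S.rN _ _ h) (by omega) (by omega)
      | exact S.EN_left _ _ _ _ (S.rE _ _ k) (S.rN _ _ h) (by omega) (by omega)
      | (have u := S.regE _ _ h; have v := S.regE _ _ k; omega)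
      | (have u := S.regE _ _ h; have v := S.regN _ _ k; omega)
      | (have u := S.regN _ _ h; have v := S.regE _ _ k; omega)
      | (have u := S.regN _ _ h; have v := S.regN _ _ k; omega)
  · intro a b c d h k hc hd
    rcases h with h | h | h | h | h <;>
    rcases k with k | k | k | k | k <;>
    first
      | exact S.NN_opp _ _ _ _ (S.rN _ _ h) (S.rN _ _ k) (by omega) (by omega)
      | (have u := S.regE _ _ h; have v := S.regE _ _ k; omega)
      | (have u := S.regE _ _ h; have v := S.regN _ _ k; omega)
      | (have u := S.regN _ _ h; have v := S.regE _ _ k; omega)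
      | (have u := S.regN _ _ h; have v := S.regN _ _ k; omega)
  · intro a b c d h k hc hd
    rcases h with h | h | h <;>
    rcases k with k | k | k <;>
    first
      | exact S.NN_opp _ _ _ _ h k (by omega) (by omega)
      | (have u := S.regE _ _ h; have v := S.regE _ _ k; omega)
      | (have u := S.regE _ _ h; have v := S.regN _ _ k; omega)
      | (have u := S.regN _ _ h; have v := S.regE _ _ k; omega)
      | (have u := S.regN _ _ h; have v := S.regN _ _ k; omega)
  · intro a b c d h k hc hd
    rcases h with h | h | h | h | h <;>
    rcases k with k | k | k | k | k <;>
    first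
      | (have u := S.regE _ _ h; have v := S.regE _ _ k; omega)
      | (have u := S.regE _ _ h; have v := S.regN _ _ k; omega)
      | (have u := S.regN _ _ h; have v := S.regE _ _ k; omega)
      | (have u := S.regN _ _ h; have v := S.regN _ _ k; omega)
  · intro a b c d h k hc hd
    rcases h with h | h | h <;>
    rcases k with k | k | k <;>
    first
      | (have u := S.regE _ _ h; have v := S.regE _ _ k; omega)
      | (have u := S.regE _ _ h; have v := S.regN _ _ k; omega)
      | (have u := S.regN _ _ h; have v := S.regE _ _ k; omega)
      | (have u := S.regN _ _ h; have v := S.regN _ _ k; omega)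

theorem separated {p q : ℤ} (hp : 0 < p) (hpq : p < q) (e : List LiftType) :
    Separated (params p q e).1 (params p q e).2 (inE p q e) (inNE p q e) := by
  induction e with
  | nil =>
    refine ⟨⟨hp, hpq⟩, (reflect_mem p q []).1, (reflect_mem p q []).2, ?_, ?_, ?_, ?_, ?_, ?_, ?_,
      ?_, ?_, ?_, ?_, ?_⟩ <;> simp only [params, inE_nil, inNE_nil] <;> intros <;> omega
  | cons t e ih =>
    have hE : inE p q (t :: e) = _ := funext fun x => funext fun y => propext (inE_cons t p q e x y)
    have hN : inNE p q (t :: e) = _ :=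
      funext fun x => funext fun y => propext (inNE_cons t p q e x y)
    rw [hE, hN]
    cases t
    · exact ih.lift_f
    · exact ih.lift_g
    · exact ih.lift_h
    · exact ih.lift_hbar

/-- Reduction to the sections E and NE: the step by 2 is a rotation through 90°. -/
theorem fin_eight_rec {motive : Fin 8 → Prop} (h0 : motive 0) (h1 : motive 1)
    (step : ∀ i, motive i → motive (i + 2)) : ∀ i, motive i := by
  have h2 := step 0 h0
  have h3 := step 1 h1
  have h4 := step _ h2
  have h5 := step _ h3
  have h6 := step _ h4
  have h7 := step _ h5
  intro i
  fin_cases i <;> assumption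

/-! ### The moves available in each section -/

section Generic

variable {A : Type*} [AddCommGroup A]

/-- The move of direction `i` of a `(p, q)`-leaper. -/
def moveVec (p q : A) (i : Fin 8) : A × A :=
  match i with
  | 0 => (q, p)
  | 1 => (p, q)
  | 2 => (-p, q)
  | 3 => (-q, p)
  | 4 => (-q, -p)
  | 5 => (-p, -q)
  | 6 => (p, -q)
  | 7 => (q, -p)

theorem moveVec_add_two (p q : A) (i : Fin 8) : moveVec p q (i + 2) = rot (moveVec p q i) := by
  fin_cases i <;> simp [moveVec, rot]

theorem moveVec_add_four (p q : A) (i : Fin 8) : moveVec p q (i + 4) = -moveVec p q i := by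
  fin_cases i <;> simp [moveVec]

theorem moveVec_map {B : Type*} [AddCommGroup B] (f : A →+ B) (p q : A) (i : Fin 8) :
    moveVec (f p) (f q) i = Prod.map f f (moveVec p q i) := by
  fin_cases i <;> simp [moveVec]

theorem mem_cyc_add_two' (p q : A) (e : List LiftType) (i : Fin 8) (x : A × A) :
    rot x ∈ cyc p q e (i + 2) ↔ x ∈ cyc p q e i := by
  rw [rot, mem_cyc_add_two]; simp

theorem rot_add (x y : A × A) : rot (x + y) = rot x + rot y := by
  simp [rot, add_comm]

theorem rot_surjective (x : A × A) : ∃ y, rot y = x := ⟨(x.2, -x.1), by simp [rot]⟩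

/-- Every square of a perfect cycle has the two moves allowed by its section. -/
theorem add_moveVec_mem (p q : A) (e : List LiftType) (i : Fin 8) : ∀ x ∈ cyc p q e i,
    (x + moveVec (params p q e).1 (params p q e).2 (i + 3) ∈ cyc p q e (i + 3) ∨
      x + moveVec (params p q e).1 (params p q e).2 (i + 3) ∈ cyc p q e (i + 4)) ∧
    (x + moveVec (params p q e).1 (params p q e).2 (i + 4) ∈ cyc p q e (i + 4) ∨
      x + moveVec (params p q e).1 (params p q e).2 (i + 4) ∈ cyc p q e (i + 5)) := by
  obtain ⟨mE, mN⟩ := move_mem p q e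
  obtain ⟨rE, rN⟩ := reflect_mem p q e
  generalize hP : (params p q e).1 = P at *
  generalize hQ : (params p q e).2 = Q at *
  induction i using fin_eight_rec with
  | h0 =>
    rintro ⟨x, y⟩ h
    have h : inE p q e x y := h
    simp only [Fin.reduceAdd, moveVec, Prod.mk_add_mk, mem_cyc, sect]
    -- The move of direction 3 starts from the square itself; the one of direction 4 comes from the
    -- mirror image of the square in the horizontal axis.
    refine ⟨(mE _ _ h).imp (fun u => cast₂ u (by abel) (by abel)) fun u =>
      cast₂ u (by abel) (by abel), (mE _ _ (rE _ _ h)).symm.imp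
      (fun u => cast₂ (rE _ _ u) (by abel) (by abel)) fun u => cast₂ (rN _ _ u) (by abel) (by abel)⟩
  | h1 =>
    rintro ⟨x, y⟩ h
    have h : inNE p q e x y := h
    simp only [Fin.reduceAdd, moveVec, Prod.mk_add_mk, mem_cyc, sect]
    refine ⟨(mN _ _ (rN _ _ h)).symm.imp (fun u => cast₂ (rE _ _ u) (by abel) (by abel)) fun u =>
      cast₂ (rN _ _ u) (by abel) (by abel), (mN _ _ h).imp
      (fun u => cast₂ u (by abel) (by abel)) fun u => cast₂ u (by abel) (by abel)⟩
  | step i ih =>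
    intro x h
    obtain ⟨x, rfl⟩ := rot_surjective x
    have := ih x ((mem_cyc_add_two' p q e i x).1 h)
    have hc : ∀ c : Fin 8, i + 2 + c = i + c + 2 := fun c => by abel
    simpa only [hc, moveVec_add_two, ← rot_add, mem_cyc_add_two'] using this

end Generic

/-- Distinct sections of a perfect cycle are disjoint. -/
theorem section_unique {p q : ℤ} (hp : 0 < p) (hpq : p < q) (e : List LiftType) (i : Fin 8) :
    ∀ j, ∀ x ∈ cyc p q e i, x ∈ cyc p q e j → i = j := by
  have S := separated hp hpq e
  have hP := S.pos
  induction i using fin_eight_rec with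
  | h0 =>
    rintro j ⟨x, y⟩ h k
    have h : inE p q e x y := h
    rw [mem_cyc] at k
    generalize (params p q e).1 = P at *
    generalize (params p q e).2 = Q at *
    generalize inE p q e = E at *
    generalize inNE p q e = N at *
    fin_cases j <;> simp only [sect] at k <;> first
      | rfl
      | exact (S.EN_same _ _ _ _ h k rfl rfl).elim
      | exact (S.EN_same _ _ _ _ (S.rE _ _ h) (S.rN _ _ k) rfl rfl).elim
      | (exfalso; have u := S.regE _ _ h; have v := S.regE _ _ k; omega)
      | (exfalso; have u := S.regE _ _ h; have v := S.regN _ _ k; omega)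
  | h1 =>
    rintro j ⟨x, y⟩ h k
    have h : inNE p q e x y := h
    rw [mem_cyc] at k
    generalize (params p q e).1 = P at *
    generalize (params p q e).2 = Q at *
    generalize inE p q e = E at *
    generalize inNE p q e = N at *
    fin_cases j <;> simp only [sect] at k <;> first
      | rfl
      | exact (S.EN_same _ _ _ _ k h rfl rfl).elim
      | exact (S.EN_same _ _ _ _ k (S.rN _ _ h) (by omega) (by omega)).elim
      | exact (S.EN_same _ _ _ _ (S.rE _ _ k) (S.rN _ _ h) (by omega) (by omega)).elim
      | (exfalso; have u := S.regN _ _ h; have v := S.regE _ _ k; omega)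
      | (exfalso; have u := S.regN _ _ h; have v := S.regN _ _ k; omega)
  | step i ih =>
    intro j x h k
    obtain ⟨x, rfl⟩ := rot_surjective x
    have hj : j = j - 2 + 2 := by abel
    rw [hj] at k
    have := ih (j - 2) x ((mem_cyc_add_two' p q e i x).1 h) ((mem_cyc_add_two' p q e _ x).1 k)
    rw [this]; abel

/-- The region bounds exclude most targets of the six other moves; the few that they leave are the
forbidden differences `EE_up`, `EN_up` and `EN_turn`, up to reflection. -/
theorem Separated.not_move_E {p q : ℤ} {E N : ℤ → ℤ → Prop} (S : Separated p q E N) {x y : ℤ}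
    (h : E x y) (j k : Fin 8)
    (hk : sect E N j (x + (moveVec p q k).1) (y + (moveVec p q k).2)) : k = 3 ∨ k = 4 := by
  have hP := S.pos
  have u := S.regE _ _ h
  fin_cases k <;> simp only [moveVec] at hk <;> first
    | exact Or.inl rfl
    | exact Or.inr rfl
    | exfalso
  all_goals
    fin_cases j <;> simp only [sect] at hk <;> first
    | (have v := S.regE _ _ hk; omega)
    | (have v := S.regN _ _ hk; omega)
    | exact S.EE_up _ _ _ _ h hk (by omega) (by omega)
    | exact S.EE_up _ _ _ _ (S.rE _ _ h) hk (by omega) (by omega)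
    | exact S.EE_up _ _ _ _ (S.rE _ _ h) (S.rE _ _ hk) (by omega) (by omega)
    | exact S.EN_up _ _ _ _ h hk (by omega) (by omega)
    | exact S.EN_up _ _ _ _ h (S.rN _ _ hk) (by omega) (by omega)
    | exact S.EN_up _ _ _ _ (S.rE _ _ h) (S.rN _ _ hk) (by omega) (by omega)
    | exact S.EN_turn _ _ _ _ h hk (by omega) (by omega)
    | exact S.EN_turn _ _ _ _ (S.rE _ _ h) (S.rN _ _ hk) (by omega) (by omega)

theorem Separated.not_move_NE {p q : ℤ} {E N : ℤ → ℤ → Prop} (S : Separated p q E N) {x y : ℤ}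
    (h : N x y) (j k : Fin 8)
    (hk : sect E N j (x + (moveVec p q k).1) (y + (moveVec p q k).2)) : k = 4 ∨ k = 5 := by
  have hP := S.pos
  have u := S.regN _ _ h
  fin_cases k <;> simp only [moveVec] at hk <;> first
    | exact Or.inl rfl
    | exact Or.inr rfl
    | exfalso
  all_goals
    fin_cases j <;> simp only [sect] at hk <;> first
    | (have v := S.regE _ _ hk; omega)
    | (have v := S.regN _ _ hk; omega)
    | exact S.NN_left _ _ _ _ hk h (by omega) (by omega)
    | exact S.NN_left _ _ _ _ (S.rN _ _ hk) (S.rN _ _ h) (by omega) (by omega)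
    | exact S.EN_up _ _ _ _ hk h (by omega) (by omega)
    | exact S.EN_up _ _ _ _ hk (S.rN _ _ h) (by omega) (by omega)
    | exact S.EN_up _ _ _ _ (S.rE _ _ hk) (S.rN _ _ h) (by omega) (by omega)
    | exact S.EN_left _ _ _ _ hk h (by omega) (by omega)
    | exact S.EN_left _ _ _ _ (S.rE _ _ hk) (S.rN _ _ h) (by omega) (by omega)

/-- A perfect cycle admits no moves but those allowed by its sections. -/
theorem move_of_mem {p q : ℤ} (hp : 0 < p) (hpq : p < q) (e : List LiftType) (i : Fin 8) :
    ∀ j k, ∀ x ∈ cyc p q e i, x + moveVec (params p q e).1 (params p q e).2 k ∈ cyc p q e j →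
      k = i + 3 ∨ k = i + 4 := by
  have S := separated hp hpq e
  induction i using fin_eight_rec with
  | h0 =>
    rintro j k ⟨x, y⟩ h hk
    exact S.not_move_E h j k ((mem_cyc p q e j _ _).1 hk)
  | h1 =>
    rintro j k ⟨x, y⟩ h hk
    exact S.not_move_NE h j k ((mem_cyc p q e j _ _).1 hk)
  | step i ih =>
    intro j k x h hk
    obtain ⟨x, rfl⟩ := rot_surjective x
    have hj : j = j - 2 + 2 := by abel
    have hk2 : k = k - 2 + 2 := by abel
    rw [hj, hk2, moveVec_add_two, ← rot_add, mem_cyc_add_two'] at hk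
    have := ih (j - 2) (k - 2) x ((mem_cyc_add_two' p q e i x).1 h) hk
    rcases this with h | h
    · left; rw [hk2, h]; abel
    · right; rw [hk2, h]; abel

/-- The paths of a perfect cycle visit no square twice. -/
theorem cyc_nodup {p q : ℤ} (hp : 0 < p) (hpq : p < q) (e : List LiftType) :
    ∀ i, (cyc p q e i).Nodup := by
  induction e with
  | nil => intro i; simp [cyc]
  | cons t e ih =>
    intro i
    have hd : ∀ j k, j ≠ k → ∀ a ∈ cyc p q e j, a ∉ cyc p q e k :=
      fun j k hjk a ha hb => hjk (section_unique hp hpq e j k a ha hb)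
    refine (List.Nodup.map (add_left_injective _) ?_)
    have hn : ∀ c d : Fin 8, c ≠ d → i + c ≠ i + d := fun c d h h' => h (add_left_cancel h')
    have h1 : i - 1 ≠ i := by revert i; decide
    have h2 : i + 1 ≠ i := by revert i; decide
    have h3 : i - 1 ≠ i + 1 := by revert i; decide
    cases t <;> by_cases h : i.val % 2 = 0 <;>
    simp only [liftPieces, h, if_true, if_false, List.nodup_append', List.nodup_reverse, ih,
      true_and, List.disjoint_left, List.mem_append, List.mem_reverse, or_imp, forall_and]
    all_goals
      repeat' refine And.intro ?_ ?_
      all_goals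
        refine hd _ _ ?_
        first
        | exact hn _ _ (by decide)
        | exact h1
        | exact h3
        | exact h2.symm

/-- The squares of a perfect cycle are pairwise distinct. -/
theorem squares_nodup {p q : ℤ} (hp : 0 < p) (hpq : p < q) (e : List LiftType) :
    (OctoPath.squares (cyc p q e)).Nodup := by
  rw [OctoPath.squares, List.nodup_flatMap]
  refine ⟨fun i _ => cyc_nodup hp hpq e i, ?_⟩
  refine (List.nodup_finRange 8).imp fun {i j} hij => ?_
  exact fun x hx hy => hij (section_unique hp hpq e i j x hx hy)

/-! ## Direction graphs from squares with formal coordinates -/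

theorem moveVec_eq_smul {A : Type*} [AddCommGroup A] (p q : A) (i : Fin 8) : moveVec p q i =
    (dirMatrix i 0 0 • p + dirMatrix i 0 1 • q, dirMatrix i 1 0 • p + dirMatrix i 1 1 • q) := by
  fin_cases i <;> simp [moveVec, dirMatrix]

/-- Linear independence of two pairs of integers. -/
def Indep (P Q : ℤ × ℤ) : Prop := P.1 * Q.2 - P.2 * Q.1 ≠ 0

theorem Indep.eq_zero {P Q : ℤ × ℤ} (h : Indep P Q) {a b : ℤ} (hab : a • P + b • Q = 0) :
    a = 0 ∧ b = 0 := by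
  simp only [Prod.ext_iff, Prod.fst_add, Prod.snd_add, Prod.smul_fst, Prod.smul_snd, smul_eq_mul,
    Prod.fst_zero, Prod.snd_zero] at hab
  obtain ⟨h1, h2⟩ := hab
  constructor
  · refine (mul_eq_zero.1 (?_ : a * (P.1 * Q.2 - P.2 * Q.1) = 0)).resolve_right h
    linear_combination Q.2 * h1 - Q.1 * h2
  · refine (mul_eq_zero.1 (?_ : b * (P.1 * Q.2 - P.2 * Q.1) = 0)).resolve_right h
    linear_combination P.1 * h2 - P.2 * h1

theorem indep_nextParams (t : LiftType) {P Q : ℤ × ℤ} (h : Indep P Q) :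
    Indep (nextParams t P Q).1 (nextParams t P Q).2 := by
  intro h0
  apply h
  cases t <;> simp only [nextParams, Prod.fst_add, Prod.snd_add, Prod.fst_sub, Prod.snd_sub] at h0
  · linear_combination h0
  · linear_combination h0
  · linear_combination -h0
  · linear_combination -h0

theorem indep_params {P Q : ℤ × ℤ} (h : Indep P Q) (e : List LiftType) :
    Indep (params P Q e).1 (params P Q e).2 := by
  induction e with
  | nil => exact h
  | cons t e ih => exact indep_nextParams t ih

/-- The entries of the matrix sum are the coefficients of P and Q in the total displacement. This
fails for integer parameters, which are always dependent; hence the formal coordinates. -/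
theorem sum_dirMatrix_eq_zero {P Q : ℤ × ℤ} (h : Indep P Q) {ι : Type*} [Fintype ι]
    (i : ι → Fin 8) (hs : ∑ k, moveVec P Q (i k) = 0) : ∑ k, dirMatrix (i k) = 0 := by
  simp only [moveVec_eq_smul] at hs
  have h1 := congrArg Prod.fst hs
  have h2 := congrArg Prod.snd hs
  simp only [Prod.fst_sum, Prod.snd_sum, Finset.sum_add_distrib, ← Finset.sum_smul,
    Prod.fst_zero, Prod.snd_zero] at h1 h2
  have h1 := h.eq_zero h1
  have h2 := h.eq_zero h2
  ext a b
  simp only [Matrix.sum_apply, Matrix.zero_apply]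
  fin_cases a <;> fin_cases b
  exacts [h1.1, h1.2, h2.1, h2.2]

theorem dirMatrix_injective : Function.Injective dirMatrix := by
  intro i j h
  revert i j
  decide

theorem Indep.moveVec_injective {P Q : ℤ × ℤ} (h : Indep P Q) :
    Function.Injective (moveVec P Q) := by
  intro i j hij
  apply dirMatrix_injective
  rw [moveVec_eq_smul, moveVec_eq_smul, Prod.mk.injEq] at hij
  have key : ∀ a b c d : ℤ, a • P + b • Q = c • P + d • Q → a = c ∧ b = d := by
    intro a b c d hh
    have : (a - c) • P + (b - d) • Q = 0 := by
      rw [sub_smul, sub_smul, sub_add_sub_comm, hh, sub_self]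
    have := h.eq_zero this
    omega
  have h1 := key _ _ _ _ hij.1
  have h2 := key _ _ _ _ hij.2
  ext a b
  fin_cases a <;> fin_cases b
  exacts [h1.1, h1.2, h2.1, h2.2]

/-- A direction graph given by formal coordinates of its vertices. -/
def DirectionGraph.ofPotential {P Q : ℤ × ℤ} (h : Indep P Q) (V : Type)
    (φ : V → (ℤ × ℤ) × (ℤ × ℤ)) (Arc : V → SkewDir → V → Prop)
    (hφ : ∀ x i y, Arc x i y → φ y = φ x + moveVec P Q i)
    (symm : ∀ x y i, Arc x i y → ∃ j, Arc y j x) : DirectionGraph where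
  V := V
  Arc := Arc
  label_unique x y i j hi hj :=
    h.moveVec_injective (add_left_cancel ((hφ _ _ _ hi).symm.trans (hφ _ _ _ hj)))
  symm := symm
  cycle_sum n x i _ hx := by
    refine sum_dirMatrix_eq_zero h i ?_
    have : ∀ k, moveVec P Q (i k) = φ (x (k + 1)) - φ (x k) := fun k => by
      rw [hφ _ _ _ (hx k)]; abel
    simp only [this, Finset.sum_sub_distrib]
    rw [sub_eq_zero]
    -- Around a cycle the differences of the potential telescope: the cyclic shift permutes the
    -- summands.
    exact Equiv.sum_comp (Equiv.addRight (1 : Fin (n + 1))) fun k => φ (x k)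

/-! ## The form of fundamental direction cycles -/

section Generic

variable {A : Type*} [AddCommGroup A]

/-- The squares of the partitioned cycle with given parameters and descent. -/
def squareSet (p q : A) (e : List LiftType) : Set (A × A) := {x | ∃ i, x ∈ cyc p q e i}

/-- The arcs of `Φ` are the moves between squares of the given cycle. -/
def MoveForm (p q : A) (e : List LiftType) (Φ : DirectionGraph) : Prop :=
  ∃ σ : squareSet p q e ≃ Φ.V, ∀ (a b : squareSet p q e) i,
    (b : A × A) = a + moveVec (params p q e).1 (params p q e).2 i ↔ Φ.Arc (σ a) i (σ b)

end Generic

/-- Evaluation of formal coordinates. -/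
def evalHom (p q : ℤ) : ℤ × ℤ →+ ℤ where
  toFun a := a.1 * p + a.2 * q
  map_zero' := by simp
  map_add' a b := by simp; ring

theorem cyc_eval (p q : ℤ) (e : List LiftType) (i : Fin 8) : cyc p q e i =
    (cyc ((1, 0) : ℤ × ℤ) (0, 1) e i).map (Prod.map (evalHom p q) (evalHom p q)) := by
  rw [← cyc_map]; simp [evalHom]

theorem params_eval (p q : ℤ) (e : List LiftType) : params p q e =
    (evalHom p q (params ((1, 0) : ℤ × ℤ) (0, 1) e).1,
      evalHom p q (params ((1, 0) : ℤ × ℤ) (0, 1) e).2) := by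
  rw [← params_map]; simp [evalHom]

/-- The evaluated list of squares has no repetition, so no two formal squares can have the same
value. -/
theorem eval_injOn {p q : ℤ} (hp : 0 < p) (hpq : p < q) (e : List LiftType) :
    Set.InjOn (Prod.map (evalHom p q) (evalHom p q)) (squareSet ((1, 0) : ℤ × ℤ) (0, 1) e) := by
  have h := squares_nodup hp hpq e
  have h2 : OctoPath.squares (cyc p q e) =
      ((List.finRange 8).flatMap (cyc ((1, 0) : ℤ × ℤ) (0, 1) e)).map
        (Prod.map (evalHom p q) (evalHom p q)) := by
    rw [OctoPath.squares, List.map_flatMap]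
    congr 1
    funext i
    exact cyc_eval p q e i
  rw [h2] at h
  rintro x ⟨i, hx⟩ y ⟨j, hy⟩ hxy
  exact List.inj_on_of_nodup_map h (List.mem_flatMap.2 ⟨i, List.mem_finRange i, hx⟩)
    (List.mem_flatMap.2 ⟨j, List.mem_finRange j, hy⟩) hxy

theorem eval_bijOn {p q : ℤ} (hp : 0 < p) (hpq : p < q) (e : List LiftType) :
    Set.BijOn (Prod.map (evalHom p q) (evalHom p q)) (squareSet ((1, 0) : ℤ × ℤ) (0, 1) e)
      (squareSet p q e) := by
  refine ⟨?_, eval_injOn hp hpq e, ?_⟩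
  · rintro x ⟨i, hx⟩
    exact ⟨i, by rw [cyc_eval]; exact List.mem_map_of_mem hx⟩
  · rintro x ⟨i, hx⟩
    rw [cyc_eval, List.mem_map] at hx
    obtain ⟨y, hy, rfl⟩ := hx
    exact ⟨y, ⟨i, hy⟩, rfl⟩

/-- No move appears by numerical accident. An actual move has one of the two directions of its
section, a formal move of this direction exists there as well, and by injectivity of evaluation its
target is the given square. -/
theorem eval_move_iff {p q : ℤ} (hp : 0 < p) (hpq : p < q) (e : List LiftType)
    {a b : (ℤ × ℤ) × (ℤ × ℤ)} (ha : a ∈ squareSet ((1, 0) : ℤ × ℤ) (0, 1) e)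
    (hb : b ∈ squareSet ((1, 0) : ℤ × ℤ) (0, 1) e) (i : Fin 8) :
    Prod.map (evalHom p q) (evalHom p q) b = Prod.map (evalHom p q) (evalHom p q) a +
        moveVec (params p q e).1 (params p q e).2 i ↔
      b = a + moveVec (params ((1, 0) : ℤ × ℤ) (0, 1) e).1 (params ((1, 0) : ℤ × ℤ) (0, 1) e).2 i := by
  have hm : Prod.map (evalHom p q) (evalHom p q) a +
        moveVec (params p q e).1 (params p q e).2 i =
      Prod.map (evalHom p q) (evalHom p q) (a +
        moveVec (params ((1, 0) : ℤ × ℤ) (0, 1) e).1 (params ((1, 0) : ℤ × ℤ) (0, 1) e).2 i) := by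
    rw [params_eval, moveVec_map]
    simp [Prod.ext_iff]
  constructor
  · intro h
    obtain ⟨k, hk⟩ := ha
    obtain ⟨l, hl⟩ := (eval_bijOn hp hpq e).1 hb
    have hk' : Prod.map (evalHom p q) (evalHom p q) a ∈ cyc p q e k := by
      rw [cyc_eval]; exact List.mem_map_of_mem hk
    rw [h] at hl
    have hi := move_of_mem hp hpq e k l i _ hk' hl
    have hmem : a + moveVec (params ((1, 0) : ℤ × ℤ) (0, 1) e).1
        (params ((1, 0) : ℤ × ℤ) (0, 1) e).2 i ∈ squareSet ((1, 0) : ℤ × ℤ) (0, 1) e := by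
      have := add_moveVec_mem ((1, 0) : ℤ × ℤ) (0, 1) e k a hk
      rcases hi with rfl | rfl
      · rcases this.1 with h | h <;> exact ⟨_, h⟩
      · rcases this.2 with h | h <;> exact ⟨_, h⟩
    exact eval_injOn hp hpq e hb hmem (h.trans hm)
  · rintro rfl
    exact hm.symm

/-- This allows any convenient parameters to be used for a given descent. -/
theorem moveForm_iff {p q : ℤ} (hp : 0 < p) (hpq : p < q) (e : List LiftType)
    (Φ : DirectionGraph) : MoveForm p q e Φ ↔ MoveForm ((1, 0) : ℤ × ℤ) (0, 1) e Φ := by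
  let τ := Set.BijOn.equiv _ (eval_bijOn hp hpq e)
  have hτ : ∀ a, (τ a : ℤ × ℤ) = Prod.map (evalHom p q) (evalHom p q) a := fun a => rfl
  constructor
  · rintro ⟨σ, h⟩
    refine ⟨τ.trans σ, fun a b i => ?_⟩
    rw [← eval_move_iff hp hpq e a.2 b.2, ← hτ, ← hτ]
    exact h _ _ _
  · rintro ⟨σ, h⟩
    refine ⟨τ.symm.trans σ, fun a b i => ?_⟩
    rw [Equiv.trans_apply, Equiv.trans_apply, ← h, ← eval_move_iff hp hpq e (τ.symm a).2 (τ.symm b).2, ← hτ, ← hτ,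
      Equiv.apply_symm_apply, Equiv.apply_symm_apply]

theorem exists_moveForm (e : List LiftType) :
    ∃ Φ, MoveForm ((1, 0) : ℤ × ℤ) (0, 1) e Φ := by
  have h : Indep (params ((1, 0) : ℤ × ℤ) (0, 1) e).1 (params ((1, 0) : ℤ × ℤ) (0, 1) e).2 :=
    indep_params (by simp [Indep]) e
  refine ⟨DirectionGraph.ofPotential h (squareSet ((1, 0) : ℤ × ℤ) (0, 1) e) Subtype.val
    (fun x i y => (y : (ℤ × ℤ) × (ℤ × ℤ)) = x + moveVec (params ((1, 0) : ℤ × ℤ) (0, 1) e).1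
      (params ((1, 0) : ℤ × ℤ) (0, 1) e).2 i) (fun _ _ _ h => h) ?_, Equiv.refl _, ?_⟩
  · intro x y i h
    exact ⟨i + 4, by rw [moveVec_add_four, h]; abel⟩
  · intro a b i
    rfl

theorem isMoveOfDir_iff (p q : ℤ) (i : Fin 8) (a b : Square) :
    IsMoveOfDir p q i a b ↔ b = a + moveVec p q i := by
  rw [IsMoveOfDir, moveVec_eq_smul, Prod.ext_iff, ← List.ofFn_inj]
  simp [Matrix.mulVec, dotProduct, Fin.sum_univ_two, sub_eq_iff_eq_add']

theorem board_secondCycle (r s : ℤ) (o : OriginType) (e : List LiftType) :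
    OctoPath.board (secondCycle r s o e) =
      squareSet (startParams o r s).1 (startParams o r s).2 e := by
  ext x
  simp [OctoPath.board, OctoPath.squares, squareSet, secondCycle_eq]

theorem startParams_pos {r s : ℤ} (hr : 0 < r) (hrs : r < s) (o : OriginType) :
    0 < (startParams o r s).1 ∧ (startParams o r s).1 < (startParams o r s).2 := by
  cases o <;> simp only [startParams] <;> constructor <;> omega

theorem isLeaperMove_moveVec {p q : ℤ} (hp : 0 < p) (hpq : p < q) (a : Square) (i : Fin 8) :
    IsLeaperMove p q a (a + moveVec p q i) := by
  have h1 : |p| = p := abs_of_pos hp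
  have h2 : |q| = q := abs_of_pos (hp.trans hpq)
  fin_cases i <;> simp [IsLeaperMove, moveVec, h1, h2]

theorem moveVec_ne_zero {p : ℤ} (hp : 0 < p) (q : ℤ) (i : Fin 8) :
    moveVec p q i ≠ 0 := by
  fin_cases i <;> simp [moveVec] <;> omega

theorem extractedFromFirst_iff {r s : ℕ} (hr : 0 < r) (hrs : r < s) (o : OriginType)
    (e : List LiftType) (Φ : DirectionGraph) : ExtractedFromFirst r s o e Φ ↔
      MoveForm (startParams o (r : ℤ) s).1 (startParams o (r : ℤ) s).2 e Φ := by
  have hpos := startParams_pos (r := r) (s := s) (by omega) (by omega) o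
  have hS := (separated hpos.1 hpos.2 e).pos
  have key : ∀ (a b : OctoPath.board (secondCycle r s o e)) (i : Fin 8),
      ((firstCycle r s o e).Adj a b ∧
        IsMoveOfDir (proportions r s o e).1 (proportions r s o e).2 i (a : Square) (b : Square)) ↔
      (b : Square) = a + moveVec (params (startParams o (r : ℤ) s).1 (startParams o (r : ℤ) s).2 e).1
        (params (startParams o (r : ℤ) s).1 (startParams o (r : ℤ) s).2 e).2 i := by
    intro a b i
    rw [isMoveOfDir_iff, proportions_eq]
    refine ⟨fun h => h.2, fun h => ⟨?_, h⟩⟩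
    rw [firstCycle, leaperGraph, SimpleGraph.fromRel_adj, proportions_eq]
    refine ⟨?_, Or.inl ?_⟩
    · rintro rfl
      exact moveVec_ne_zero hS.1 _ i (left_eq_add.1 h)
    · rw [h]; exact isLeaperMove_moveVec hS.1 hS.2 _ _
  let τ := Equiv.setCongr (board_secondCycle (r : ℤ) s o e)
  constructor
  · rintro ⟨σ, h⟩
    refine ⟨τ.symm.trans σ, fun a b i => ?_⟩
    exact (key (τ.symm a) (τ.symm b) i).symm.trans (h _ _ _)
  · rintro ⟨σ, h⟩
    refine ⟨τ.trans σ, fun a b i => ?_⟩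
    exact (key a b i).trans (h (τ a) (τ b) i)

theorem IsFundamental.moveForm {e : List LiftType} {Φ : DirectionGraph} (h : IsFundamental e Φ) :
    MoveForm ((1, 0) : ℤ × ℤ) (0, 1) e Φ := by
  obtain ⟨r, s, hr, hrs, o, h⟩ := h
  have hpos := startParams_pos (r := r) (s := s) (by omega) (by omega) o
  exact (moveForm_iff hpos.1 hpos.2 e Φ).1 ((extractedFromFirst_iff hr hrs o e Φ).1 h)

theorem exists_extractedFromFirst {r s : ℕ} (hr : 0 < r) (hrs : r < s) (o : OriginType)
    (e : List LiftType) : ∃ Φ, ExtractedFromFirst r s o e Φ := by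
  have hpos := startParams_pos (r := r) (s := s) (by omega) (by omega) o
  obtain ⟨Φ, h⟩ := exists_moveForm e
  exact ⟨Φ, (extractedFromFirst_iff hr hrs o e Φ).2 ((moveForm_iff hpos.1 hpos.2 e Φ).2 h)⟩

theorem MoveForm.coincide {A : Type*} [AddCommGroup A] {p q : A} {e : List LiftType}
    {Φ Ψ : DirectionGraph} (h : MoveForm p q e Φ) (h' : MoveForm p q e Ψ) : Φ.Coincide Ψ := by
  obtain ⟨σ, h⟩ := h
  obtain ⟨τ, h'⟩ := h'
  refine ⟨σ.symm.trans τ, fun x i y => ?_⟩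
  rw [Equiv.trans_apply, Equiv.trans_apply, ← h', h]
  simp

/-! ## Companions -/

section Generic

variable {A : Type*} [AddCommGroup A]

/-- Rotation through `45°`, combined with a scaling. -/
def halfRot (x : A × A) : A × A := (x.1 - x.2, x.1 + x.2)

theorem halfRot_add (x y : A × A) : halfRot (x + y) = halfRot x + halfRot y := by
  simp only [halfRot, Prod.fst_add, Prod.snd_add, Prod.mk_add_mk, Prod.mk.injEq]
  constructor <;> abel

theorem liftPieces_companion {X : Type*} (t : LiftType) (a b : Fin 8 → List X)
    (h : ∀ j, b (j + 1) = a j) (i : Fin 8) :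
    liftPieces t.companion b (i + 1) = liftPieces t a i := by
  have hc : ∀ c : Fin 8, i + 1 + c = i + c + 1 := fun c => by abel
  have hd : i + 1 - 1 = i - 1 + 1 := by abel
  have h2 : i.val % 2 = 0 ↔ ¬ (i + 1).val % 2 = 0 := by revert i; decide
  by_cases h0 : (i + 1).val % 2 = 0 <;> cases t <;>
    simp only [LiftType.companion, liftPieces, h2, h0, hc, hd, h, not_true, not_false_iff, if_true,
      if_false]

theorem nextParams_companion (t : LiftType) (p q : A) :
    nextParams t.companion (q - p) (q + p) =
      ((nextParams t p q).2 - (nextParams t p q).1, (nextParams t p q).2 + (nextParams t p q).1) := by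
  cases t <;> simp only [LiftType.companion, nextParams, Prod.mk.injEq] <;> constructor <;> abel

theorem params_companion (p q : A) (e : List LiftType) :
    params (q - p) (q + p) (companion e) =
      ((params p q e).2 - (params p q e).1, (params p q e).2 + (params p q e).1) := by
  induction e with
  | nil => rfl
  | cons t e ih =>
    have : companion (t :: e) = t.companion :: companion e := rfl
    rw [this, params, ih, nextParams_companion]
    rfl

theorem compassVec_halfRot (t : LiftType) (p q : A) (i : Fin 8) :
    compassVec (i + 1) (liftCoeff t.companion (q - p) (q + p) (i + 1)) =
      halfRot (compassVec i (liftCoeff t p q i)) := by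
  fin_cases i <;> cases t <;>
    simp [LiftType.companion, liftCoeff, compassVec, compass, halfRot] <;> abel

/-- The 45° rotation with scaling by √2 exchanges axis and diagonal sections. On lifts this is the
exchange of f with g and of h with ħ; on parameters it is (p, q) ↦ (q - p, q + p). -/
theorem cyc_companion (p q : A) (e : List LiftType) (i : Fin 8) :
    cyc (q - p) (q + p) (companion e) (i + 1) = (cyc p q e i).map halfRot := by
  induction e generalizing i with
  | nil =>
    fin_cases i <;> simp [companion, cyc, compassVec, compass, halfRot] <;> abel
  | cons t e ih =>
    have : companion (t :: e) = t.companion :: companion e := rfl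
    simp only [this, cyc, params_companion]
    rw [liftPieces_companion t (fun j => (cyc p q e j).map halfRot) _ ih, liftPieces_map,
      compassVec_halfRot, List.map_map, List.map_map]
    congr 1
    funext x
    simp [halfRot_add]

theorem moveVec_halfRot (p q : A) (i : Fin 8) :
    moveVec (q - p) (q + p) (i + 1) = halfRot (moveVec p q i) := by
  fin_cases i <;> simp [moveVec, halfRot] <;> (try constructor) <;> abel

end Generic

theorem halfRot_injective : Function.Injective (halfRot : ℤ × ℤ → ℤ × ℤ) := by
  rintro ⟨a, b⟩ ⟨c, d⟩ h
  simp only [halfRot, Prod.mk.injEq] at h ⊢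
  omega

theorem isEquivalencePerm_addRight_one : IsEquivalencePerm (Equiv.addRight 1) := by
  -- The left factor is the matrix of `halfRot`; the right one is the inverse of the parameter
  -- change (p, q) ↦ (q - p, q + p).
  refine ⟨!![1, -1; 1, 1], !![-1 / 2, 1 / 2; 1 / 2, 1 / 2], fun i => ?_⟩
  fin_cases i <;> ext a b <;> fin_cases a <;> fin_cases b <;>
    simp only [Matrix.mul_apply, Fin.sum_univ_two, Matrix.map_apply] <;>
    simp [dirMatrix] <;> norm_num

theorem halfRot_bijOn (p q : ℤ) (e : List LiftType) :
    Set.BijOn halfRot (squareSet p q e) (squareSet (q - p) (q + p) (companion e)) := by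
  refine ⟨?_, halfRot_injective.injOn, ?_⟩
  · rintro x ⟨i, hx⟩
    exact ⟨i + 1, by rw [cyc_companion]; exact List.mem_map_of_mem hx⟩
  · rintro x ⟨i, hx⟩
    have hi : i = i - 1 + 1 := by abel
    rw [hi, cyc_companion, List.mem_map] at hx
    obtain ⟨y, hy, rfl⟩ := hx
    exact ⟨y, ⟨_, hy⟩, rfl⟩

theorem MoveForm.equivalent_companion {e : List LiftType} {Φ Ψ : DirectionGraph}
    (h : MoveForm ((1, 0) : ℤ × ℤ) (0, 1) e Φ)
    (h' : MoveForm ((1, 0) : ℤ × ℤ) (0, 1) (companion e) Ψ) : Φ.Equivalent Ψ := by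
  -- The parameters (1, 2) and (2 - 1, 2 + 1) are related as `halfRot` requires.
  obtain ⟨σ, h⟩ := (moveForm_iff (p := 1) (q := 2) (by norm_num) (by norm_num) _ _).2 h
  obtain ⟨τ, h'⟩ := (moveForm_iff (p := 2 - 1) (q := 2 + 1) (by norm_num) (by norm_num) _ _).2 h'
  refine ⟨Equiv.addRight 1, isEquivalencePerm_addRight_one,
    (σ.symm.trans (Set.BijOn.equiv halfRot (halfRot_bijOn 1 2 e))).trans τ, fun x i y => ?_⟩
  obtain ⟨a, rfl⟩ := σ.surjective x
  obtain ⟨b, rfl⟩ := σ.surjective y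
  simp only [Equiv.trans_apply, Equiv.symm_apply_apply]
  rw [← h, ← h', params_companion]
  simp only [Equiv.coe_addRight, moveVec_halfRot]
  have hτ : ∀ a, ((Set.BijOn.equiv halfRot (halfRot_bijOn 1 2 e)) a : ℤ × ℤ) = halfRot a := fun a => rfl
  rw [hτ, hτ, ← halfRot_add]
  exact halfRot_injective.eq_iff.symm

/-! ## Equivalence permutations -/

/-- The direction matrices over the reals. -/
abbrev realDir (i : SkewDir) : Matrix (Fin 2) (Fin 2) ℝ := (dirMatrix i).map (fun z : ℤ => (z : ℝ))

theorem realDir_injective : Function.Injective realDir := by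
  intro i j h
  apply dirMatrix_injective
  ext a b
  have := congrFun (congrFun h a) b
  simpa [realDir] using this

theorem det_realDir (i : SkewDir) : (realDir i).det = if i.val % 2 = 0 then -1 else 1 := by
  fin_cases i <;> simp [realDir, dirMatrix, Matrix.det_fin_two]

theorem realDir_one : realDir 1 = 1 := by
  ext a b
  fin_cases a <;> fin_cases b <;> simp [realDir, dirMatrix]

theorem isEquivalencePerm_refl : IsEquivalencePerm (Equiv.refl _) :=
  ⟨1, 1, fun i => by simp⟩

theorem IsEquivalencePerm.trans {π ρ : Equiv.Perm SkewDir} (h : IsEquivalencePerm π)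
    (h' : IsEquivalencePerm ρ) : IsEquivalencePerm (π.trans ρ) := by
  obtain ⟨P, Q, h⟩ := h
  obtain ⟨P', Q', h'⟩ := h'
  exact ⟨P' * P, Q * Q', fun i => by rw [Equiv.trans_apply, h', h]; simp only [Matrix.mul_assoc]⟩

theorem isUnit_det_of_realDir {π : Equiv.Perm SkewDir} {P Q : Matrix (Fin 2) (Fin 2) ℝ}
    (h : ∀ i, realDir (π i) = P * realDir i * Q) : IsUnit P.det ∧ IsUnit Q.det := by
  have h1 := congrArg Matrix.det (h 1)
  rw [realDir_one, mul_one, Matrix.det_mul, det_realDir] at h1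
  have h0 : P.det * Q.det ≠ 0 := by
    rw [← h1]; split_ifs <;> norm_num
  exact ⟨isUnit_iff_ne_zero.2 (left_ne_zero_of_mul h0),
    isUnit_iff_ne_zero.2 (right_ne_zero_of_mul h0)⟩

theorem IsEquivalencePerm.symm {π : Equiv.Perm SkewDir} (h : IsEquivalencePerm π) :
    IsEquivalencePerm π.symm := by
  obtain ⟨P, Q, h⟩ := h
  obtain ⟨hP, hQ⟩ := isUnit_det_of_realDir h
  refine ⟨P⁻¹, Q⁻¹, fun i => ?_⟩
  have := h (π.symm i)
  rw [Equiv.apply_symm_apply] at this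
  rw [this, Matrix.mul_assoc P, Matrix.nonsing_inv_mul_cancel_left _ _ hP,
    Matrix.mul_nonsing_inv_cancel_right _ _ hQ]

theorem DirectionGraph.Equivalent.refl (Φ : DirectionGraph) : Φ.Equivalent Φ :=
  ⟨Equiv.refl _, isEquivalencePerm_refl, Equiv.refl _, fun _ _ _ => Iff.rfl⟩

theorem DirectionGraph.Coincide.equivalent {Φ Ψ : DirectionGraph} (h : Φ.Coincide Ψ) :
    Φ.Equivalent Ψ := ⟨Equiv.refl _, isEquivalencePerm_refl, h⟩

/-! ## Counting vertices by the directions of their arcs -/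

/-- The four pairings of directions: the direction matrix of `partner c i` is the product of the
direction matrix of `i` and a reflection which depends on `c`. -/
def partner (c : Fin 4) (i : SkewDir) : SkewDir :=
  if i.val % 2 = 0 then i + Fin.ofNat 8 (2 * c.val + 1) else i - Fin.ofNat 8 (2 * c.val + 1)

theorem realDir_partner (c : Fin 4) (i : SkewDir) :
    realDir (partner c i) = realDir i * realDir (partner c 1) := by
  have h : dirMatrix (partner c i) = dirMatrix i * dirMatrix (partner c 1) := by
    revert c i; decide
  rw [realDir, h]
  exact Matrix.map_mul (f := Int.castRingHom ℝ)

/-- A pairing is right multiplication by a reflection R, and i ↦ P Aᵢ Q conjugates R by Q.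
Evaluating at the identity matrix shows that the conjugate is again one of the four reflections, so
the same pairing d serves for all i. -/
theorem IsEquivalencePerm.exists_partner {π : Equiv.Perm SkewDir} (h : IsEquivalencePerm π)
    (c : Fin 4) : ∃ d, ∀ i, π (partner c i) = partner d (π i) := by
  obtain ⟨P, Q, h⟩ := h
  obtain ⟨hP, hQ⟩ := isUnit_det_of_realDir h
  have h : ∀ i, realDir (π i) = P * realDir i * Q := h
  have h1 := h 1
  have h2 := h (partner c 1)
  -- Parity is the sign of the determinant. The identity and a reflection have opposite signs, and
  -- so have their images.
  have hpar : (π (partner c 1)).val % 2 ≠ (π 1).val % 2 := by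
    intro hh
    have d1 := congrArg Matrix.det h1
    have d2 := congrArg Matrix.det h2
    have hc : ∀ c : Fin 4, (partner c 1).val % 2 = 0 := by decide
    rw [Matrix.det_mul, Matrix.det_mul, det_realDir, det_realDir] at d1 d2
    rw [hh, d1, if_pos (hc c)] at d2
    have : P.det * Q.det = 0 := by
      have h11 : (1 : Fin 8).val % 2 ≠ 0 := by decide
      rw [if_neg h11] at d2
      linarith
    exact (mul_ne_zero hP.ne_zero hQ.ne_zero) this
  have hd : ∀ i j : Fin 8, j.val % 2 ≠ i.val % 2 → ∃ d, j = partner d i := by decide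
  obtain ⟨d, hd⟩ := hd _ _ hpar
  have hK : realDir (partner c 1) * Q = Q * realDir (partner d 1) := by
    rw [hd, realDir_partner, h1, realDir_one, mul_one] at h2
    have := congrArg (P⁻¹ * ·) h2
    simp only [Matrix.mul_assoc] at this
    rw [Matrix.nonsing_inv_mul_cancel_left _ _ hP, Matrix.nonsing_inv_mul_cancel_left _ _ hP]
      at this
    exact this.symm
  refine ⟨d, fun i => realDir_injective ?_⟩
  rw [h, realDir_partner, realDir_partner d, h i, Matrix.mul_assoc P, Matrix.mul_assoc (realDir i),
    hK]
  simp only [Matrix.mul_assoc]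

theorem IsEquivalencePerm.exists_perm {π : Equiv.Perm SkewDir} (h : IsEquivalencePerm π) :
    ∃ τ : Equiv.Perm (Fin 4), ∀ c i, π (partner c i) = partner (τ c) (π i) := by
  choose τ hτ using h.exists_partner
  have hinj : Function.Injective τ := by
    intro c d hcd
    have h1 := hτ c 1
    rw [hcd, ← hτ d 1] at h1
    have hp : ∀ c d : Fin 4, partner c 1 = partner d 1 → c = d := by decide
    exact hp _ _ (π.injective h1)
  exact ⟨Equiv.ofBijective τ (Finite.injective_iff_bijective.1 hinj), hτ⟩

/-- The number of vertices with two arcs whose directions are paired by `partner c`. -/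
noncomputable def DirectionGraph.pairCount (Φ : DirectionGraph) (c : Fin 4) : ℕ :=
  Nat.card {x : Φ.V // ∃ i y z, Φ.Arc x i y ∧ Φ.Arc x (partner c i) z}

theorem pairCount_eq_of_perm {Φ Ψ : DirectionGraph} (π : Equiv.Perm SkewDir)
    (τ : Equiv.Perm (Fin 4)) (hτ : ∀ c i, π (partner c i) = partner (τ c) (π i))
    (σ : Φ.V ≃ Ψ.V) (h : ∀ x i y, Φ.Arc x i y ↔ Ψ.Arc (σ x) (π i) (σ y)) (c : Fin 4) :
    Φ.pairCount c = Ψ.pairCount (τ c) := by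
  refine Nat.card_congr (Equiv.subtypeEquiv σ fun x => ?_)
  constructor
  · rintro ⟨i, y, z, h1, h2⟩
    exact ⟨π i, σ y, σ z, (h _ _ _).1 h1, by rw [← hτ]; exact (h _ _ _).1 h2⟩
  · rintro ⟨i, y, z, h1, h2⟩
    obtain ⟨i, rfl⟩ := π.surjective i
    obtain ⟨y, rfl⟩ := σ.surjective y
    obtain ⟨z, rfl⟩ := σ.surjective z
    rw [← hτ] at h2
    exact ⟨i, y, z, (h _ _ _).2 h1, (h _ _ _).2 h2⟩

/-- The nonzero values of `pairCount` are `a` and `b`. -/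
def DirectionGraph.HasCounts (Φ : DirectionGraph) (a b : ℕ) : Prop :=
  ∃ c d, c ≠ d ∧ Φ.pairCount c = a ∧ Φ.pairCount d = b ∧
    ∀ x, x ≠ c → x ≠ d → Φ.pairCount x = 0

/-- Equivalence only permutes the four counts. As a and b are positive, their classes must go to the
two classes of Ψ that are allowed a nonzero count. -/
theorem DirectionGraph.HasCounts.eq_or_swap {Φ Ψ : DirectionGraph} {a b a' b' : ℕ}
    (h : Φ.HasCounts a b) (h' : Ψ.HasCounts a' b') (ha : 0 < a) (hb : 0 < b)
    (hΦΨ : Φ.Equivalent Ψ) : (a = a' ∧ b = b') ∨ (a = b' ∧ b = a') := by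
  obtain ⟨π, hπ, σ, hσ⟩ := hΦΨ
  obtain ⟨τ, hτ⟩ := hπ.exists_perm
  have key := pairCount_eq_of_perm π τ hτ σ hσ
  obtain ⟨c, d, hcd, hc, hd, -⟩ := h
  obtain ⟨c', d', -, hc', hd', h0⟩ := h'
  rw [key] at hc hd
  have hne : τ c ≠ τ d := fun h => hcd (τ.injective h)
  have h1 : τ c = c' ∨ τ c = d' := by
    by_contra! hh
    have := h0 _ hh.1 hh.2
    omega
  have h2 : τ d = c' ∨ τ d = d' := by
    by_contra! hh
    have := h0 _ hh.1 hh.2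
    omega
  rcases h1 with h1 | h1 <;> rcases h2 with h2 | h2 <;> rw [h1, h2] at hne <;>
    rw [h1] at hc <;> rw [h2] at hd
  · exact absurd rfl hne
  · left; omega
  · right; omega
  · exact absurd rfl hne

/-! ## Counts and descents -/

/-- The effect of a lift on the numbers of squares in the sections `E` and `NE`. -/
def countStep (t : LiftType) (v : ℕ × ℕ) : ℕ × ℕ :=
  match t with
  | .f => (v.1 + 2 * v.2, v.2)
  | .g => (v.1, 2 * v.1 + v.2)
  | .h => (3 * v.1 + 2 * v.2, 2 * v.1 + v.2)
  | .hbar => (v.1 + 2 * v.2, 2 * v.1 + 3 * v.2)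

/-- The effect of a string of lifts on the numbers of squares in the sections `E` and `NE`. -/
def counts (e : List LiftType) (v : ℕ × ℕ) : ℕ × ℕ := e.foldr countStep v

theorem counts_pos (e : List LiftType) : 0 < (counts e (1, 1)).1 ∧ 0 < (counts e (1, 1)).2 := by
  induction e with
  | nil => simp [counts]
  | cons t e ih =>
    simp only [counts, List.foldr_cons] at ih ⊢
    cases t <;> simp only [countStep] <;> omega

/-- On positive vectors the steps have disjoint images: x > 2y for f, y > 2x for g, y < x < 2y for h
and x < y < 2x for ħ, while the start has x = y. Each step is an invertible linear map, so the
characters can be peeled off one at a time. -/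
theorem counts_injective {e e' : List LiftType} (h : counts e (1, 1) = counts e' (1, 1)) :
    e = e' := by
  induction e generalizing e' with
  | nil =>
    cases e' with
    | nil => rfl
    | cons t e' =>
      have := counts_pos e'
      simp only [counts, List.foldr_cons, List.foldr_nil, Prod.ext_iff] at this h
      cases t <;> simp only [countStep] at h <;> omega
  | cons t e ih =>
    have h1 := counts_pos e
    cases e' with
    | nil =>
      simp only [counts, List.foldr_cons, List.foldr_nil, Prod.ext_iff] at h1 h
      cases t <;> simp only [countStep] at h <;> omega
    | cons t' e' =>
      have h2 := counts_pos e'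
      have ih := @ih e'
      simp only [counts, List.foldr_cons, Prod.ext_iff] at h1 h2 h ih
      cases t <;> cases t' <;> simp only [countStep] at h <;> first
        | (exfalso; omega)
        | rw [ih (by omega)]

theorem counts_companion (e : List LiftType) (v : ℕ × ℕ) :
    counts (companion e) v.swap = (counts e v).swap := by
  induction e with
  | nil => rfl
  | cons t e ih =>
    simp only [counts, companion, List.map_cons, List.foldr_cons] at ih ⊢
    rw [ih]
    cases t <;> simp [LiftType.companion, countStep, add_comm]

theorem eq_or_companion_of_counts {e e' : List LiftType}
    (h : ((counts e (1, 1)).1 = (counts e' (1, 1)).1 ∧ (counts e (1, 1)).2 = (counts e' (1, 1)).2) ∨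
      ((counts e (1, 1)).1 = (counts e' (1, 1)).2 ∧ (counts e (1, 1)).2 = (counts e' (1, 1)).1)) :
    e = e' ∨ e' = companion e := by
  rcases h with h | h
  · exact Or.inl (counts_injective (Prod.ext h.1 h.2))
  · right
    apply counts_injective
    have := counts_companion e (1, 1)
    rw [Prod.swap_prod_mk] at this
    rw [this]
    exact Prod.ext h.2.symm h.1.symm

theorem length_liftPieces {X : Type*} {t : LiftType} {a : Fin 8 → List X} {v : ℕ × ℕ}
    (h : ∀ i, (a i).length = if i.val % 2 = 0 then v.1 else v.2) (i : Fin 8) :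
    (liftPieces t a i).length = if i.val % 2 = 0 then (countStep t v).1 else (countStep t v).2 := by
  fin_cases i <;> cases t <;> simp [liftPieces, h, countStep] <;> ring

theorem length_cyc {A : Type*} [AddCommGroup A] (p q : A) (e : List LiftType) (i : Fin 8) :
    (cyc p q e i).length =
      if i.val % 2 = 0 then (counts e (1, 1)).1 else (counts e (1, 1)).2 := by
  induction e generalizing i with
  | nil => simp [cyc, counts]
  | cons t e ih =>
    rw [cyc, List.length_map]
    exact length_liftPieces ih i

theorem card_mem_list {X : Type*} {l : List X} (h : l.Nodup) : Nat.card {x // x ∈ l} = l.length := by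
  classical
  rw [Nat.card_congr (List.Nodup.getEquiv l h).symm, Nat.card_fin]

/-- The pairing of the two directions allowed in a section. -/
def sectionPairing (k : Fin 8) : Fin 4 := if k.val % 2 = 0 then 3 else 0

/-- A vertex in section k has exactly the directions k + 3 and k + 4, so its pairing depends only on
the parity of k. The count is a total length of sections. -/
theorem MoveForm.pairCount {p q : ℤ} (hp : 0 < p) (hpq : p < q) {e : List LiftType}
    {Φ : DirectionGraph} (h : MoveForm p q e Φ) (c : Fin 4) : Φ.pairCount c =
      (((List.finRange 8).filter fun k => sectionPairing k = c).flatMap (cyc p q e)).length := by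
  obtain ⟨σ, h⟩ := h
  have hnd : (((List.finRange 8).filter fun k => sectionPairing k = c).flatMap (cyc p q e)).Nodup :=
    (squares_nodup hp hpq e).sublist (List.Sublist.flatMap List.filter_sublist _)
  rw [← card_mem_list hnd]
  have hdir : ∀ k, ∀ x ∈ cyc p q e k, ∀ i, (∃ b : squareSet p q e,
      (b : ℤ × ℤ) = x + moveVec (params p q e).1 (params p q e).2 i) ↔ i = k + 3 ∨ i = k + 4 := by
    intro k x hx i
    constructor
    · rintro ⟨⟨b, j, hb⟩, rfl⟩
      exact move_of_mem hp hpq e k j i x hx hb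
    · intro hi
      have := add_moveVec_mem p q e k x hx
      rcases hi with rfl | rfl
      · rcases this.1 with h | h <;> exact ⟨⟨_, _, h⟩, rfl⟩
      · rcases this.2 with h | h <;> exact ⟨⟨_, _, h⟩, rfl⟩
  have hpair : ∀ (c : Fin 4) (k : Fin 8), (∃ i, (i = k + 3 ∨ i = k + 4) ∧
      (partner c i = k + 3 ∨ partner c i = k + 4)) ↔ sectionPairing k = c := by
    decide
  have hx : ∀ x : squareSet p q e, (∃ i y z, Φ.Arc (σ x) i y ∧ Φ.Arc (σ x) (partner c i) z) ↔
      (x : ℤ × ℤ) ∈ ((List.finRange 8).filter fun k => sectionPairing k = c).flatMap (cyc p q e) := by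
    rintro ⟨x, k, hk⟩
    have h1 : (∃ i y z, Φ.Arc (σ ⟨x, k, hk⟩) i y ∧ Φ.Arc (σ ⟨x, k, hk⟩) (partner c i) z) ↔
        sectionPairing k = c := by
      rw [← hpair c k]
      refine exists_congr fun i => ?_
      rw [← hdir k x hk, ← hdir k x hk]
      constructor
      · rintro ⟨y, z, h1, h2⟩
        obtain ⟨y, rfl⟩ := σ.surjective y
        obtain ⟨z, rfl⟩ := σ.surjective z
        exact ⟨⟨y, (h _ _ _).2 h1⟩, ⟨z, (h _ _ _).2 h2⟩⟩
      · rintro ⟨⟨y, h1⟩, ⟨z, h2⟩⟩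
        exact ⟨σ y, σ z, (h ⟨x, k, hk⟩ _ _).1 h1, (h ⟨x, k, hk⟩ _ _).1 h2⟩
    rw [h1, List.mem_flatMap]
    constructor
    · intro hc
      exact ⟨k, by simp [hc], hk⟩
    · rintro ⟨j, hj, hxj⟩
      rw [section_unique hp hpq e k j x hk hxj]
      simpa using hj
  refine (Nat.card_congr ?_).symm
  refine ⟨fun x => ⟨σ ⟨x.1, ?_⟩, (hx _).2 x.2⟩, fun x => ⟨σ.symm x.1, ?_⟩, ?_, ?_⟩
  · obtain ⟨k, -, hk⟩ := List.mem_flatMap.1 x.2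
    exact ⟨k, hk⟩
  · rw [← hx, Equiv.apply_symm_apply]
    exact x.2
  · intro x; simp
  · intro x; simp

theorem MoveForm.pairCount_eq {e : List LiftType} {Φ : DirectionGraph}
    (h : MoveForm ((1, 0) : ℤ × ℤ) (0, 1) e Φ) :
    Φ.pairCount 3 = 4 * (counts e (1, 1)).1 ∧ Φ.pairCount 0 = 4 * (counts e (1, 1)).2 ∧
      Φ.pairCount 1 = 0 ∧ Φ.pairCount 2 = 0 := by
  have h := ((moveForm_iff (p := 1) (q := 2) (by norm_num) (by norm_num) _ _).2 h).pairCount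
    (by norm_num) (by norm_num)
  have h3 : ((List.finRange 8).filter fun k => sectionPairing k = 3) = [0, 2, 4, 6] := by decide
  have h0 : ((List.finRange 8).filter fun k => sectionPairing k = 0) = [1, 3, 5, 7] := by decide
  have h1 : ((List.finRange 8).filter fun k => sectionPairing k = 1) = [] := by decide
  have h2 : ((List.finRange 8).filter fun k => sectionPairing k = 2) = [] := by decide
  simp only [h, h3, h0, h1, h2, List.length_flatMap, List.map_cons, List.map_nil, length_cyc]
  simp
  omega

theorem MoveForm.hasCounts {e : List LiftType} {Φ : DirectionGraph}
    (h : MoveForm ((1, 0) : ℤ × ℤ) (0, 1) e Φ) :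
    Φ.HasCounts (4 * (counts e (1, 1)).1) (4 * (counts e (1, 1)).2) := by
  obtain ⟨h3, h0, h1, h2⟩ := h.pairCount_eq
  refine ⟨3, 0, by decide, h3, h0, fun x hx3 hx0 => ?_⟩
  fin_cases x
  · exact absurd rfl hx0
  · exact h1
  · exact h2
  · exact absurd rfl hx3

theorem eq_or_companion_of_equivalent {e e' : List LiftType} {Φ Ψ : DirectionGraph}
    (h : Φ.HasCounts (4 * (counts e (1, 1)).1) (4 * (counts e (1, 1)).2))
    (h' : Ψ.HasCounts (4 * (counts e' (1, 1)).1) (4 * (counts e' (1, 1)).2))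
    (hΦΨ : Φ.Equivalent Ψ) : e = e' ∨ e' = companion e := by
  have hpos := counts_pos e
  have := h.eq_or_swap h' (by omega) (by omega) hΦΨ
  exact eq_or_companion_of_counts (by omega)

/-- Coincidence keeps the labels, so the counts match class by class and the companion is excluded.
-/
theorem eq_of_coincide {e e' : List LiftType} {Φ Ψ : DirectionGraph}
    (h : MoveForm ((1, 0) : ℤ × ℤ) (0, 1) e Φ) (h' : MoveForm ((1, 0) : ℤ × ℤ) (0, 1) e' Ψ)
    (hΦΨ : Φ.Coincide Ψ) : e = e' := by
  obtain ⟨σ, hσ⟩ := hΦΨ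
  have key := pairCount_eq_of_perm (Equiv.refl _) (Equiv.refl _) (fun _ _ => rfl) σ hσ
  have h1 := h.pairCount_eq
  have h2 := h'.pairCount_eq
  have k3 := key 3
  have k0 := key 0
  simp only [Equiv.refl_apply] at k3 k0
  exact counts_injective (Prod.ext (by omega) (by omega))

/-! ## Walks -/

section Walks

variable {V K : Type*} [AddCommGroup V] (w : K → V)

/-- The displacement of a walk with the given steps. -/
def wsum (l : List K) : V := (l.map w).sum

/-- The points visited by a walk with the given steps, starting from `x`. -/
def walk (x : V) : List K → List V
  | [] => [x]
  | k :: l => x :: walk (x + w k) l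

@[simp] theorem wsum_nil : wsum w [] = 0 := rfl

@[simp] theorem wsum_cons (k : K) (l : List K) : wsum w (k :: l) = w k + wsum w l := by
  simp [wsum]

@[simp] theorem wsum_append (l l' : List K) : wsum w (l ++ l') = wsum w l + wsum w l' := by
  simp [wsum]

@[simp] theorem wsum_reverse (l : List K) : wsum w l.reverse = wsum w l := by
  simp [wsum, List.sum_reverse]

theorem walk_append {x y : V} {l : List K} {k : K} (h : x + wsum w l + w k = y) (l' : List K) :
    walk w x (l ++ k :: l') = walk w x l ++ walk w y l' := by
  induction l generalizing x with
  | nil =>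
    simp only [wsum_nil, add_zero] at h
    simp [walk, h]
  | cons j l ih =>
    simp only [List.cons_append, walk]
    rw [ih]
    rw [← h, wsum_cons]
    abel

theorem walk_map_add (x v : V) (l : List K) :
    (walk w x l).map (· + v) = walk w (x + v) l := by
  induction l generalizing x with
  | nil => rfl
  | cons k l ih =>
    simp only [walk, List.map_cons, ih]
    rw [add_right_comm]

theorem walk_reverse {ν : K → K} (hν : ∀ k, w (ν k) = -w k) (x : V) (l : List K) :
    (walk w x l).reverse = walk w (x + wsum w l) (l.reverse.map ν) := by
  induction l generalizing x with
  | nil => simp [walk]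
  | cons k l ih =>
    have hs : ∀ l : List K, wsum w (l.map ν) = -wsum w l := by
      intro l
      induction l with
      | nil => simp
      | cons j l ih => rw [List.map_cons, wsum_cons, wsum_cons, ih, hν]; abel
    rw [walk, List.reverse_cons, ih, List.reverse_cons, List.map_append, List.map_cons,
      List.map_nil, walk_append w (y := x), walk, wsum_cons, add_assoc]
    rw [hs, wsum_reverse, hν, wsum_cons]
    abel

theorem length_walk (x : V) (l : List K) : (walk w x l).length = l.length + 1 := by
  induction l generalizing x with
  | nil => rfl
  | cons k l ih => simp [walk, ih]

theorem getElem?_walk (x : V) (l : List K) {k : ℕ} (hk : k ≤ l.length) :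
    (walk w x l)[k]? = some (x + wsum w (l.take k)) := by
  induction l generalizing x k with
  | nil =>
    obtain rfl : k = 0 := by simpa using hk
    simp [walk]
  | cons j l ih =>
    cases k with
    | zero => simp [walk]
    | succ k =>
      rw [walk, List.getElem?_cons_succ, ih _ (by simpa using hk), List.take_succ_cons, wsum_cons,
        add_assoc]

end Walks

/-! ## The directions of the successive moves of a cycle -/

/-- The label of the move from one path to the next after a lift. -/
def liftJunction (t : LiftType) (J : Fin 8 → Fin 8) (i : Fin 8) : Fin 8 :=
  match t with
  | .f => J i
  | .g => J i
  | .h => if i.val % 2 = 0 then J (i - 1) else J (i + 1)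
  | .hbar => if i.val % 2 = 0 then J (i + 1) else J (i - 1)

/-- The labels along three successive paths. -/
def tri {K : Type*} (L : Fin 8 → List K) (J : Fin 8 → K) (i : Fin 8) : List K :=
  L (i - 1) ++ J (i - 1) :: (L i ++ J i :: L (i + 1))

/-- The labels along five successive paths. -/
def quint {K : Type*} (L : Fin 8 → List K) (J : Fin 8 → K) (i : Fin 8) : List K :=
  L (i - 2) ++ J (i - 2) :: (tri L J i ++ J (i + 1) :: L (i + 2))

/-- The labels along a path after a lift. -/
def liftWord {K : Type*} (t : LiftType) (L : Fin 8 → List K) (J : Fin 8 → K) (i : Fin 8) :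
    List K :=
  match t with
  | .f => if i.val % 2 = 0 then (tri L J i).reverse else L i
  | .g => if i.val % 2 = 0 then L i else (tri L J i).reverse
  | .h => if i.val % 2 = 0 then (quint L J i).reverse else tri L J i
  | .hbar => if i.val % 2 = 0 then tri L J i else (quint L J i).reverse

/-- The labels of the moves between successive paths. -/
def junction : List LiftType → Fin 8 → Fin 8
  | [] => id
  | t :: e => liftJunction t (junction e)

/-- The labels of the moves along the paths. -/
def pathWord : List LiftType → Fin 8 → List (Fin 8)
  | [] => fun _ => []
  | t :: e => liftWord t (pathWord e) (junction e)

theorem junction_add (c : Fin 8) (hc : c.val % 2 = 0) (e : List LiftType) (i : Fin 8) :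
    junction e (i + c) = junction e i + c := by
  have h2 : ∀ i c : Fin 8, c.val % 2 = 0 → (i + c).val % 2 = i.val % 2 := by decide
  induction e generalizing i with
  | nil => rfl
  | cons t e ih =>
    have h1 : i + c - 1 = i - 1 + c := by abel
    have h3 : i + c + 1 = i + 1 + c := by abel
    cases t <;> simp only [junction, liftJunction, h2 i c hc, h1, h3, ih] <;> split_ifs <;> rfl

theorem pathWord_add (c : Fin 8) (hc : c.val % 2 = 0) (e : List LiftType) (i : Fin 8) :
    pathWord e (i + c) = (pathWord e i).map (· + c) := by
  have h2 : ∀ i c : Fin 8, c.val % 2 = 0 → (i + c).val % 2 = i.val % 2 := by decide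
  induction e generalizing i with
  | nil => rfl
  | cons t e ih =>
    have h1 : ∀ j, i + c - j = i - j + c := fun j => by abel
    have h3 : ∀ j, i + c + j = i + j + c := fun j => by abel
    cases t <;> simp only [pathWord, liftWord, tri, quint, h2 i c hc, h1, h3, ih,
      junction_add c hc] <;> split_ifs <;> simp [List.map_reverse]

section Generic

variable {A : Type*} [AddCommGroup A]

/-- The moves of the initial cycle. -/
def baseMove (p q : A) (k : Fin 8) : A × A := moveVec (q - p - p) p (k + 2)

theorem baseMove_add_four (p q : A) (k : Fin 8) : baseMove p q (k + 4) = -baseMove p q k := by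
  rw [baseMove, add_right_comm, moveVec_add_four]
  rfl

/-- The coordinates of the last square of the path `E`. -/
def corner (p q : A) : List LiftType → A × A
  | [] => (q - p, 0)
  | t :: e =>
    let X := (corner p q e).1
    let Y := (corner p q e).2
    let P := (params p q e).1
    let Q := (params p q e).2
    match t with
    | .f => (X + P, Y + P)
    | .g => (X + Q - P, Y)
    | .h => (Y + P + Q, X)
    | .hbar => (P + Q + Q - X, Y + P)

/-- The first squares of the paths. -/
def entry (P Q : A) (c : A × A) : Fin 8 → A × A :=
  ![(c.1, -c.2), (c.2 + P, Q - c.1), (c.2, c.1), (c.1 - Q, c.2 + P), (-c.1, c.2),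
    (-c.2 - P, c.1 - Q), (-c.2, -c.1), (Q - c.1, -c.2 - P)]

/-- The last squares of the paths. -/
def exit (P Q : A) (c : A × A) : Fin 8 → A × A :=
  ![(c.1, c.2), (Q - c.1, c.2 + P), (-c.2, c.1), (-c.2 - P, Q - c.1), (-c.1, -c.2),
    (c.1 - Q, -c.2 - P), (c.2, -c.1), (c.2 + P, c.1 - Q)]

/-- The paths are walks with the given labels. -/
structure IsWalkCycle (w : Fin 8 → A × A) (a : Fin 8 → List (A × A)) (L : Fin 8 → List (Fin 8))
    (J : Fin 8 → Fin 8) (P Q : A) (c : A × A) : Prop where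
  eq_walk : ∀ i, a i = walk w (entry P Q c i) (L i)
  wsum_eq : ∀ i, wsum w (L i) = exit P Q c i - entry P Q c i
  junction_eq : ∀ i, w (J i) = entry P Q c (i + 1) - exit P Q c i

namespace IsWalkCycle

variable {w : Fin 8 → A × A} {a : Fin 8 → List (A × A)} {L : Fin 8 → List (Fin 8)}
    {J : Fin 8 → Fin 8} {P Q : A} {c : A × A}

theorem tri_eq_walk (h : IsWalkCycle w a L J P Q c) (i : Fin 8) :
    a (i - 1) ++ a i ++ a (i + 1) = walk w (entry P Q c (i - 1)) (tri L J i) := by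
  rw [tri, walk_append w (y := entry P Q c i), walk_append w (y := entry P Q c (i + 1)),
    h.eq_walk, h.eq_walk, h.eq_walk, List.append_assoc]
  · rw [h.wsum_eq, h.junction_eq]; abel
  · rw [h.wsum_eq, h.junction_eq, sub_add_cancel]; abel

theorem wsum_tri (h : IsWalkCycle w a L J P Q c) (i : Fin 8) :
    wsum w (tri L J i) = exit P Q c (i + 1) - entry P Q c (i - 1) := by
  simp only [tri, wsum_append, wsum_cons, h.wsum_eq, h.junction_eq, sub_add_cancel]
  abel

theorem quint_eq_walk (h : IsWalkCycle w a L J P Q c) (i : Fin 8) :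
    a (i - 2) ++ (a (i - 1) ++ a i ++ a (i + 1)) ++ a (i + 2) =
      walk w (entry P Q c (i - 2)) (quint L J i) := by
  have h1 : i + 1 + 1 = i + 2 := by revert i; decide
  have h2 : i - 2 + 1 = i - 1 := by revert i; decide
  rw [quint, walk_append w (y := entry P Q c (i - 1)), walk_append w (y := entry P Q c (i + 2)),
    h.tri_eq_walk, h.eq_walk, h.eq_walk (i + 2), List.append_assoc]
  · rw [h.wsum_tri, h.junction_eq, h1]; abel
  · rw [h.wsum_eq, h.junction_eq, h2]; abel

theorem wsum_quint (h : IsWalkCycle w a L J P Q c) (i : Fin 8) :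
    wsum w (quint L J i) = exit P Q c (i + 2) - entry P Q c (i - 2) := by
  have h1 : i + 1 + 1 = i + 2 := by revert i; decide
  have h2 : i - 2 + 1 = i - 1 := by revert i; decide
  simp only [quint, wsum_append, wsum_cons, h.wsum_eq, h.junction_eq, h.wsum_tri, h1, h2]
  abel

/-- Passing to the opposite paths adds 4 to each label, and so does reversing the direction of
travel. The two cancel, and only the order of the labels is reversed. -/
theorem reverse_tri_eq_walk (h : IsWalkCycle w a L J P Q c) (hw : ∀ k, w (k + 4) = -w k)
    (hL : ∀ i, L (i + 4) = (L i).map (· + 4)) (hJ : ∀ i, J (i + 4) = J i + 4) (i : Fin 8) :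
    (a (i + 5)).reverse ++ (a (i + 4)).reverse ++ (a (i + 3)).reverse =
      walk w (exit P Q c (i + 5)) (tri L J i).reverse := by
  have h1 : i + 4 - 1 = i + 3 := by revert i; decide
  have h2 : i + 4 + 1 = i + 5 := by revert i; decide
  have h3 : i + 3 = i - 1 + 4 := by revert i; decide
  have h5 : i + 5 = i + 1 + 4 := by revert i; decide
  have h44 : ∀ k : Fin 8, k + 4 + 4 = k := by decide
  have hr := congrArg List.reverse (h.tri_eq_walk (i + 4))
  rw [walk_reverse w hw, h.wsum_tri, h1, h2, add_sub_cancel] at hr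
  simp only [List.reverse_append, List.append_assoc] at hr ⊢
  rw [hr]
  congr 1
  rw [tri, h1, h2, h3, h5, hL, hL, hL, hJ, hJ, tri]
  simp [List.map_reverse, h44, Function.comp_def]

theorem reverse_quint_eq_walk (h : IsWalkCycle w a L J P Q c) (hw : ∀ k, w (k + 4) = -w k)
    (hL : ∀ i, L (i + 4) = (L i).map (· + 4)) (hJ : ∀ i, J (i + 4) = J i + 4) (i : Fin 8) :
    (a (i + 6)).reverse ++ (a (i + 5)).reverse ++ (a (i + 4)).reverse ++ (a (i + 3)).reverse ++
      (a (i + 2)).reverse = walk w (exit P Q c (i + 6)) (quint L J i).reverse := by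
  have h1 : i + 4 - 1 = i + 3 := by revert i; decide
  have h2 : i + 4 + 1 = i + 5 := by revert i; decide
  have h1' : i + 4 - 2 = i + 2 := by revert i; decide
  have h2' : i + 4 + 2 = i + 6 := by revert i; decide
  have h3 : i + 3 = i - 1 + 4 := by revert i; decide
  have h5 : i + 5 = i + 1 + 4 := by revert i; decide
  have h6 : i + 6 = i + 2 + 4 := by revert i; decide
  have h7 : i + 2 = i - 2 + 4 := by revert i; decide
  have h44 : ∀ k : Fin 8, k + 4 + 4 = k := by decide
  have hr := congrArg List.reverse (h.quint_eq_walk (i + 4))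
  rw [walk_reverse w hw, h.wsum_quint, h1, h2, h1', h2', add_sub_cancel] at hr
  simp only [List.reverse_append, List.append_assoc] at hr ⊢
  rw [hr]
  congr 1
  rw [quint, tri, h1, h2, h1', h2', h3, h5, h6, hL, hL, hL, hL (i + 2), hJ, hJ, hJ, quint, tri, h7,
    hL, hJ]
  simp [List.map_reverse, h44, Function.comp_def]

end IsWalkCycle

/-- By symmetry one corner determines all endpoints of paths; for example, the path NW begins at the
end of E plus the (P, Q)-move of direction 3. With the endpoints explicit, each lift requires only
linear identities. -/
theorem isWalkCycle (p q : A) (e : List LiftType) :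
    IsWalkCycle (baseMove p q) (cyc p q e) (pathWord e) (junction e) (params p q e).1
      (params p q e).2 (corner p q e) := by
  induction e with
  | nil =>
    constructor <;> intro i <;> fin_cases i <;>
      simp [cyc, pathWord, junction, walk, corner, entry, exit, params, compassVec, compass,
        baseMove, moveVec] <;> abel
  | cons t e ih =>
    have hw := baseMove_add_four p q
    have hL := pathWord_add 4 (by decide) e
    have hJ := junction_add 4 (by decide) e
    have htri := ih.tri_eq_walk
    have hrtri := ih.reverse_tri_eq_walk hw hL hJ
    have hrquint := ih.reverse_quint_eq_walk hw hL hJ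
    obtain ⟨⟨P, Q⟩, hP⟩ : ∃ P, params p q e = P := ⟨_, rfl⟩
    obtain ⟨⟨X, Y⟩, hc⟩ : ∃ c, corner p q e = c := ⟨_, rfl⟩
    rw [hP, hc] at htri hrtri hrquint ih
    constructor <;> intro i
    · rw [cyc]
      have hS : ∀ x y v l, x + v = y → (walk (baseMove p q) x l).map (· + v) =
          walk (baseMove p q) y l := by
        rintro x y v l rfl
        exact walk_map_add _ _ _ _
      by_cases h : i.val % 2 = 0 <;> cases t <;>
        simp only [liftPieces, pathWord, liftWord, h, if_true, if_false] <;>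
        (first | rw [hrquint] | rw [hrtri] | rw [htri] | rw [ih.eq_walk]) <;>
        apply hS <;> clear hS htri hrtri hrquint hL hJ hw ih <;> revert h <;> fin_cases i <;>
        simp [entry, exit, compassVec, compass, liftCoeff, corner, params, nextParams, hP, hc] <;>
        (try constructor) <;> abel
    · by_cases h : i.val % 2 = 0 <;> cases t <;>
        simp only [pathWord, liftWord, h, if_true, if_false, wsum_reverse, ih.wsum_eq, ih.wsum_tri,
          ih.wsum_quint] <;>
        clear htri hrtri hrquint hL hJ hw ih <;> revert h <;> fin_cases i <;>
        simp [entry, exit, corner, params, nextParams, hP, hc] <;> (try constructor) <;> abel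
    · by_cases h : i.val % 2 = 0 <;> cases t <;>
        simp only [junction, liftJunction, h, if_true, if_false, ih.junction_eq] <;>
        clear htri hrtri hrquint hL hJ hw ih <;> revert h <;> fin_cases i <;>
        simp [entry, exit, corner, params, nextParams, hP, hc] <;> (try constructor) <;> abel

end Generic

/-! ## The cyclic word of labels -/

/-- The labels along a cycle. -/
def cycleWord (e : List LiftType) : List (Fin 8) :=
  (List.finRange 8).flatMap fun i => pathWord e i ++ [junction e i]

/-- The letters of a word continued periodically. -/
def letter {X : Type*} [Inhabited X] (l : List X) (a : ℕ) : X := l.getD (a % l.length) default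

theorem letter_congr {X : Type*} [Inhabited X] (l : List X) {a b : ℕ} (h : a ≡ b [MOD l.length]) :
    letter l a = letter l b := by
  rw [letter, letter, show a % l.length = b % l.length from h]

theorem letter_eq_getElem {X : Type*} [Inhabited X] {l : List X} {a : ℕ} (h : a < l.length) :
    letter l a = l[a] := by
  rw [letter, Nat.mod_eq_of_lt h, List.getD_eq_getElem _ _ h]

theorem getElem?_mod {X : Type*} [Inhabited X] {l : List X} (h : 0 < l.length) (a : ℕ) :
    l[a % l.length]? = some (letter l a) := by
  rw [letter, List.getD_eq_getElem _ _ (Nat.mod_lt _ h), List.getElem?_eq_getElem]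

theorem letter_rotate {X : Type*} [Inhabited X] (l : List X) (m a : ℕ) :
    letter (l.rotate m) a = letter l (a + m) := by
  rcases Nat.eq_zero_or_pos l.length with h | h
  · obtain rfl := List.length_eq_zero_iff.1 h
    simp [letter]
  · have h1 := getElem?_mod (l := l.rotate m) (by simpa using h) a
    rw [List.length_rotate, List.getElem?_rotate (Nat.mod_lt _ h), Nat.mod_add_mod,
      getElem?_mod h] at h1
    exact (Option.some.inj h1).symm

theorem letter_map {X Y : Type*} [Inhabited X] [Inhabited Y] (f : X → Y) {l : List X}
    (h : 0 < l.length) (a : ℕ) : letter (l.map f) a = f (letter l a) := by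
  have h1 := getElem?_mod (l := l.map f) (by simpa using h) a
  rw [List.length_map, List.getElem?_map, getElem?_mod h] at h1
  exact (Option.some.inj h1).symm

theorem letter_succ_of_closed {V K : Type*} [AddCommGroup V] [Inhabited V] [Inhabited K]
    {w : K → V} {X : List V} {l : List K} {x₀ : V} (h : X ++ [x₀] = walk w x₀ l)
    (hl : 0 < l.length) (a : ℕ) : letter X (a + 1) = letter X a + w (letter l a) := by
  have hlen : X.length = l.length := by
    have := congrArg List.length h
    rw [length_walk, List.length_append, List.length_singleton] at this
    omega
  have hX : ∀ k ≤ l.length, letter X k = x₀ + wsum w (l.take k) := by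
    intro k hk
    have hk' : (walk w x₀ l)[k]? = some (letter X k) := by
      rw [← h]
      rcases hk.lt_or_eq with hlt | rfl
      · rw [List.getElem?_append_left (hlen ▸ hlt), letter_eq_getElem (hlen ▸ hlt),
          List.getElem?_eq_getElem]
      · rw [← hlen, List.getElem?_concat_length, letter_congr X (b := 0) (by simp [Nat.ModEq]),
          letter_eq_getElem (hlen ▸ hl)]
        have h0 := getElem?_walk w x₀ l (Nat.zero_le _)
        rw [← h, List.getElem?_append_left (hlen ▸ hl), List.getElem?_eq_getElem (hlen ▸ hl)] at h0
        simpa using h0.symm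
    rw [getElem?_walk _ _ _ hk] at hk'
    exact (Option.some.inj hk').symm
  have hm := Nat.mod_lt a hl
  have e1 : letter X (a + 1) = letter X (a % l.length + 1) :=
    letter_congr X (by rw [hlen]; exact ((Nat.mod_modEq a l.length).add_right 1).symm)
  have e2 : letter X a = letter X (a % l.length) :=
    letter_congr X (by rw [hlen]; exact (Nat.mod_modEq a l.length).symm)
  have e3 : letter l a = l[a % l.length] := by
    rw [← letter_eq_getElem hm]
    exact letter_congr l (Nat.mod_modEq a l.length).symm
  rw [e1, e2, e3, hX _ hm, hX _ hm.le, List.take_succ_eq_append_getElem hm, wsum_append, wsum_cons,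
    wsum_nil, add_zero, add_assoc]

/-- The last junction leads from section SE back to the first square of E, so the labels describe a
closed walk. -/
theorem closed_cyc {A : Type*} [AddCommGroup A] (p q : A) (e : List LiftType) :
    ∃ x₀, (List.finRange 8).flatMap (cyc p q e) ++ [x₀] =
      walk (baseMove p q) x₀ (cycleWord e) := by
  have h := isWalkCycle p q e
  refine ⟨entry (params p q e).1 (params p q e).2 (corner p q e) 0, ?_⟩
  have hstep : ∀ i l, walk (baseMove p q) (entry (params p q e).1 (params p q e).2 (corner p q e) i)
      (pathWord e i ++ junction e i :: l) = cyc p q e i ++ walk (baseMove p q)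
        (entry (params p q e).1 (params p q e).2 (corner p q e) (i + 1)) l := by
    intro i l
    rw [walk_append (y := entry (params p q e).1 (params p q e).2 (corner p q e) (i + 1)), h.eq_walk]
    rw [h.wsum_eq, h.junction_eq]
    abel
  have h8 : List.finRange 8 = [0, 1, 2, 3, 4, 5, 6, 7] := by decide
  simp only [cycleWord, h8, List.flatMap_cons, List.flatMap_nil, List.append_assoc,
    List.cons_append, List.nil_append, hstep, Fin.reduceAdd]
  rfl

theorem cycleWord_ne_nil (e : List LiftType) : 0 < (cycleWord e).length := by
  have h8 : List.finRange 8 = 0 :: [1, 2, 3, 4, 5, 6, 7] := by decide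
  rw [cycleWord, h8]
  simp

theorem junction_companion (e : List LiftType) (i : Fin 8) :
    junction (companion e) (i + 1) = junction e i + 1 := by
  induction e generalizing i with
  | nil => rfl
  | cons t e ih =>
    have h2 : (i + 1).val % 2 = 0 ↔ ¬ i.val % 2 = 0 := by revert i; decide
    have h1 : i + 1 - 1 = i - 1 + 1 := by abel
    have : companion (t :: e) = t.companion :: companion e := rfl
    rw [this]
    by_cases h0 : i.val % 2 = 0 <;> cases t <;>
      simp only [LiftType.companion, junction, liftJunction, h2, h0, h1, ih, not_true,
        not_false_iff, if_true, if_false]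

theorem pathWord_companion (e : List LiftType) (i : Fin 8) :
    pathWord (companion e) (i + 1) = (pathWord e i).map (· + 1) := by
  induction e generalizing i with
  | nil => rfl
  | cons t e ih =>
    have h2 : (i + 1).val % 2 = 0 ↔ ¬ i.val % 2 = 0 := by revert i; decide
    have h1 : ∀ j, i + 1 - j = i - j + 1 := fun j => by abel
    have h3 : ∀ j, i + 1 + j = i + j + 1 := fun j => by abel
    have : companion (t :: e) = t.companion :: companion e := rfl
    rw [this]
    by_cases h0 : i.val % 2 = 0 <;> cases t <;>
      simp only [LiftType.companion, pathWord, liftWord, tri, quint, h2, h0, h1, h3, ih,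
        junction_companion, not_true, not_false_iff, if_true, if_false] <;>
      simp [List.map_reverse]

theorem cycleWord_companion (e : List LiftType) :
    ∃ m, (cycleWord (companion e)).rotate m = (cycleWord e).map (· + 1) := by
  have h8 : List.finRange 8 = [0, 1, 2, 3, 4, 5, 6, 7] := by decide
  have hL := pathWord_companion e
  have hJ := junction_companion e
  have key : ∀ i, (pathWord e i ++ [junction e i]).map (· + 1) =
      pathWord (companion e) (i + 1) ++ [junction (companion e) (i + 1)] := by
    intro i
    rw [hL, hJ]; simp
  -- The companion's sections are shifted by one, so its word is rotated past the block of its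
  -- section E.
  refine ⟨(pathWord (companion e) 0 ++ [junction (companion e) 0]).length, ?_⟩
  rw [cycleWord, h8, List.flatMap_cons, List.rotate_append_length_eq, cycleWord, List.map_flatMap,
    h8]
  simp only [key, List.flatMap_cons, List.flatMap_nil, List.append_nil, List.append_assoc,
    Fin.reduceAdd]

/-! ## Turns -/

/-- The indicator of the pairings of the two directions at a vertex between arcs labeled `a`
and `b`. -/
def turn (a b : Fin 8) (c : Fin 4) : ℕ := if a + 4 = partner c b then 1 else 0

/-- The numbers of turns in a word of labels. -/
def turns : List (Fin 8) → Fin 4 → ℕ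
  | [] => 0
  | [_] => 0
  | a :: b :: l => turn a b + turns (b :: l)

theorem turn_comm (a b : Fin 8) : turn a b = turn b a := by
  have h : ∀ a b c, turn a b c = turn b a c := by decide
  exact funext (h a b)

theorem turns_append_cons (l : List (Fin 8)) (x : Fin 8) (l' : List (Fin 8)) :
    turns (l ++ x :: l') = turns (l ++ [x]) + turns (x :: l') := by
  match l with
  | [] => simp [turns]
  | [a] => simp [turns]
  | a :: b :: l =>
    have := turns_append_cons (b :: l) x l'
    simp only [List.cons_append] at this
    simp only [List.cons_append, turns, this, add_assoc]

theorem turns_reverse (l : List (Fin 8)) : turns l.reverse = turns l := by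
  match l with
  | [] => rfl
  | [a] => rfl
  | a :: b :: l =>
    have := turns_reverse (b :: l)
    rw [List.reverse_cons] at this
    rw [List.reverse_cons, List.reverse_cons, List.append_assoc, List.singleton_append,
      turns_append_cons, this, turns, turns, turns, turn_comm a b, add_zero, add_comm]

/-- The two added turns are of the forms (j, j + 1) and (j + 1, j + 2). Their classes depend only on
the parity of j, so together they contribute the same for every k. -/
theorem turns_append_pair {l v : List (Fin 8)} {k : Fin 8} (h : l = v ++ [k - 1]) :
    turns (l ++ [k, k + 1]) = turns l + turns [0, 1, 2] := by
  have hk : ∀ k c, turns [k - 1, k, k + 1] c = turns [0, 1, 2] c := by decide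
  rw [h, List.append_assoc, List.singleton_append, turns_append_cons, funext (hk k)]

/-- Properties of words of labels that are preserved by lifts. -/
structure Smooth (L : Fin 8 → List (Fin 8)) (J : Fin 8 → Fin 8) : Prop where
  head : ∀ i, ∃ u, L i ++ [J i] = (J (i - 1) + 1) :: u
  last : ∀ i, ∃ v, J (i - 1) :: L i = v ++ [J i - 1]

/-- The turns from a path to the next one. -/
def pathTurns (L : Fin 8 → List (Fin 8)) (J : Fin 8 → Fin 8) (i : Fin 8) : Fin 4 → ℕ :=
  turns (L i ++ [J i, J i + 1])

namespace Smooth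

variable {L : Fin 8 → List (Fin 8)} {J : Fin 8 → Fin 8}

theorem head_append (h : Smooth L J) (i : Fin 8) (l : List (Fin 8)) :
    ∃ u, L i ++ J i :: l = (J (i - 1) + 1) :: u := by
  obtain ⟨u, hu⟩ := h.head i
  exact ⟨u ++ l, by rw [← List.cons_append, ← hu]; simp⟩

theorem append_last (h : Smooth L J) (i : Fin 8) (l : List (Fin 8)) :
    ∃ v, l ++ J (i - 1) :: L i = v ++ [J i - 1] := by
  obtain ⟨v, hv⟩ := h.last i
  exact ⟨l ++ v, by rw [hv]; simp⟩

theorem turns_append (i : Fin 8) {j : Fin 8} {l u : List (Fin 8)}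
    (hl : l = (j + 1) :: u) (hj : J i = j) :
    turns (L i ++ J i :: l) = pathTurns L J i + turns l := by
  rw [pathTurns, hj, hl, List.append_cons, turns_append_cons]
  simp

theorem tri_head (h : Smooth L J) (i : Fin 8) : ∃ u, tri L J i = (J (i - 2) + 1) :: u := by
  obtain ⟨u, hu⟩ := h.head_append (i - 1) (L i ++ J i :: L (i + 1))
  rw [sub_sub] at hu
  exact ⟨u, hu⟩

theorem tri_last (h : Smooth L J) (i : Fin 8) : ∃ v, tri L J i = v ++ [J (i + 1) - 1] := by
  obtain ⟨v, hv⟩ := h.append_last (i + 1) (L (i - 1) ++ J (i - 1) :: L i)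
  rw [add_sub_cancel_right] at hv
  exact ⟨v, by rw [← hv]; simp [tri]⟩

theorem quint_head (h : Smooth L J) (i : Fin 8) : ∃ u, quint L J i = (J (i - 3) + 1) :: u := by
  obtain ⟨u, hu⟩ := h.head_append (i - 2) (tri L J i ++ J (i + 1) :: L (i + 2))
  rw [sub_sub] at hu
  exact ⟨u, hu⟩

theorem quint_last (h : Smooth L J) (i : Fin 8) : ∃ v, quint L J i = v ++ [J (i + 2) - 1] := by
  obtain ⟨v, hv⟩ := h.append_last (i + 2) (L (i - 2) ++ J (i - 2) :: tri L J i)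
  have h1 : ∀ i : Fin 8, i + 2 - 1 = i + 1 := by decide
  rw [h1] at hv
  exact ⟨v, by rw [← hv]; simp [quint]⟩

/-- Each `pathTurns` extends past its junction by the letter that really follows, so consecutive
ones add up exactly. Only the two turns beyond the last path are surplus; they account for the
constant. -/
theorem turns_tri (h : Smooth L J) (i : Fin 8) :
    turns (tri L J i) + turns [0, 1, 2] =
      pathTurns L J (i - 1) + pathTurns L J i + pathTurns L J (i + 1) := by
  obtain ⟨v, hv⟩ := h.tri_last i
  obtain ⟨u, hu⟩ := h.head_append (i + 1) [J (i + 1) + 1]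
  rw [add_sub_cancel_right] at hu
  obtain ⟨u', hu'⟩ := h.head_append i (L (i + 1) ++ [J (i + 1), J (i + 1) + 1])
  rw [← turns_append_pair hv, tri]
  simp only [List.append_assoc, List.cons_append]
  rw [turns_append (i - 1) hu' rfl, turns_append i hu rfl, ← add_assoc]
  rfl

theorem turns_quint (h : Smooth L J) (i : Fin 8) :
    turns (quint L J i) + turns [0, 1, 2] =
      pathTurns L J (i - 2) + (pathTurns L J (i - 1) + pathTurns L J i + pathTurns L J (i + 1)) +
        pathTurns L J (i + 2) := by
  have h1 : i - 2 = i - 1 - 1 := by revert i; decide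
  have h2 : i + 2 - 1 = i + 1 := by revert i; decide
  obtain ⟨v, hv⟩ := h.quint_last i
  obtain ⟨v', hv'⟩ := h.tri_last i
  obtain ⟨u, hu⟩ := h.head_append (i + 2) [J (i + 2) + 1]
  rw [h2] at hu
  obtain ⟨u', hu'⟩ := h.tri_head i
  rw [← turns_append_pair hv, quint]
  simp only [List.append_assoc, List.cons_append]
  rw [turns_append (i - 2) (by rw [hu']; rfl) rfl, ← h.turns_tri, ← turns_append_pair hv',
    add_assoc]
  congr 1
  have : tri L J i ++ J (i + 1) :: (L (i + 2) ++ [J (i + 2), J (i + 2) + 1]) =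
      (tri L J i ++ [J (i + 1)]) ++ (J (i + 1) + 1) :: u := by
    rw [hu]; simp
  rw [this, turns_append_cons, ← hu]
  simp [pathTurns]

end Smooth

/-- Around every junction the labels increase by 1. Reversing three or five paths preserves this
because junctions two sections apart differ by 2. -/
theorem smooth (e : List LiftType) : Smooth (pathWord e) (junction e) := by
  induction e with
  | nil =>
    constructor <;> intro i
    · exact ⟨[], by simp [pathWord, junction]⟩
    · exact ⟨[], by simp [pathWord, junction]⟩
  | cons t e ih =>
    have hJ := junction_add 2 (by decide) e
    have hd : ∀ i : Fin 8, (i - 1).val % 2 = 0 ↔ ¬ i.val % 2 = 0 := by decide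
    have i1 : ∀ i : Fin 8, i - 1 - 1 = i - 2 := by decide
    have hJ1 : ∀ i, junction e (i + 1) = junction e (i - 1) + 2 := fun i => by
      rw [← hJ]; congr 1; revert i; decide
    have hJ2 : ∀ i, junction e i = junction e (i - 2) + 2 := fun i => by
      rw [← hJ]; congr 1; revert i; decide
    have hJ3 : ∀ i, junction e (i - 1) = junction e (i - 3) + 2 := fun i => by
      rw [← hJ]; congr 1; revert i; decide
    have a1 : ∀ a : Fin 8, a + 2 - 1 = a + 1 := by decide
    have head_rev : ∀ {l v : List (Fin 8)} {a b : Fin 8}, l = v ++ [a - 1] → ∀ k, a = b + 2 →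
        ∃ u, l.reverse ++ [k] = (b + 1) :: u := by
      rintro l v a b rfl k rfl
      exact ⟨v.reverse ++ [k], by simp [a1]⟩
    have last_rev : ∀ {l u : List (Fin 8)} {a b : Fin 8}, l = (a + 1) :: u → ∀ k, b = a + 2 →
        ∃ v, k :: l.reverse = v ++ [b - 1] := by
      rintro l u a b rfl k rfl
      exact ⟨k :: u.reverse, by simp [a1]⟩
    have head_app : ∀ {l u : List (Fin 8)} {a : Fin 8}, l = a :: u → ∀ k,
        ∃ u, l ++ [k] = a :: u := by
      rintro l u a rfl k
      exact ⟨u ++ [k], rfl⟩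
    have last_app : ∀ {l v : List (Fin 8)} {b : Fin 8}, l = v ++ [b] → ∀ k,
        ∃ v, k :: l = v ++ [b] := by
      rintro l v b rfl k
      exact ⟨k :: v, rfl⟩
    constructor <;> intro i <;> obtain ⟨u, hu⟩ := ih.tri_head i <;>
      obtain ⟨v, hv⟩ := ih.tri_last i <;> obtain ⟨u', hu'⟩ := ih.quint_head i <;>
      obtain ⟨v', hv'⟩ := ih.quint_last i <;>
      by_cases h : i.val % 2 = 0 <;> cases t <;>
      simp only [pathWord, liftWord, junction, liftJunction, hd, h, not_true, not_false_iff,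
        if_true, if_false, i1, sub_add_cancel]
    · exact head_rev hv _ (hJ1 i)
    · exact ih.head i
    · exact head_rev hv' _ (hJ i)
    · exact head_app hu _
    · exact ih.head i
    · exact head_rev hv _ (hJ1 i)
    · exact head_app hu _
    · exact head_rev hv' _ (hJ i)
    · exact last_rev hu _ (hJ2 i)
    · exact ih.last i
    · exact last_rev hu' _ (hJ3 i)
    · exact last_app hv _
    · exact ih.last i
    · exact last_rev hu _ (hJ2 i)
    · exact last_app hv _
    · exact last_rev hu' _ (hJ3 i)

/-- Turns are invariant under reversal, and the constant of `turns_tri` and `turns_quint` is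
restored when the new word is extended past its new junction. Path turns therefore satisfy the same
recursion as path lengths, started from the turns of the initial octagon. -/
theorem pathTurns_eq (e : List LiftType) (i : Fin 8) (c : Fin 4) :
    pathTurns (pathWord e) (junction e) i c = if i.val % 2 = 0
      then (counts e (turn 0 1 c, turn 1 2 c)).1 else (counts e (turn 0 1 c, turn 1 2 c)).2 := by
  induction e generalizing i with
  | nil => revert i c; decide
  | cons t e ih =>
    have hs := smooth e
    have hJ := junction_add 2 (by decide) e
    have h1 : ∀ i : Fin 8, (i + 1).val % 2 = 0 ↔ ¬ i.val % 2 = 0 := by decide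
    have h2 : ∀ i : Fin 8, (i - 1).val % 2 = 0 ↔ ¬ i.val % 2 = 0 := by decide
    have h3 : ∀ i : Fin 8, (i + 2).val % 2 = 0 ↔ i.val % 2 = 0 := by decide
    have h4 : ∀ i : Fin 8, (i - 2).val % 2 = 0 ↔ i.val % 2 = 0 := by decide
    have hJ2 : ∀ i, junction e (i - 2) + 1 = junction e i - 1 := fun i => by
      have : ∀ a b : Fin 8, a = b + 2 → b + 1 = a - 1 := by decide
      apply this
      rw [← hJ]; congr 1; revert i; decide
    have hJ3 : ∀ i, junction e (i - 3) + 1 = junction e (i - 1) - 1 := fun i => by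
      have := hJ2 (i - 1)
      rwa [sub_sub] at this
    have hrev : ∀ {l u : List (Fin 8)} {k : Fin 8}, l = (k - 1) :: u →
        turns (l.reverse ++ [k, k + 1]) = turns l + turns [0, 1, 2] := by
      intro l u k h
      rw [turns_append_pair (l := l.reverse) (v := u.reverse) (by rw [h]; simp), turns_reverse]
    have htri := congrFun (hs.turns_tri i) c
    have hquint := congrFun (hs.turns_quint i) c
    simp only [Pi.add_apply, ih, h1, h2, h3, h4] at htri hquint
    obtain ⟨u, hu⟩ := hs.tri_head i
    obtain ⟨v, hv⟩ := hs.tri_last i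
    obtain ⟨u', hu'⟩ := hs.quint_head i
    obtain ⟨v', hv'⟩ := hs.quint_last i
    rw [hJ2] at hu
    rw [hJ3] at hu'
    have ih := ih i
    rw [pathTurns] at ih ⊢
    simp only [counts, List.foldr_cons] at ih htri hquint ⊢
    by_cases h : i.val % 2 = 0 <;> cases t <;>
      simp only [pathWord, liftWord, junction, liftJunction, h, not_true, not_false_iff,
        if_true, if_false, countStep, hrev hu, hrev hu', turns_append_pair hv, Pi.add_apply]
        at ih htri hquint ⊢ <;> omega

theorem turns_cycleWord (e : List LiftType) (c : Fin 4) :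
    turns (cycleWord e ++ [letter (cycleWord e) 0]) c =
      4 * ((counts e (turn 0 1 c, turn 1 2 c)).1 + (counts e (turn 0 1 c, turn 1 2 c)).2) := by
  have hs := smooth e
  have h8 : List.finRange 8 = [0, 1, 2, 3, 4, 5, 6, 7] := by decide
  have hw : cycleWord e = pathWord e 0 ++ junction e 0 :: (pathWord e 1 ++ junction e 1 ::
      (pathWord e 2 ++ junction e 2 :: (pathWord e 3 ++ junction e 3 ::
      (pathWord e 4 ++ junction e 4 :: (pathWord e 5 ++ junction e 5 ::
      (pathWord e 6 ++ junction e 6 :: (pathWord e 7 ++ [junction e 7]))))))) := by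
    simp [cycleWord, h8]
  have h0 : letter (cycleWord e) 0 = junction e 7 + 1 := by
    obtain ⟨u, hu⟩ := hs.head_append 0 (pathWord e 1 ++ junction e 1 ::
      (pathWord e 2 ++ junction e 2 :: (pathWord e 3 ++ junction e 3 ::
      (pathWord e 4 ++ junction e 4 :: (pathWord e 5 ++ junction e 5 ::
      (pathWord e 6 ++ junction e 6 :: (pathWord e 7 ++ [junction e 7])))))))
    rw [hw, hu]
    rfl
  have hstep : ∀ i j l, j = i + 1 → turns (pathWord e i ++ junction e i ::
      (pathWord e j ++ junction e j :: l)) = pathTurns (pathWord e) (junction e) i +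
        turns (pathWord e j ++ junction e j :: l) := by
    rintro i j l rfl
    obtain ⟨u, hu⟩ := hs.head_append (i + 1) l
    rw [add_sub_cancel_right] at hu
    exact Smooth.turns_append i hu rfl
  have h7 : turns (pathWord e 7 ++ [junction e 7, junction e 7 + 1]) =
      pathTurns (pathWord e) (junction e) 7 := rfl
  rw [h0, hw]
  simp only [List.append_assoc, List.cons_append, List.nil_append]
  rw [hstep 0 1 _ rfl, hstep 1 2 _ rfl, hstep 2 3 _ rfl, hstep 3 4 _ rfl, hstep 4 5 _ rfl,
    hstep 5 6 _ rfl, hstep 6 7 _ rfl, h7]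
  simp only [Pi.add_apply, pathTurns_eq]
  simp
  omega

theorem turns_eq_sum (l : List (Fin 8)) (c : Fin 4) (f : ℕ → Fin 8) (n : ℕ)
    (hn : l.length = n + 1) (hf : ∀ k, (hk : k < l.length) → f k = l[k]) :
    turns l c = ∑ k ∈ Finset.range n, turn (f k) (f (k + 1)) c := by
  induction n generalizing l f with
  | zero =>
    obtain ⟨a, rfl⟩ := List.length_eq_one_iff.1 hn
    rfl
  | succ n ih =>
    match l, hn with
    | a :: b :: l, hn =>
      rw [Finset.sum_range_succ', turns, Pi.add_apply, ih (b :: l) (fun k => f (k + 1))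
        (by simpa using hn) (fun k hk => by
          rw [hf (k + 1) (by simpa using hk)]; rfl), hf 0 (by simp), hf 1 (by simp), add_comm]
      rfl

theorem sum_turn_letter (e : List LiftType) (c : Fin 4) :
    ∑ k ∈ Finset.range (cycleWord e).length,
        turn (letter (cycleWord e) k) (letter (cycleWord e) (k + 1)) c =
      4 * ((counts e (turn 0 1 c, turn 1 2 c)).1 + (counts e (turn 0 1 c, turn 1 2 c)).2) := by
  rw [← turns_cycleWord, turns_eq_sum _ c (letter (cycleWord e)) (cycleWord e).length (by simp)]
  intro k hk
  have hk' : k ≤ (cycleWord e).length := by simpa [Nat.lt_succ_iff] using hk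
  rcases hk'.lt_or_eq with hlt | rfl
  · rw [List.getElem_append_left hlt, letter_eq_getElem hlt]
  · rw [List.getElem_concat_length rfl]
    exact letter_congr _ (by simp [Nat.ModEq])

/-! ## Transposed descents -/

/-- The exchange of `f` and `g`. -/
def LiftType.transpose : LiftType → LiftType
  | .f => .g
  | .g => .f
  | .h => .h
  | .hbar => .hbar

/-- The descent whose count matrix is the transpose of the one of `e`. -/
def transpose (e : List LiftType) : List LiftType := (e.map LiftType.transpose).reverse

/-- The matrices of f and g are transposes of each other and those of h and ħ are symmetric, so
transposing the product reverses the string and exchanges f with g. -/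
theorem counts_transpose (e : List LiftType) (u v : ℕ × ℕ) :
    (counts (transpose e) u).1 * v.1 + (counts (transpose e) u).2 * v.2 =
      u.1 * (counts e v).1 + u.2 * (counts e v).2 := by
  induction e generalizing u with
  | nil => rfl
  | cons t e ih =>
    have h : counts (transpose (t :: e)) u = counts (transpose e) (countStep t.transpose u) := by
      simp [counts, transpose]
    rw [h, ih]
    simp only [counts, List.foldr_cons]
    cases t <;> simp only [LiftType.transpose, countStep] <;> ring

theorem mem_transpose_iff (e : List LiftType) :
    (LiftType.h ∈ transpose e ↔ LiftType.h ∈ e) ∧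
      (LiftType.hbar ∈ transpose e ↔ LiftType.hbar ∈ e) := by
  constructor
  all_goals
    simp only [transpose, List.mem_reverse, List.mem_map]
    constructor
    · rintro ⟨t, ht, h⟩
      cases t <;> simp_all [LiftType.transpose]
    · intro h
      exact ⟨_, h, rfl⟩

theorem mem_companion_iff (e : List LiftType) :
    (LiftType.h ∈ companion e ↔ LiftType.hbar ∈ e) ∧
      (LiftType.hbar ∈ companion e ↔ LiftType.h ∈ e) := by
  constructor
  all_goals
    simp only [companion, List.mem_map]
    constructor
    · rintro ⟨t, ht, h⟩
      cases t <;> simp_all [LiftType.companion]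
    · intro h
      exact ⟨_, h, rfl⟩

/-! ## Cyclic direction graphs -/

/-- Vertices `a` and `b` of a cycle of length `n` are joined by an arc with label `i`. -/
def IsLink (n : ℕ) (lab : ℕ → SkewDir) (a : ℕ) (i : SkewDir) (b : ℕ) : Prop :=
  (b ≡ a + 1 [MOD n] ∧ i = lab a) ∨ (a ≡ b + 1 [MOD n] ∧ i = lab b + 4)

/-- `Φ` is a cycle of length `n` with the given labels. -/
def CyclicForm (n : ℕ) (lab : ℕ → SkewDir) (Φ : DirectionGraph) : Prop :=
  ∃ v : ℕ → Φ.V, Function.Surjective v ∧ (∀ a b, v a = v b ↔ a ≡ b [MOD n]) ∧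
    ∀ a i b, Φ.Arc (v a) i (v b) ↔ IsLink n lab a i b

/-- Backward arcs carry the opposite label, so the permutation has to commute with k ↦ k + 4. -/
theorem CyclicForm.equivalent {n : ℕ} {lab : ℕ → SkewDir} {Φ Ψ : DirectionGraph}
    {π : Equiv.Perm SkewDir} (hπ : IsEquivalencePerm π) (h4 : ∀ k, π (k + 4) = π k + 4)
    (h : CyclicForm n lab Φ) (h' : CyclicForm n (π ∘ lab) Ψ) : Φ.Equivalent Ψ := by
  obtain ⟨v, hv, hvn, h⟩ := h
  obtain ⟨v', hv', hvn', h'⟩ := h'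
  have hσ : ∀ a, v' (Function.surjInv hv (v a)) = v' a := fun a => by
    rw [hvn', ← hvn]
    exact Function.surjInv_eq hv _
  have hbij : Function.Bijective fun x => v' (Function.surjInv hv x) := by
    constructor
    · intro x y hxy
      obtain ⟨a, rfl⟩ := hv x
      obtain ⟨b, rfl⟩ := hv y
      simp only [hσ] at hxy
      rwa [hvn, ← hvn']
    · intro y
      obtain ⟨a, rfl⟩ := hv' y
      exact ⟨v a, hσ a⟩
  refine ⟨π, hπ, Equiv.ofBijective _ hbij, fun x i y => ?_⟩
  obtain ⟨a, rfl⟩ := hv x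
  obtain ⟨b, rfl⟩ := hv y
  simp only [Equiv.ofBijective_apply, hσ, h, h', IsLink, Function.comp_apply, ← h4,
    π.injective.eq_iff]

theorem CyclicForm.shift {n : ℕ} {lab : ℕ → SkewDir} {Φ : DirectionGraph} (hn : 0 < n)
    (h : CyclicForm n lab Φ) (m : ℕ) : CyclicForm n (fun a => lab (a + m)) Φ := by
  obtain ⟨v, hv, hvn, h⟩ := h
  refine ⟨fun a => v (a + m), fun x => ?_, fun a b => ?_, fun a i b => ?_⟩
  · obtain ⟨a, rfl⟩ := hv x
    refine ⟨a + (n * m - m), ?_⟩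
    have : m ≤ n * m := Nat.le_mul_of_pos_left m hn
    rw [hvn, add_assoc, Nat.sub_add_cancel this]
    simp [Nat.ModEq]
  · rw [hvn]
    exact ⟨Nat.ModEq.add_right_cancel' m, Nat.ModEq.add_right m⟩
  · rw [h, IsLink, IsLink, add_right_comm, add_right_comm b]
    have key : ∀ a b : ℕ, a + m ≡ b + m [MOD n] ↔ a ≡ b [MOD n] := fun a b =>
      ⟨Nat.ModEq.add_right_cancel' m, Nat.ModEq.add_right m⟩
    rw [key, key]

/-- The arcs leaving vertex a + 1 are labeled `lab (a + 1)` and `lab a + 4`. Since `partner c` is an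
involution without fixed points, the vertex is counted exactly when it pairs these two. -/
theorem CyclicForm.pairCount {n : ℕ} {lab : ℕ → SkewDir} {Φ : DirectionGraph} (hn : 0 < n)
    (hlab : ∀ a b, a ≡ b [MOD n] → lab a = lab b) (h : CyclicForm n lab Φ) (c : Fin 4) :
    Φ.pairCount c = ∑ k ∈ Finset.range n, turn (lab k) (lab (k + 1)) c := by
  obtain ⟨v, hv, hvn, h⟩ := h
  have key : ∀ (c : Fin 4) (x y : Fin 8), (∃ i, (i = x ∨ i = y + 4) ∧
      (partner c i = x ∨ partner c i = y + 4)) ↔ y + 4 = partner c x := by decide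
  have harc : ∀ a i, (∃ y, Φ.Arc (v (a + 1)) i y) ↔ i = lab (a + 1) ∨ i = lab a + 4 := by
    intro a i
    constructor
    · rintro ⟨y, hy⟩
      obtain ⟨b, rfl⟩ := hv y
      rw [h] at hy
      rcases hy with hy | hy
      · exact Or.inl hy.2
      · rw [hlab a b (Nat.ModEq.add_right_cancel' 1 hy.1)]
        exact Or.inr hy.2
    · rintro (rfl | rfl)
      · exact ⟨v (a + 1 + 1), (h _ _ _).2 (Or.inl ⟨Nat.ModEq.refl _, rfl⟩)⟩
      · exact ⟨v a, (h _ _ _).2 (Or.inr ⟨Nat.ModEq.refl _, rfl⟩)⟩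
  have hx : ∀ a, (∃ i y z, Φ.Arc (v (a + 1)) i y ∧ Φ.Arc (v (a + 1)) (partner c i) z) ↔
      lab a + 4 = partner c (lab (a + 1)) := by
    intro a
    rw [← key]
    refine exists_congr fun i => ?_
    rw [← harc, ← harc]
    simp only [exists_and_left, exists_and_right]
  have hset : {x | ∃ i y z, Φ.Arc x i y ∧ Φ.Arc x (partner c i) z} = (fun a => v (a + 1)) ''
      ((Finset.range n).filter fun a => lab a + 4 = partner c (lab (a + 1)) : Finset ℕ) := by
    ext x
    constructor
    · intro hxs
      obtain ⟨b, rfl⟩ := hv x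
      have hb : v (((b + (n - 1)) % n) + 1) = v b := by
        rw [hvn]
        refine ((Nat.mod_modEq _ n).add_right 1).trans ?_
        rw [add_assoc, Nat.sub_add_cancel hn]
        simp [Nat.ModEq]
      refine ⟨(b + (n - 1)) % n, ?_, hb⟩
      rw [Finset.coe_filter]
      refine ⟨Finset.mem_range.2 (Nat.mod_lt _ hn), ?_⟩
      rw [← hx, hb]
      exact hxs
    · rintro ⟨a, ha, rfl⟩
      rw [Finset.coe_filter] at ha
      exact (hx a).2 ha.2
  have hinj : Set.InjOn (fun a => v (a + 1)) ((Finset.range n).filter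
      fun a => lab a + 4 = partner c (lab (a + 1)) : Finset ℕ) := by
    intro a ha b hb hab
    rw [Finset.coe_filter] at ha hb
    have := Nat.ModEq.add_right_cancel' 1 ((hvn _ _).1 hab)
    exact this.eq_of_lt_of_lt (Finset.mem_range.1 ha.1) (Finset.mem_range.1 hb.1)
  have hcard : Φ.pairCount c = Set.ncard {x | ∃ i y z, Φ.Arc x i y ∧ Φ.Arc x (partner c i) z} := rfl
  rw [hcard, hset, hinj.ncard_image, Set.ncard_coe_finset, Finset.card_filter]
  rfl

/-! ## Second fundamental direction cycles -/

/-- The relabeling of the moves of the initial cycle of type `o`. -/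
def startPerm (o : OriginType) : Equiv.Perm SkewDir where
  toFun k := match o with
    | .f => if k.val % 2 = 0 then k + 3 else k + 1
    | .g => if k.val % 2 = 0 then k + 1 else k + 3
    | .h => k + 2
  invFun k := match o with
    | .f => if k.val % 2 = 0 then k - 1 else k - 3
    | .g => if k.val % 2 = 0 then k - 3 else k - 1
    | .h => k - 2
  left_inv := by cases o <;> decide
  right_inv := by cases o <;> decide

theorem startPerm_add_four (o : OriginType) (k : Fin 8) :
    startPerm o (k + 4) = startPerm o k + 4 := by
  revert k
  cases o <;> decide

theorem isEquivalencePerm_of_int {π : Equiv.Perm SkewDir} (P Q : Matrix (Fin 2) (Fin 2) ℤ)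
    (h : ∀ i, dirMatrix (π i) = P * dirMatrix i * Q) : IsEquivalencePerm π := by
  refine ⟨P.map (Int.castRingHom ℝ), Q.map (Int.castRingHom ℝ), fun i => ?_⟩
  rw [h]
  change Matrix.map _ (Int.castRingHom ℝ) = _
  rw [Matrix.map_mul, Matrix.map_mul]
  rfl

theorem isEquivalencePerm_startPerm (o : OriginType) : IsEquivalencePerm (startPerm o) :=
  match o with
  | .f => isEquivalencePerm_of_int !![0, -1; 1, 0] !![0, 1; 1, 0] (by decide)
  | .g => isEquivalencePerm_of_int !![0, -1; 1, 0] !![-1, 0; 0, 1] (by decide)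
  | .h => isEquivalencePerm_of_int !![0, -1; 1, 0] 1 (by decide)

/-- The origin affects the second cycle only by relabeling. The pair (q - 2p, p) equals (s, r), (-r,
s) or (r, s), which permutes the eight moves of the (r, s)-leaper. -/
theorem baseMove_startParams {A : Type*} [AddCommGroup A] (o : OriginType) (r s : A) (k : Fin 8) :
    baseMove (startParams o r s).1 (startParams o r s).2 k = moveVec r s (startPerm o k) := by
  cases o <;> fin_cases k <;> simp [baseMove, startParams, startPerm, moveVec] <;> abel

theorem moveVec_injective {r s : ℤ} (hr : 0 < r) (hrs : r < s) :
    Function.Injective (moveVec r s) := by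
  intro i j h
  fin_cases i <;> fin_cases j <;> simp [moveVec] at h ⊢ <;> omega

theorem letter_mem {X : Type*} [Inhabited X] {l : List X} (h : 0 < l.length) (a : ℕ) :
    letter l a ∈ l := List.mem_of_getElem? (getElem?_mod h a)

theorem letter_eq_iff {X : Type*} [Inhabited X] {l : List X} (hl : l.Nodup) (h : 0 < l.length)
    {a b : ℕ} : letter l a = letter l b ↔ a ≡ b [MOD l.length] := by
  refine ⟨fun hab => ?_, letter_congr l⟩
  have e : ∀ a, letter l a = l[a % l.length]'(Nat.mod_lt _ h) := fun a => by
    rw [letter, List.getD_eq_getElem _ _ (Nat.mod_lt _ h)]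
  rw [e, e] at hab
  exact (hl.getElem_inj_iff).1 hab

section Generic

variable {A : Type*} [AddCommGroup A]

theorem length_squares (p q : A) (e : List LiftType) :
    ((List.finRange 8).flatMap (cyc p q e)).length = (cycleWord e).length := by
  obtain ⟨x₀, h⟩ := closed_cyc p q e
  have := congrArg List.length h
  rw [length_walk, List.length_append, List.length_singleton] at this
  omega

variable [Inhabited A]

/-- The squares of a cycle, visited periodically. -/
def position (o : OriginType) (r s : A) (e : List LiftType) (a : ℕ) : A × A :=
  letter ((List.finRange 8).flatMap (cyc (startParams o r s).1 (startParams o r s).2 e)) a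

theorem position_congr (o : OriginType) (r s : A) (e : List LiftType) {a b : ℕ}
    (h : a ≡ b [MOD (cycleWord e).length]) : position o r s e a = position o r s e b := by
  rw [position, position]
  exact letter_congr _ (by rwa [length_squares])

theorem position_succ (o : OriginType) (r s : A) (e : List LiftType) (a : ℕ) :
    position o r s e (a + 1) =
      position o r s e a + moveVec r s (startPerm o (letter (cycleWord e) a)) := by
  obtain ⟨x₀, h⟩ := closed_cyc (startParams o r s).1 (startParams o r s).2 e
  rw [← baseMove_startParams]
  exact letter_succ_of_closed h (cycleWord_ne_nil e) a

end Generic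

theorem exists_link {r s : ℕ} (hr : 0 < r) (hrs : r < s) (o : OriginType) (e : List LiftType) :
    ∃ v : ℕ → OctoPath.board (secondCycle r s o e), Function.Surjective v ∧
      (∀ a b, v a = v b ↔ a ≡ b [MOD (cycleWord e).length]) ∧
      ∀ a i b, ((OctoPath.cycleGraph (secondCycle r s o e)).Adj (v a) (v b) ∧
        IsMoveOfDir r s i (v a : Square) (v b : Square)) ↔
          IsLink (cycleWord e).length (startPerm o ∘ letter (cycleWord e)) a i b := by
  have hr' : (0 : ℤ) < r := by omega
  have hrs' : (r : ℤ) < s := by omega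
  have hpos := startParams_pos hr' hrs' o
  have hnd := squares_nodup hpos.1 hpos.2 e
  obtain ⟨X, hX⟩ : ∃ X, X = OctoPath.squares (secondCycle r s o e) := ⟨_, rfl⟩
  have hX' : X = (List.finRange 8).flatMap
      (cyc (startParams o (r : ℤ) s).1 (startParams o (r : ℤ) s).2 e) := by
    rw [hX, secondCycle_eq, OctoPath.squares]
  rw [← secondCycle_eq, ← hX] at hnd
  have hlen : X.length = (cycleWord e).length := by rw [hX', length_squares]
  have hn : 0 < X.length := hlen ▸ cycleWord_ne_nil e
  have hpos : ∀ a, position o (r : ℤ) s e a = letter X a := fun a => by rw [hX']; rfl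
  have hmem : ∀ a, position o (r : ℤ) s e a ∈ OctoPath.board (secondCycle r s o e) := fun a => by
    rw [hpos, OctoPath.board, ← hX]
    exact letter_mem hn a
  have hinj : ∀ a b, position o (r : ℤ) s e a = position o (r : ℤ) s e b ↔
      a ≡ b [MOD (cycleWord e).length] := fun a b => by
    rw [hpos, hpos, letter_eq_iff hnd hn, hlen]
  have hnext : ∀ a b, (∃ k < X.length, X[k]? = some (position o (r : ℤ) s e a) ∧
      X[(k + 1) % X.length]? = some (position o (r : ℤ) s e b)) ↔
      b ≡ a + 1 [MOD (cycleWord e).length] := by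
    intro a b
    constructor
    · rintro ⟨k, hk, h1, h2⟩
      rw [← Nat.mod_eq_of_lt hk, getElem?_mod hn, Option.some_inj, ← hpos, hinj] at h1
      rw [getElem?_mod hn, Option.some_inj, ← hpos, hinj] at h2
      exact h2.symm.trans (h1.add_right 1)
    · intro h
      refine ⟨a % X.length, Nat.mod_lt _ hn, ?_, ?_⟩
      · rw [getElem?_mod hn, hpos]
      · rw [getElem?_mod hn, ← hpos, Option.some_inj, hinj, ← hlen]
        exact ((Nat.mod_modEq a X.length).add_right 1).trans (hlen ▸ h.symm)
  refine ⟨fun a => ⟨position o (r : ℤ) s e a, hmem a⟩, ?_, ?_, ?_⟩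
  · rintro ⟨x, hx⟩
    rw [OctoPath.board, ← hX] at hx
    obtain ⟨k, hk, rfl⟩ := List.mem_iff_getElem.1 hx
    exact ⟨k, Subtype.ext ((hpos k).trans (letter_eq_getElem hk))⟩
  · intro a b
    rw [Subtype.mk.injEq, hinj]
  · intro a i b
    rw [isMoveOfDir_iff, OctoPath.cycleGraph, SimpleGraph.fromRel_adj, ← hX]
    simp only [hnext, ne_eq, Subtype.mk.injEq]
    have hne : ∀ a b, b ≡ a + 1 [MOD (cycleWord e).length] →
        position o (r : ℤ) s e a ≠ position o (r : ℤ) s e b := by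
      intro a b h heq
      rw [position_congr o (r : ℤ) (s : ℤ) e h, position_succ] at heq
      exact moveVec_ne_zero hr' _ _ (left_eq_add.1 heq)
    have hfwd : ∀ a b, b ≡ a + 1 [MOD (cycleWord e).length] → ∀ i,
        (position o (r : ℤ) s e b = position o (r : ℤ) s e a + moveVec (r : ℤ) s i ↔
          i = startPerm o (letter (cycleWord e) a)) := by
      intro a b h i
      rw [position_congr o (r : ℤ) (s : ℤ) e h, position_succ, add_right_inj,
        (moveVec_injective hr' hrs').eq_iff, eq_comm]
    have hbwd : ∀ a b, a ≡ b + 1 [MOD (cycleWord e).length] → ∀ i,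
        (position o (r : ℤ) s e b = position o (r : ℤ) s e a + moveVec (r : ℤ) s i ↔
          i = startPerm o (letter (cycleWord e) b) + 4) := by
      intro a b h i
      rw [position_congr o (r : ℤ) (s : ℤ) e h, position_succ, add_assoc, left_eq_add,
        ← neg_eq_iff_add_eq_zero, ← moveVec_add_four, (moveVec_injective hr' hrs').eq_iff, eq_comm]
    constructor
    · rintro ⟨⟨-, h | h⟩, h'⟩
      · exact Or.inl ⟨h, (hfwd a b h i).1 h'⟩
      · exact Or.inr ⟨h, (hbwd a b h i).1 h'⟩
    · rintro (⟨h, h'⟩ | ⟨h, h'⟩)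
      · exact ⟨⟨hne a b h, Or.inl h⟩, (hfwd a b h i).2 h'⟩
      · exact ⟨⟨(hne b a h).symm, Or.inr h⟩, (hbwd a b h i).2 h'⟩

theorem exists_extractedFromSecond {r s : ℕ} (hr : 0 < r) (hrs : r < s) (o : OriginType)
    (e : List LiftType) : ∃ Φ, ExtractedFromSecond r s o e Φ := by
  obtain ⟨v, hv, hvn, hlink⟩ := exists_link hr hrs o e
  have hI : Indep (1, 0) (0, 1) := by simp [Indep]
  let Φ := DirectionGraph.ofPotential hI (OctoPath.board (secondCycle r s o e))
    -- The potential is the formal position of a square. The index chosen by `surjInv` is determined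
    -- modulo the length of the cycle, which suffices by `position_congr`.
    (fun x => position o ((1, 0) : ℤ × ℤ) (0, 1) e (Function.surjInv hv x))
    (fun x i y => (OctoPath.cycleGraph (secondCycle r s o e)).Adj x y ∧
      IsMoveOfDir r s i (x : Square) (y : Square))
    (by
      intro x i y h
      have hx := Function.surjInv_eq hv x
      have hy := Function.surjInv_eq hv y
      rw [← hx, ← hy, hlink] at h
      rcases h with ⟨h, rfl⟩ | ⟨h, rfl⟩
      · rw [position_congr _ _ _ _ h, position_succ]
        rfl
      · rw [position_congr _ _ _ _ h, position_succ, moveVec_add_four]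
        exact (add_neg_cancel_right _ _).symm)
    (by
      rintro x y i ⟨h1, h2⟩
      refine ⟨i + 4, h1.symm, ?_⟩
      rw [isMoveOfDir_iff] at h2 ⊢
      rw [h2, moveVec_add_four]
      exact (add_neg_cancel_right _ _).symm)
  exact ⟨Φ, Equiv.refl _, fun a b i => Iff.rfl⟩

theorem IsSecondFundamental.cyclicForm {o : OriginType} {e : List LiftType} {Φ : DirectionGraph}
    (h : IsSecondFundamental o e Φ) :
    CyclicForm (cycleWord e).length (startPerm o ∘ letter (cycleWord e)) Φ := by
  obtain ⟨r, s, hr, hrs, σ, h⟩ := h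
  obtain ⟨v, hv, hvn, hlink⟩ := exists_link hr hrs o e
  exact ⟨σ ∘ v, σ.surjective.comp hv, fun a b => by simp [hvn], fun a i b => by
    rw [← hlink, h]; rfl⟩

/-- The initial turn vector is (1, 0) for pairing 2, (0, 1) for pairing 1 and zero otherwise.
Summing over all sections gives 4 times (1, 1) · M · v with M the matrix of e, so the nonzero counts
are the coordinates of 4 Mᵀ(1, 1). -/
theorem IsSecondFundamental.hasCounts {o : OriginType} {e : List LiftType} {Φ : DirectionGraph}
    (h : IsSecondFundamental o e Φ) : Φ.HasCounts (4 * (counts (transpose e) (1, 1)).1)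
      (4 * (counts (transpose e) (1, 1)).2) := by
  obtain ⟨τ, hτ⟩ := (isEquivalencePerm_startPerm o).exists_perm
  have key : ∀ c, Φ.pairCount (τ c) =
      4 * ((counts e (turn 0 1 c, turn 1 2 c)).1 + (counts e (turn 0 1 c, turn 1 2 c)).2) := by
    intro c
    rw [h.cyclicForm.pairCount (cycleWord_ne_nil e)
      (fun a b hab => congrArg (startPerm o) (letter_congr _ hab)), ← sum_turn_letter]
    refine Finset.sum_congr rfl fun k _ => ?_
    simp only [turn, ← hτ, ← startPerm_add_four, (startPerm o).injective.eq_iff]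
  have ht := fun v => counts_transpose e (1, 1) v
  have h2 := ht (1, 0)
  have h1 := ht (0, 1)
  simp only [one_mul, mul_one, mul_zero, add_zero, zero_add] at h1 h2
  have h00 := ht (0, 0)
  simp only [one_mul, mul_zero, add_zero] at h00
  refine ⟨τ 2, τ 1, τ.injective.ne (by decide), ?_, ?_, fun x hx2 hx1 => ?_⟩
  · rw [key, h2]; rfl
  · rw [key, h1]; rfl
  · obtain ⟨c, rfl⟩ := τ.surjective x
    have hc : ∀ c : Fin 4, c ≠ 2 → c ≠ 1 → c = 0 ∨ c = 3 := by decide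
    replace hc := hc c (ne_of_apply_ne τ hx2) (ne_of_apply_ne τ hx1)
    rw [key]
    rcases hc with rfl | rfl
    · exact congrArg (4 * ·) h00.symm
    · exact congrArg (4 * ·) h00.symm

theorem IsSecondFundamental.equivalent {o o' : OriginType} {e : List LiftType}
    {Φ Ψ : DirectionGraph} (h : IsSecondFundamental o e Φ) (h' : IsSecondFundamental o' e Ψ) :
    Φ.Equivalent Ψ := by
  have hπ := (isEquivalencePerm_startPerm o).symm.trans (isEquivalencePerm_startPerm o')
  refine h.cyclicForm.equivalent hπ (fun k => ?_) ?_
  · obtain ⟨k, rfl⟩ := (startPerm o).surjective k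
    rw [← startPerm_add_four]
    simp only [Equiv.trans_apply, Equiv.symm_apply_apply]
    exact startPerm_add_four o' k
  · convert h'.cyclicForm using 1
    funext a
    simp

/-- The relabeling undoes the first origin, adds 1, and applies the second origin; the rotation of
the cyclic word is a change of starting vertex. -/
theorem IsSecondFundamental.equivalent_companion {o o' : OriginType} {e : List LiftType}
    {Φ Ψ : DirectionGraph} (h : IsSecondFundamental o e Φ)
    (h' : IsSecondFundamental o' (companion e) Ψ) : Φ.Equivalent Ψ := by
  obtain ⟨m, hm⟩ := cycleWord_companion e
  have hn : (cycleWord (companion e)).length = (cycleWord e).length := by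
    have := congrArg List.length hm
    simpa using this
  have hlab : ∀ a, letter (cycleWord (companion e)) (a + m) = letter (cycleWord e) a + 1 := by
    intro a
    rw [← letter_rotate, hm, letter_map _ (cycleWord_ne_nil e)]
  have hπ := ((isEquivalencePerm_startPerm o).symm.trans isEquivalencePerm_addRight_one).trans
    (isEquivalencePerm_startPerm o')
  refine h.cyclicForm.equivalent hπ (fun k => ?_) ?_
  · obtain ⟨k, rfl⟩ := (startPerm o).surjective k
    rw [← startPerm_add_four]
    simp only [Equiv.trans_apply, Equiv.symm_apply_apply, Equiv.coe_addRight]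
    rw [add_right_comm, startPerm_add_four]
  · have := h'.cyclicForm.shift (cycleWord_ne_nil _) m
    rw [hn] at this
    convert this using 1
    funext a
    simp [hlab]

/-! ## The main theorem -/

theorem IsFundamental.hasCounts {e : List LiftType} {Φ : DirectionGraph} (h : IsFundamental e Φ) :
    Φ.HasCounts (4 * (counts e (1, 1)).1) (4 * (counts e (1, 1)).2) := h.moveForm.hasCounts

/-- The counts of a direction cycle are those of a string with the same uses of `h` and `ħ`. -/
theorem IsFundamentalOrSecond.hasCounts {e : List LiftType} {Φ : DirectionGraph}
    (h : IsFundamentalOrSecond e Φ) : ∃ e', (LiftType.h ∈ e' ↔ LiftType.h ∈ e) ∧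
      (LiftType.hbar ∈ e' ↔ LiftType.hbar ∈ e) ∧
      Φ.HasCounts (4 * (counts e' (1, 1)).1) (4 * (counts e' (1, 1)).2) := by
  rcases h with h | ⟨o, h⟩
  · exact ⟨e, Iff.rfl, Iff.rfl, h.hasCounts⟩
  · exact ⟨transpose e, (mem_transpose_iff e).1, (mem_transpose_iff e).2, h.hasCounts⟩

/-- If ħ occurs then h does not, and the companion is free of ħ. Since all origins are equivalent, a
second cycle of origin f can be replaced by one of origin g. -/
theorem IsFundamentalOrSecond.exists_isClassical {e : List LiftType} {Φ : DirectionGraph}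
    (h : IsFundamentalOrSecond e Φ) (he : ¬ (LiftType.h ∈ e ∧ LiftType.hbar ∈ e)) :
    ∃ Ψ, IsClassical Ψ ∧ Φ.Equivalent Ψ := by
  by_cases hb : LiftType.hbar ∈ e
  · have hb' : LiftType.hbar ∉ companion e := by
      rw [(mem_companion_iff e).2]
      exact fun hh => he ⟨hh, hb⟩
    rcases h with h | ⟨o, h⟩
    · obtain ⟨Ψ, hΨ⟩ := exists_extractedFromFirst one_pos one_lt_two .g (companion e)
      have hΨ : IsFundamental (companion e) Ψ := ⟨1, 2, one_pos, one_lt_two, .g, hΨ⟩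
      exact ⟨Ψ, ⟨_, hb', Or.inl hΨ⟩, h.moveForm.equivalent_companion hΨ.moveForm⟩
    · obtain ⟨Ψ, hΨ⟩ := exists_extractedFromSecond one_pos one_lt_two .g (companion e)
      have hΨ : IsSecondFundamental .g (companion e) Ψ := ⟨1, 2, one_pos, one_lt_two, hΨ⟩
      exact ⟨Ψ, ⟨_, hb', Or.inr (Or.inl hΨ)⟩, h.equivalent_companion hΨ⟩
  · rcases h with h | ⟨o, h⟩
    · exact ⟨Φ, ⟨_, hb, Or.inl h⟩, .refl Φ⟩
    · obtain ⟨Ψ, hΨ⟩ := exists_extractedFromSecond one_pos one_lt_two .g e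
      have hΨ : IsSecondFundamental .g e Ψ := ⟨1, 2, one_pos, one_lt_two, hΨ⟩
      exact ⟨Ψ, ⟨_, hb, Or.inr (Or.inl hΨ)⟩, h.equivalent hΨ⟩

theorem IsClassical.hasCounts {Ψ : DirectionGraph} (h : IsClassical Ψ) :
    ∃ e, LiftType.hbar ∉ e ∧ Ψ.HasCounts (4 * (counts e (1, 1)).1) (4 * (counts e (1, 1)).2) := by
  obtain ⟨e, he, h⟩ := h
  have h' : IsFundamentalOrSecond e Ψ := by
    rcases h with h | h | h
    exacts [Or.inl h, Or.inr ⟨_, h⟩, Or.inr ⟨_, h⟩]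
  obtain ⟨e', -, hb, hc⟩ := h'.hasCounts
  exact ⟨e', fun hh => he (hb.1 hh), hc⟩

/-- The counts of Φ belong to a string with both h and ħ, so that string and its companion both
contain ħ, whereas the counts of Ψ belong to a string without it. -/
theorem IsFundamentalOrSecond.not_equivalent {e : List LiftType} {Φ Ψ : DirectionGraph}
    (h : IsFundamentalOrSecond e Φ) (hh : LiftType.h ∈ e) (hb : LiftType.hbar ∈ e)
    (hΨ : IsClassical Ψ) : ¬ Φ.Equivalent Ψ := by
  intro hΦΨ
  obtain ⟨e', hh', hb', hc⟩ := h.hasCounts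
  obtain ⟨e₁, he₁, hc₁⟩ := hΨ.hasCounts
  rcases eq_or_companion_of_equivalent hc hc₁ hΦΨ with rfl | rfl
  · exact he₁ (hb'.2 hb)
  · exact he₁ ((mem_companion_iff _).2.2 (hh'.2 hh))

end LeaperGraphs

theorem mainTheorem10 :
    -- the direction graphs in question exist: they can be extracted from the cycles
    (∀ r s : ℕ, 0 < r → r < s → ∀ (o : LeaperGraphs.OriginType) (e : List LeaperGraphs.LiftType),
      (∃ Φ, LeaperGraphs.ExtractedFromFirst r s o e Φ) ∧
      (∃ Φ, LeaperGraphs.ExtractedFromSecond r s o e Φ)) ∧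
    -- coincidence of fundamental direction cycles
    (∀ (e₁ e₂ : List LeaperGraphs.LiftType) (Φ₁ Φ₂ : LeaperGraphs.DirectionGraph),
      LeaperGraphs.IsFundamental e₁ Φ₁ → LeaperGraphs.IsFundamental e₂ Φ₂ →
        (Φ₁.Coincide Φ₂ ↔ e₁ = e₂)) ∧
    -- equivalence of fundamental direction cycles
    (∀ (e₁ e₂ : List LeaperGraphs.LiftType) (Φ₁ Φ₂ : LeaperGraphs.DirectionGraph),
      LeaperGraphs.IsFundamental e₁ Φ₁ → LeaperGraphs.IsFundamental e₂ Φ₂ →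
        (Φ₁.Equivalent Φ₂ ↔ e₁ = e₂ ∨ e₂ = LeaperGraphs.companion e₁)) ∧
    -- which graphs of the large family are new
    (∀ (e : List LeaperGraphs.LiftType) (Φ : LeaperGraphs.DirectionGraph),
      LeaperGraphs.IsFundamentalOrSecond e Φ →
        ((∀ Ψ, LeaperGraphs.IsClassical Ψ → ¬ Φ.Equivalent Ψ) ↔
          LeaperGraphs.LiftType.h ∈ e ∧ LeaperGraphs.LiftType.hbar ∈ e)) := by
  refine ⟨fun r s hr hrs o e => ⟨LeaperGraphs.exists_extractedFromFirst hr hrs o e,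
    LeaperGraphs.exists_extractedFromSecond hr hrs o e⟩, ?_, ?_, ?_⟩
  · intro e₁ e₂ Φ₁ Φ₂ h₁ h₂
    refine ⟨LeaperGraphs.eq_of_coincide h₁.moveForm h₂.moveForm, ?_⟩
    rintro rfl
    exact h₁.moveForm.coincide h₂.moveForm
  · intro e₁ e₂ Φ₁ Φ₂ h₁ h₂
    refine ⟨LeaperGraphs.eq_or_companion_of_equivalent h₁.hasCounts h₂.hasCounts, ?_⟩
    rintro (rfl | rfl)
    · exact (h₁.moveForm.coincide h₂.moveForm).equivalent
    · exact h₁.moveForm.equivalent_companion h₂.moveForm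
  · intro e Φ h
    constructor
    · intro hnew
      by_contra he
      obtain ⟨Ψ, hΨ, hΦΨ⟩ := h.exists_isClassical he
      exact hnew Ψ hΨ hΦΨ
    · rintro ⟨hh, hb⟩ Ψ hΨ
      exact h.not_equivalent hh hb hΨ
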